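/- **Setting.** Let $(a_n)_{n}$ be a sequence of random real symmetric $n\times n$ matrices on a probability space, whose entries have finite moments of all orders. For each $n$ let $\sim_n$ be an equivalence relation on $\{1,\dots,n\}^2$ with $(p,q)\sim_n(q,p)$ for all $p,q$, such that for some $B\in\mathbb N$ independent of $n$: - (E1) $\max_p \#\{(q,r,s): (p,q)\sim_n(r,s)\}=o(n^2)$, - (E2) $\max_{p,q,r}\#\{s:(p,q)\sim_n(r,s)\}\le B$, - (E3) $\#\{(p,q,r):(p,q)\sim_n(q,r),\ r\ne p\}=o(n^2)$. Assume there are constants $C(m)$ and sequences $C^{(s)}_n\to0$ ($n\to\infty$, each $s\ge 0$) such that for all $n$, all $s,\ell\ge0$ and all $P_1,\dots,P_s,Q_1,\dots,Q_\ell\in\{1,\dots,n\}^2$ and $\delta_1,\dots,\delta_\ell\ge1$: - (A1) if the $P_i$ lie in pairwise distinct $\sim_n$-classes, the $Q_j$ are distinct, and no $Q_j$ is equivalent to any $P_i$, then $$\bigl|\mathbb E\, a_n(P_1)\cdots a_n(P_s)\,a_n(Q_1)^{\delta_1}\cdots a_n(Q_\ell)^{\delta_\ell}\bigr|\le \frac{C(s+\delta_1+\dots+\delta_\ell)}{n^{s/2}};$$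 - (A2) if the $P_i$ lie in pairwise distinct $\sim_n$-classes, then $|\mathbb E\, a_n(P_1)^2\cdots a_n(P_s)^2-1|\le C^{(s)}_n$. (Such $(a_n)$ is called SSB-HKW correlated.) Let $w:[0,1]\to\mathbb R$ be Riemann integrable, $X_n=n^{-1/2}\,[\,w(|i-j|/n)\,a_n(i,j)\,]_{1\le i,j\le n}$, and let $\sigma_n$ be the empirical spectral distribution of $X_n$. **The constants $J_w(\pi)$.** Let $\mathcal{NPP}(k)$ be the set of non-crossing pair partitions of $\{1,\dots,k\}$. For $\pi\in\mathcal{NPP}(k)$ define the path $t^\pi$ by $t_1=1$ and, for $1\le l<k$, $t_{l+1}=t_{l'}$ if $l$ is paired by $\pi$ with some $l'<l$, and $t_{l+1}=\max(t_1,\dots,t_l)+1$ otherwise; set $t_{k+1}=t_1$. It visits $k/2+1$ labels, and $$J_w(\pi)=\int_{[0,1]^{k/2+1}}\prod_{i=1}^{k} w\bigl(|x_{t_i}-x_{t_{i+1}}|\bigr)\,dx ,$$ with $J_w(\emptyset)=J_w(\emptyset\,|\,x)=1$ for $k=0$. For a label $v$ let $J_w(\pi\,|\,x_v)$ be the same integral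 with $x_v$ fixed and the remaining $k/2$ variables integrated over $[0,1]$. Put $\varphi(x)=\int_0^1 w^2(|x-y|)\,dy$ for $x\in[0,1]$, and $\varphi_0=\int_0^1\varphi(x)\,dx$. **Theorem.** 1. There is a probability measure $\mu$ on $\mathbb R$, symmetric and compactly supported, such that $\sigma_n\to\mu$ weakly in probability. For all $k$, $\int x^k\,d\mu=\sum_{\pi\in\mathcal{NPP}(k)}J_w(\pi)$, and $\mu$ is the only probability measure with these moments. 2. The $J_w(\pi)$ can be calculated recursively: if $\{m,m+1\}\in\pi\in\mathcal{NPP}(k)$ and $\tilde\pi\in\mathcal{NPP}(k-2)$ arises from $\pi$ by deleting this block and relabelling increasingly, then $J_w(\pi)=\int_0^1\varphi(x)\,J_w(\tilde\pi\,|\,x_{t^\pi_m}=x)\,dx$. 3. $\int x^2\,d\mu=\varphi_0=2\int_0^1(1-x)w^2(x)\,dx$, and $\varphi_0=0$ if and only if $w=0$ Lebesgue-almost everywhere on $[0,1]$. 4. If $\varphi_0>0$, the following are equivalent: (a) the semicircle law holds in probability for $X_n/\sqrt{\varphi_0}$, i.e. its empirical spectral distributions converge weakly in probability to the standard semicircle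 distribution; (b) $\varphi$ is constant on $[0,1]$; (b') $\varphi\equiv\varphi_0$ on $[0,1]$; (c) $\varphi\equiv\int_0^1w^2(z)\,dz$ on $[0,1]$; (d) $w^2(x)=w^2(1-x)$ for Lebesgue-almost all $x\in[0,1]$. 5. Suppose in addition that for some $\delta>0$ the quantities in (E1) and (E3) are $O(n^{2-\delta})$ (conditions (E1') and (E3')), and that $\sum_n C^{(s)}_n$ converges for every $s$. Then weak convergence in probability can be replaced by almost sure weak convergence in 1 and in 4(a). -/

import Mathlib

open MeasureTheory Filter Topology Asymptotics

noncomputable section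

namespace WeightedEnsemble

/-! ### Riemann integrability, weighted matrices, spectral distributions -/

/-- Riemann (Darboux) integrability on `[0,1]`: for every `ε > 0` there are a partition
`0 = t 0 ≤ t 1 ≤ ⋯ ≤ t N = 1` and real lower and upper bounds `m i`, `M i` of `f` on the `i`-th
closed cell, with upper sum minus lower sum less than `ε`.  Boundedness is implied.  Only the
values of `f` on `[0,1]` matter. -/
def RiemannIntegrableUnit (f : ℝ → ℝ) : Prop :=
  ∀ ε : ℝ, 0 < ε → ∃ (N : ℕ) (t m M : ℕ → ℝ), Monotone t ∧ t 0 = 0 ∧ t N = 1 ∧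
    (∀ i < N, ∀ x ∈ Set.Icc (t i) (t (i + 1)), m i ≤ f x ∧ f x ≤ M i) ∧
    ∑ i ∈ Finset.range N, (M i - m i) * (t (i + 1) - t i) < ε

/-- The matrix `n^{-1/2} [w(|i-j|/n) A(i,j)]`. -/
def weightedMatrix (w : ℝ → ℝ) (n : ℕ) (A : Matrix (Fin n) (Fin n) ℝ) :
    Matrix (Fin n) (Fin n) ℝ :=
  Matrix.of fun i j => 1 / √(n : ℝ) * (w (|(i : ℝ) - (j : ℝ)| / n) * A i j)

/-- Empirical spectral distribution of a real symmetric matrix: mass `1/n` at each eigenvalue,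
counted with multiplicity (the eigenvalues are the roots of the characteristic polynomial, all
of which are real for a symmetric matrix). -/
def esd {n : ℕ} (A : Matrix (Fin n) (Fin n) ℝ) : Measure ℝ :=
  (n : ENNReal)⁻¹ • (A.charpoly.roots.map fun x => Measure.dirac x).sum

/-- The standard semicircle distribution: density `√(4-x²)/(2π)` on `[-2,2]`
(the real square root vanishes for `|x| > 2`). -/
def semicircle : Measure ℝ :=
  volume.withDensity fun x => ENNReal.ofReal (√(4 - x ^ 2) / (2 * Real.pi))

/-- Weak convergence in probability of random measures `σ n` to the deterministic `μ`. -/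
def WeakConvInProb {Ω : Type*} [MeasurableSpace Ω] (P : Measure Ω)
    (σ : ℕ → Ω → Measure ℝ) (μ : Measure ℝ) : Prop :=
  ∀ f : BoundedContinuousFunction ℝ ℝ,
    TendstoInMeasure P (fun n ω => ∫ x, f x ∂(σ n ω)) atTop (fun _ => ∫ x, f x ∂μ)

/-- Almost sure weak convergence of random measures `σ n` to the deterministic `μ`. -/
def WeakConvAS {Ω : Type*} [MeasurableSpace Ω] (P : Measure Ω)
    (σ : ℕ → Ω → Measure ℝ) (μ : Measure ℝ) : Prop :=
  ∀ᵐ ω ∂P, ∀ f : BoundedContinuousFunction ℝ ℝ,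
    Tendsto (fun n => ∫ x, f x ∂(σ n ω)) atTop (𝓝 (∫ x, f x ∂μ))

/-! ### SSB-HKW correlated schemes -/

/-- `#{(q,r,s) : (p,q) ∼ (r,s)}`. -/
def countE1 {n : ℕ} (R : Setoid (Fin n × Fin n)) (p : Fin n) : ℕ :=
  {x : Fin n × Fin n × Fin n | R (p, x.1) (x.2.1, x.2.2)}.ncard

/-- `max_p #{(q,r,s) : (p,q) ∼ (r,s)}`. -/
def maxE1 {n : ℕ} (R : Setoid (Fin n × Fin n)) : ℕ :=
  Finset.univ.sup fun p : Fin n => countE1 R p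

/-- `#{s : (p,q) ∼ (r,s)}`. -/
def countE2 {n : ℕ} (R : Setoid (Fin n × Fin n)) (p q r : Fin n) : ℕ :=
  {s : Fin n | R (p, q) (r, s)}.ncard

/-- `#{(p,q,r) : (p,q) ∼ (q,r), r ≠ p}`. -/
def countE3 {n : ℕ} (R : Setoid (Fin n × Fin n)) : ℕ :=
  {x : Fin n × Fin n × Fin n | R (x.1, x.2.1) (x.2.1, x.2.2) ∧ x.2.2 ≠ x.1}.ncard

/-- `(a n)` is an SSB-HKW correlated scheme of random real symmetric matrices with respect to the
equivalence relations `R n` on index pairs, with constants `C` and sequences `D s`.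
In `condA1` the classes of the pairs `P i` are distinct and contain no other pair of the list;
the pairs `Q j` are distinct and otherwise arbitrary. -/
structure IsSSBHKW {Ω : Type*} [MeasurableSpace Ω] (ℙ : Measure Ω)
    (a : (n : ℕ) → Ω → Matrix (Fin n) (Fin n) ℝ)
    (R : (n : ℕ) → Setoid (Fin n × Fin n)) (C : ℕ → ℝ) (D : ℕ → ℕ → ℝ) : Prop where
  measurable_entry : ∀ n i j, Measurable fun ω => a n ω i j
  symm : ∀ n ω, (a n ω).IsSymm
  /-- all moments of the entries exist -/
  moments : ∀ n i j (k : ℕ), MemLp (fun ω => a n ω i j) k ℙ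
  rel_swap : ∀ n (p q : Fin n), R n (p, q) (q, p)
  condE1 : (fun n => (maxE1 (R n) : ℝ)) =o[atTop] fun n : ℕ => (n : ℝ) ^ 2
  condE2 : ∃ B : ℕ, ∀ n (p q r : Fin n), countE2 (R n) p q r ≤ B
  condE3 : (fun n => (countE3 (R n) : ℝ)) =o[atTop] fun n : ℕ => (n : ℝ) ^ 2
  condA1 : ∀ (n s l : ℕ) (P : Fin s → Fin n × Fin n) (Q : Fin l → Fin n × Fin n) (δ : Fin l → ℕ),
    (∀ i j, i ≠ j → ¬ R n (P i) (P j)) → (∀ i j, ¬ R n (P i) (Q j)) → Function.Injective Q →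
    (∀ j, 1 ≤ δ j) →
    |∫ ω, (∏ i, a n ω (P i).1 (P i).2) * ∏ j, a n ω (Q j).1 (Q j).2 ^ δ j ∂ℙ| ≤
      C (s + ∑ j, δ j) / (n : ℝ) ^ ((s : ℝ) / 2)
  tendsto_D : ∀ s, Tendsto (D s) atTop (𝓝 0)
  condA2 : ∀ (n s : ℕ) (P : Fin s → Fin n × Fin n), (∀ i j, i ≠ j → ¬ R n (P i) (P j)) →
    |(∫ ω, ∏ i, a n ω (P i).1 (P i).2 ^ 2 ∂ℙ) - 1| ≤ D s n

/-- The strengthened counting conditions (with a common exponent `δ > 0`). -/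
def StrongE (R : (n : ℕ) → Setoid (Fin n × Fin n)) : Prop :=
  ∃ δ : ℝ, 0 < δ ∧
    ((fun n => (maxE1 (R n) : ℝ)) =O[atTop] fun n : ℕ => (n : ℝ) ^ (2 - δ)) ∧
    ((fun n => (countE3 (R n) : ℝ)) =O[atTop] fun n : ℕ => (n : ℝ) ^ (2 - δ))

/-! ### Non-crossing pair partitions and the constants `J_w(π)` -/

/-- Partitions of the index set `{0, …, k-1}`. -/
abbrev Ptn (k : ℕ) : Type := Finpartition (Finset.univ : Finset (Fin k))

/-- All blocks have two elements, and no two blocks `{a,c}`, `{b,d}` cross. -/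
def IsNonCrossingPairing {k : ℕ} (π : Ptn k) : Prop :=
  (∀ B ∈ π.parts, B.card = 2) ∧
    ¬ ∃ a b c d : Fin k, a < b ∧ b < c ∧ c < d ∧
      ({a, c} : Finset (Fin k)) ∈ π.parts ∧ ({b, d} : Finset (Fin k)) ∈ π.parts

open Classical in
/-- The finite set of non-crossing pair partitions of `k` points. -/
def ncPairings (k : ℕ) : Finset (Ptn k) :=
  Finset.univ.filter IsNonCrossingPairing

/-- The indices `i` and `j` lie in the same block. -/
def Linked {k : ℕ} (π : Ptn k) (i j : ℕ) : Prop :=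
  ∃ B ∈ π.parts, (∃ x ∈ B, (x : ℕ) = i) ∧ ∃ y ∈ B, (y : ℕ) = j

instance {k : ℕ} (π : Ptn k) (i j : ℕ) : Decidable (Linked π i j) := by
  unfold Linked; infer_instance

/-- The canonical `π`-backtracking path `t_0, t_1, …` (everything indexed from `0`; edge `l` runs
from `t_l` to `t_{l+1}`).  If edge `l` is linked to an earlier edge `i`, then it returns to
`t_{l+1} = t_i`; otherwise `t_{l+1}` is the next unused label. -/
def canonicalPath {k : ℕ} (π : Ptn k) : ℕ → ℕ
  | 0 => 0
  | l + 1 =>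
    if h : ∃ i, i < l ∧ Linked π i l then canonicalPath π (Nat.find h)
    else (Finset.univ.sup fun i : Fin (l + 1) => canonicalPath π i) + 1
  decreasing_by
  · exact Nat.lt_succ_of_lt (Nat.find_spec h).1
  · exact i.isLt

/-- The vertices visited by the canonical path (just `0` if `k = 0`). -/
def pathVertices {k : ℕ} (π : Ptn k) : Finset ℕ :=
  insert 0 ((Finset.range k).image (canonicalPath π))

/-- `∏_{i} w(|x_{t_i} - x_{t_{i+1}}|)` over the `k` edges of the closed canonical path.  For a
non-crossing pair partition each edge is traversed twice, so this is the product of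
`w²(|x_r - x_s|)` over the distinct edges `{r,s}`. -/
def pathWeight (w : ℝ → ℝ) {k : ℕ} (π : Ptn k) (x : ℕ → ℝ) : ℝ :=
  ∏ i ∈ Finset.range k, w |x (canonicalPath π i) - x (canonicalPath π ((i + 1) % k))|

/-- Extend `y : V → ℝ` to all of `ℕ` by the value `c`. -/
def extendBy {V : Finset ℕ} (y : V → ℝ) (c : ℝ) : ℕ → ℝ :=
  fun u => if h : u ∈ V then y ⟨u, h⟩ else c

/-- `J_w(π)`: the integral of the path weight over all vertex variables in `[0,1]`. -/
def J (w : ℝ → ℝ) {k : ℕ} (π : Ptn k) : ℝ :=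
  ∫ y : pathVertices π → ℝ in Set.univ.pi fun _ => Set.Icc 0 1,
    pathWeight w π (extendBy y 0)

/-- `J_w(π | x_v = c)`: the variable of the vertex `v` is fixed to `c`, all others are integrated
over `[0,1]`. -/
def Jcond (w : ℝ → ℝ) {k : ℕ} (π : Ptn k) (v : ℕ) (c : ℝ) : ℝ :=
  ∫ y : (pathVertices π).erase v → ℝ in Set.univ.pi fun _ => Set.Icc 0 1,
    pathWeight w π (extendBy y c)

/-- The increasing map from `k` points to `k + 2` points that skips `m` and `m + 1`. -/
def skipPair {k : ℕ} (m : Fin (k + 1)) (i : Fin k) : Fin (k + 2) :=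
  if (i : ℕ) < m then ⟨i, by omega⟩ else ⟨i + 2, by omega⟩

open Classical in
/-- Remove the neighbouring points `m`, `m + 1` from `π` and relabel the others increasingly. -/
def removePair {k : ℕ} (π : Ptn (k + 2)) (m : Fin (k + 1)) : Ptn k :=
  Finpartition.ofSetoid (Setoid.ker fun i : Fin k => π.part (skipPair m i))

/-! ### The variance profile -/

/-- `φ(x) = ∫_0^1 w²(|x-y|) dy`. -/
def phi (w : ℝ → ℝ) (x : ℝ) : ℝ := ∫ y in (0 : ℝ)..1, w |x - y| ^ 2

/-- `φ_0 = ∫_0^1 φ(x) dx`. -/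
def phi0 (w : ℝ → ℝ) : ℝ := ∫ x in (0 : ℝ)..1, phi w x

end WeightedEnsemble

end

noncomputable section

namespace WeightedEnsemble

/-! ### Riemann integrable functions -/

/-! The proof is the method of moments. The `K`-th moment of the spectral distribution is `n⁻¹ tr
X_n^K`, that is, `n^{-(1+K/2)}` times a sum over circuits `p` (closed index paths of length `K`) of
a product of weights times a product of matrix entries. The edges of a circuit fall into
`∼`-classes, and circuits are sorted by these classes.

Circuits having a class that is not a pair are negligible. Walking along a circuit, (E2) leaves a
bounded number of choices whenever an edge has a class seen before, so the number of free indices is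
governed by the number of classes. Singleton classes allow more indices, but (A1) charges `n^{-1/2}`
for each of them. The balance, in `card_le_of_not_paired` and `sum_unpaired_le`, is a loss of at
least `n^{-1/6}` per circuit, uniformly for families of circuits, so all moments of this part of the
sum are controlled. If all classes are pairs, `isTreeLike_or` leaves three possibilities: two blocks
cross (few circuits by (E1)), a block is not traversed backwards (few by (E3)), or the circuit
backtracks along a non-crossing pairing. For these last, tree-like circuits (A2) gives expectation
close to `1`, and a second moment estimate (`integral_treeLike_sq_le`) replaces the random product
by `1`; pairs of linked tree-like circuits are again rare by (E1).

What remains is a deterministic sum of weights. A circuit backtracking along `π` is an arbitrary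
labelling of the vertices of the canonical path of `π`, so its contribution is a Riemann sum over a
cube of dimension `K/2+1` converging to `J w π` (`tendsto_treeLike_sum`). As `w` is continuous
almost everywhere, dominated convergence applies.

The limiting moments grow at most exponentially. Hence a measure with these moments lives on a
compact interval and is unique by Weierstrass approximation, and convergence of moments implies weak
convergence (`HasMoments.exists_moments_close`). The limit measure itself is obtained as a weak
limit of suitable realisations of the spectral distributions.

The recursion for `J` integrates out the tip of an excursion along a neighbouring pair, which
produces the factor `φ`. If `φ` is constant it factors out and Catalan numbers remain. Conversely,
the fourth moment is `2∫φ²`, and agreement with the semicircle value is equality in Cauchy-Schwarz.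
The symmetry of `w²` comes from differentiating its primitive. Almost sure convergence uses the same
moment bounds, taken high enough to be summable in `n`. -/

/-- The first index `i` with `x ≤ t i` is the right end of a suitable cell. It can be `0` only if `x
= 0`; then, if no cell contained `0`, all partition points would be nonpositive by induction,
against `t N = 1`. -/
lemma exists_cell {N : ℕ} {t : ℕ → ℝ} (h0 : t 0 = 0) (hN : t N = 1) {x : ℝ}
    (hx : x ∈ Set.Icc (0 : ℝ) 1) : ∃ i < N, x ∈ Set.Icc (t i) (t (i + 1)) := by
  classical
  have hex : ∃ i, x ≤ t i := ⟨N, by rw [hN]; exact hx.2⟩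
  have hfN : Nat.find hex ≤ N := Nat.find_min' hex (by rw [hN]; exact hx.2)
  have hN0 : N ≠ 0 := by rintro rfl; rw [h0] at hN; exact zero_ne_one hN
  rcases Nat.eq_zero_or_pos (Nat.find hex) with h | h
  · have h1 := Nat.find_spec hex
    rw [h, h0] at h1
    have hx0 : x = 0 := le_antisymm h1 hx.1
    by_contra hcon
    push Not at hcon
    have key : ∀ i ≤ N, t i ≤ 0 := by
      intro i
      induction i with
      | zero => intro _; exact h0.le
      | succ j ih =>
        intro hj
        have := hcon j (by omega)
        by_contra hlt
        exact this ⟨hx0 ▸ ih (by omega), by rw [hx0]; linarith⟩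
    have := key N le_rfl
    rw [hN] at this; linarith
  · refine ⟨Nat.find hex - 1, by omega, ?_, ?_⟩
    · have := Nat.find_min hex (m := Nat.find hex - 1) (by omega)
      linarith
    · have := Nat.find_spec hex
      rwa [Nat.sub_add_cancel h]

lemma RiemannIntegrableUnit.bounded {w : ℝ → ℝ} (hw : RiemannIntegrableUnit w) :
    ∃ M : ℝ, 1 ≤ M ∧ ∀ x ∈ Set.Icc (0 : ℝ) 1, |w x| ≤ M := by
  obtain ⟨N, t, m, M, -, h0, hN, hb, -⟩ := hw 1 one_pos
  refine ⟨1 + ∑ i ∈ Finset.range N, (|m i| + |M i|), ?_, fun x hx => ?_⟩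
  · have : 0 ≤ ∑ i ∈ Finset.range N, (|m i| + |M i|) :=
      Finset.sum_nonneg fun i _ => by positivity
    linarith
  · obtain ⟨i, hi, hxi⟩ := exists_cell h0 hN hx
    obtain ⟨h1, h2⟩ := hb i hi x hxi
    have h3 : |m i| + |M i| ≤ ∑ i ∈ Finset.range N, (|m i| + |M i|) :=
      Finset.single_le_sum (f := fun i => |m i| + |M i|) (fun i _ => by positivity)
        (Finset.mem_range.2 hi)
    rw [abs_le]
    constructor
    · linarith [neg_abs_le (m i), abs_nonneg (M i)]
    · linarith [le_abs_self (M i), abs_nonneg (m i)]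

/-- For a partition with gap `ε` between upper and lower sum, a point of oscillation at least `α` is
a partition point or lies in a cell with `M i - m i ≥ α`. The lengths of those cells add up to at
most `ε / α`. -/
lemma RiemannIntegrableUnit.volume_oscillation_eq_zero {w : ℝ → ℝ} (hw : RiemannIntegrableUnit w)
    {α : ℝ} (hα : 0 < α) :
    volume {x | x ∈ Set.Ioo (0 : ℝ) 1 ∧ ¬ ∃ U ∈ 𝓝 x, ∀ y ∈ U, |w y - w x| < α} = 0 := by
  set D := {x | x ∈ Set.Ioo (0 : ℝ) 1 ∧ ¬ ∃ U ∈ 𝓝 x, ∀ y ∈ U, |w y - w x| < α}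
  have key : ∀ ε : ℝ, 0 < ε → volume D ≤ ENNReal.ofReal (ε / α) := by
    intro ε hε
    obtain ⟨N, t, m, M, hmono, h0, hN, hb, hs⟩ := hw ε hε
    set bad := (Finset.range N).filter fun i => α ≤ M i - m i
    have hsub : D ⊆ (t '' (Finset.range (N + 1))) ∪ ⋃ i ∈ bad, Set.Icc (t i) (t (i + 1)) := by
      rintro x ⟨hx, hno⟩
      obtain ⟨i, hi, hxi⟩ := exists_cell h0 hN ⟨hx.1.le, hx.2.le⟩
      by_cases hbad : α ≤ M i - m i
      · right
        simp only [Set.mem_iUnion]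
        exact ⟨i, by simp [bad, hi, hbad], hxi⟩
      · left
        by_contra hnt
        have hne : ∀ j ≤ N, t j ≠ x := fun j hj h => hnt ⟨j, by simp; omega, h⟩
        refine hno ⟨Set.Ioo (t i) (t (i + 1)), Ioo_mem_nhds
          (lt_of_le_of_ne hxi.1 (hne i (by omega)))
          (lt_of_le_of_ne hxi.2 (hne (i + 1) (by omega)).symm), fun y hy => ?_⟩
        have h1 := hb i hi y ⟨hy.1.le, hy.2.le⟩
        have h2 := hb i hi x hxi
        rw [abs_lt]
        constructor <;> linarith
    have hfin : volume (t '' (Finset.range (N + 1) : Set ℕ)) = 0 :=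
      ((Finset.finite_toSet _).image t).measure_zero _
    have hsum : ∑ i ∈ bad, (t (i + 1) - t i) ≤ ε / α := by
      rw [le_div_iff₀ hα, Finset.sum_mul]
      refine le_trans ?_ hs.le
      calc ∑ i ∈ bad, (t (i + 1) - t i) * α
          ≤ ∑ i ∈ bad, (M i - m i) * (t (i + 1) - t i) := by
            refine Finset.sum_le_sum fun i hi => ?_
            rw [mul_comm]
            exact mul_le_mul_of_nonneg_right (Finset.mem_filter.1 hi).2
              (sub_nonneg.2 (hmono (Nat.le_succ i)))
        _ ≤ _ := by
            refine Finset.sum_le_sum_of_subset_of_nonneg (Finset.filter_subset _ _) ?_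
            intro i hi _
            have := hb i (Finset.mem_range.1 hi) (t i) ⟨le_rfl, hmono (Nat.le_succ i)⟩
            exact mul_nonneg (by linarith) (sub_nonneg.2 (hmono (Nat.le_succ i)))
    calc volume D ≤ volume (t '' (Finset.range (N + 1) : Set ℕ)) +
          volume (⋃ i ∈ bad, Set.Icc (t i) (t (i + 1))) :=
          (measure_mono hsub).trans (measure_union_le _ _)
      _ ≤ 0 + ∑ i ∈ bad, volume (Set.Icc (t i) (t (i + 1))) := by
          rw [hfin]; gcongr; exact measure_biUnion_finset_le _ _
      _ = ENNReal.ofReal (∑ i ∈ bad, (t (i + 1) - t i)) := by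
          rw [zero_add, ENNReal.ofReal_sum_of_nonneg
            (fun i _ => sub_nonneg.2 (hmono (Nat.le_succ i)))]
          simp [Real.volume_Icc]
      _ ≤ _ := ENNReal.ofReal_le_ofReal hsum
  refine le_antisymm (ENNReal.le_of_forall_pos_le_add fun ε hε _ => ?_) bot_le
  have := key (ε * α) (by positivity)
  rw [mul_div_cancel_right₀ _ hα.ne'] at this
  simpa using this

/-- A Riemann integrable function is continuous at almost every point. -/
lemma RiemannIntegrableUnit.ae_continuousAt {w : ℝ → ℝ} (hw : RiemannIntegrableUnit w) :
    ∀ᵐ x, x ∈ Set.Ioo (0 : ℝ) 1 → ContinuousAt w x := by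
  -- Discontinuities are the countable union of the oscillation sets for `α = 1/(j+1)`.
  have h : ∀ᵐ x : ℝ, ∀ j : ℕ, ¬ (x ∈ Set.Ioo (0 : ℝ) 1 ∧
      ¬ ∃ U ∈ 𝓝 x, ∀ y ∈ U, |w y - w x| < 1 / ((j : ℝ) + 1)) :=
    ae_all_iff.2 fun j => by
      rw [ae_iff]; simpa only [not_not] using hw.volume_oscillation_eq_zero (α := 1 / ((j : ℝ) + 1)) (by positivity)
  filter_upwards [h] with x hx hx01
  rw [Metric.continuousAt_iff']
  intro ε hε
  obtain ⟨j, hj⟩ := exists_nat_one_div_lt hε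
  have := hx j
  push Not at this
  obtain ⟨U, hU, hy⟩ := this hx01
  filter_upwards [hU] with y hyU
  rw [Real.dist_eq]
  exact (hy y hyU).trans hj

/-! ### Riemann sums over cubes -/

/-- Lebesgue measure on the unit interval. -/
abbrev unitVol : Measure ℝ := volume.restrict (Set.Icc 0 1)

instance : IsProbabilityMeasure unitVol := ⟨by simp⟩

lemma restrict_cube {ι : Type*} [Fintype ι] :
    (volume : Measure (ι → ℝ)).restrict (Set.univ.pi fun _ => Set.Icc 0 1) =
      Measure.pi fun _ => unitVol := by
  rw [volume_pi, Measure.restrict_pi_pi]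

lemma ae_mem_Ioo_pi {ι : Type*} [Fintype ι] :
    ∀ᵐ y ∂(Measure.pi fun _ : ι => unitVol), ∀ i, y i ∈ Set.Ioo (0 : ℝ) 1 := by
  rw [ae_all_iff]
  intro i
  have h : ∀ᵐ x ∂unitVol, x ∈ Set.Ioo (0 : ℝ) 1 := by
    rw [unitVol, ← restrict_Ioo_eq_restrict_Icc]
    exact ae_restrict_mem measurableSet_Ioo
  exact (Measure.quasiMeasurePreserving_eval (μ := fun _ : ι => unitVol) i).ae h

/-- A surjective linear map, here `y ↦ y a - y b`, pulls null sets back to null sets. The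
exceptional set is made symmetric under negation to absorb the absolute value. -/
lemma ae_abs_sub_pi {ι : Type*} [Fintype ι] {a b : ι} (hab : a ≠ b) {p : ℝ → Prop}
    (hp : ∀ᵐ x : ℝ, p x) :
    ∀ᵐ y ∂(Measure.pi fun _ : ι => unitVol), p |y a - y b| := by
  classical
  rw [← restrict_cube]
  refine ae_restrict_of_ae ?_
  obtain ⟨T, hT, hTm, hT0⟩ := exists_measurable_superset_of_null hp
  have hneg : volume (Neg.neg ⁻¹' T) = 0 := by
    rw [Measure.measure_preimage_neg]; exact hT0
  set U := T ∪ Neg.neg ⁻¹' T with hU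
  have hU0 : volume U = 0 := measure_union_null hT0 hneg
  have hUm : MeasurableSet U := hTm.union (measurable_neg hTm)
  let L : (ι → ℝ) →ₗ[ℝ] ℝ := LinearMap.proj (R := ℝ) (φ := fun _ => ℝ) a - LinearMap.proj (R := ℝ) (φ := fun _ => ℝ) b
  have hL : Function.Surjective L := fun x => ⟨Pi.single a x, by
    simp [L, Pi.single_eq_of_ne hab.symm]⟩
  have h2 := (ae_comp_linearMap_mem_iff L volume volume hL hUm.compl).2
    (by rw [ae_iff]; simpa using hU0)
  filter_upwards [h2] with y hy
  by_contra hcon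
  apply hy
  have h3 : |y a - y b| ∈ T := hT hcon
  have h4 : L y = y a - y b := by simp [L]
  rw [hU, h4]
  rcases abs_choice (y a - y b) with h | h
  · left; rwa [h] at h3
  · right; show -(y a - y b) ∈ T; rwa [h] at h3

/-- The half-open unit cube is tiled by the cubes of side `1/n`, and the integrand is constant on
each of them. Writing the Riemann sum as an integral makes dominated convergence available. -/
lemma sum_grid_eq_integral {ι : Type*} [Fintype ι] [DecidableEq ι] (F : (ι → ℝ) → ℝ) {n : ℕ} (hn : 0 < n) :
    ((n : ℝ) ^ Fintype.card ι)⁻¹ * ∑ x : ι → Fin n, F (fun i => (x i : ℝ) / n) =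
      ∫ y, F (fun i => (⌊(n : ℝ) * y i⌋ : ℝ) / n) ∂(Measure.pi fun _ : ι => unitVol) := by
  have hn' : (0 : ℝ) < n := by exact_mod_cast hn
  have e1 : (Measure.pi fun _ : ι => unitVol) =
      (volume : Measure (ι → ℝ)).restrict (Set.univ.pi fun _ => Set.Ico 0 1) := by
    rw [volume_pi, Measure.restrict_pi_pi]
    simp only [unitVol, restrict_Ico_eq_restrict_Icc]
  let cell : (ι → Fin n) → Set (ι → ℝ) := fun x =>
    Set.univ.pi fun i => Set.Ico ((x i : ℝ) / n) (((x i : ℝ) + 1) / n)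
  have hfloor : ∀ x, ∀ y ∈ cell x, ∀ i, ⌊(n : ℝ) * y i⌋ = (x i : ℤ) := by
    intro x y hy i
    have h := hy i (Set.mem_univ i)
    rw [Int.floor_eq_iff]
    have h1 := (div_le_iff₀ hn').1 h.1
    have h2 := (lt_div_iff₀ hn').1 h.2
    constructor
    · push_cast; linarith
    · push_cast; linarith
  have e2 : (Set.univ.pi fun _ : ι => Set.Ico (0 : ℝ) 1) = ⋃ x, cell x := by
    ext y
    simp only [Set.mem_iUnion]
    constructor
    · intro hy
      have hlt : ∀ i, ⌊(n : ℝ) * y i⌋₊ < n := fun i => by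
        have h := hy i (Set.mem_univ i)
        rw [Nat.floor_lt (mul_nonneg hn'.le h.1)]
        nlinarith [h.2]
      refine ⟨fun i => ⟨⌊(n : ℝ) * y i⌋₊, hlt i⟩, fun i _ => ?_⟩
      have h := hy i (Set.mem_univ i)
      have h0 := mul_nonneg hn'.le h.1
      constructor
      · rw [div_le_iff₀ hn']; have := Nat.floor_le h0; dsimp; linarith
      · rw [lt_div_iff₀ hn']; have := Nat.lt_floor_add_one ((n : ℝ) * y i); dsimp; linarith
    · rintro ⟨x, hx⟩ i -
      have h := hx i (Set.mem_univ i)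
      constructor
      · exact le_trans (by positivity) h.1
      · refine h.2.trans_le ?_
        rw [div_le_one hn']
        exact_mod_cast (x i).2
  have hdisj : Pairwise fun x x' => Disjoint (cell x) (cell x') := by
    intro x x' hne
    rw [Set.disjoint_left]
    intro y hy hy'
    apply hne
    funext i
    have h := (hfloor x y hy i).symm.trans (hfloor x' y hy' i)
    exact Fin.ext (by exact_mod_cast h)
  have hmeas : ∀ x, MeasurableSet (cell x) := fun x =>
    MeasurableSet.univ_pi fun i => measurableSet_Ico
  have hconst : ∀ x, Set.EqOn (fun y => F (fun i => (⌊(n : ℝ) * y i⌋ : ℝ) / n))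
      (fun _ => F (fun i => (x i : ℝ) / n)) (cell x) := by
    intro x y hy
    simp only [hfloor x y hy, Int.cast_natCast]
  have hvol : ∀ x, volume (cell x) = ENNReal.ofReal (((n : ℝ) ^ Fintype.card ι)⁻¹) := by
    intro x
    have : ∀ i, ((x i : ℝ) + 1) / n - (x i : ℝ) / n = (n : ℝ)⁻¹ := fun i => by field_simp; ring
    rw [Real.volume_pi_Ico]
    simp only [this, Finset.prod_const, Finset.card_univ]
    rw [← ENNReal.ofReal_pow (by positivity), inv_pow]
  rw [e1, e2, integral_iUnion_fintype hmeas hdisj, Finset.mul_sum]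
  · refine Finset.sum_congr rfl fun x _ => ?_
    rw [setIntegral_congr_fun (hmeas x) (hconst x), setIntegral_const, measureReal_def, hvol,
      ENNReal.toReal_ofReal (by positivity), smul_eq_mul]
  · intro x
    refine IntegrableOn.congr_fun ?_ (hconst x).symm (hmeas x)
    exact integrableOn_const (by rw [hvol]; exact ENNReal.ofReal_ne_top)

lemma tendsto_floor_div (y : ℝ) :
    Tendsto (fun n : ℕ => (⌊(n : ℝ) * y⌋ : ℝ) / n) atTop (𝓝 y) := by
  have h1 : Tendsto (fun n : ℕ => y - 1 / (n : ℝ)) atTop (𝓝 y) := by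
    simpa using tendsto_const_nhds.sub (tendsto_one_div_atTop_nhds_zero_nat (𝕜 := ℝ))
  refine tendsto_of_tendsto_of_tendsto_of_le_of_le' h1 tendsto_const_nhds ?_ ?_
  · filter_upwards [eventually_gt_atTop 0] with n hn
    have hn' : (0 : ℝ) < n := by exact_mod_cast hn
    rw [le_div_iff₀ hn', sub_mul, one_div_mul_cancel hn'.ne']
    linarith [Int.sub_one_lt_floor ((n : ℝ) * y)]
  · filter_upwards [eventually_gt_atTop 0] with n hn
    have hn' : (0 : ℝ) < n := by exact_mod_cast hn
    rw [div_le_iff₀ hn']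
    linarith [Int.floor_le ((n : ℝ) * y)]

/-- No measurability of `F` is required: the function factors through the countable discrete space
`ι → ℤ`. -/
lemma aestronglyMeasurable_grid {ι : Type*} [Fintype ι] (F : (ι → ℝ) → ℝ) (n : ℕ)
    (μ : Measure (ι → ℝ)) :
    AEStronglyMeasurable (fun y => F (fun i => (⌊(n : ℝ) * y i⌋ : ℝ) / n)) μ := by
  have h1 : Measurable fun y : ι → ℝ => fun i => ⌊(n : ℝ) * y i⌋ :=
    measurable_pi_lambda _ fun i => ((measurable_pi_apply i).const_mul _).floor
  have h2 : Measurable fun z : ι → ℤ => F (fun i => (z i : ℝ) / n) := .of_discrete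
  exact (h2.comp h1).aestronglyMeasurable

/-- The grid values of a function continuous at almost every point of the open cube converge. -/
lemma ae_tendsto_grid {ι : Type*} [Fintype ι] {F : (ι → ℝ) → ℝ}
    (hF : ∀ᵐ y ∂(Measure.pi fun _ : ι => unitVol), ContinuousAt F y) :
    ∀ᵐ y ∂(Measure.pi fun _ : ι => unitVol),
      Tendsto (fun n : ℕ => F (fun i => (⌊(n : ℝ) * y i⌋ : ℝ) / n)) atTop (𝓝 (F y)) := by
  filter_upwards [hF] with y hy
  exact hy.tendsto.comp (tendsto_pi_nhds.2 fun i => tendsto_floor_div (y i))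

lemma aestronglyMeasurable_of_ae_continuousAt {ι : Type*} [Fintype ι] {F : (ι → ℝ) → ℝ}
    (hF : ∀ᵐ y ∂(Measure.pi fun _ : ι => unitVol), ContinuousAt F y) :
    AEStronglyMeasurable F (Measure.pi fun _ : ι => unitVol) :=
  aestronglyMeasurable_of_tendsto_ae atTop (fun n => aestronglyMeasurable_grid F n _)
    (ae_tendsto_grid hF)

lemma tendsto_grid_sum {ι : Type*} [Fintype ι] [DecidableEq ι] {F : (ι → ℝ) → ℝ} {M : ℝ}
    (hF : ∀ᵐ y ∂(Measure.pi fun _ : ι => unitVol), ContinuousAt F y)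
    (hM : ∀ y : ι → ℝ, (∀ i, y i ∈ Set.Icc (0 : ℝ) 1) → |F y| ≤ M) :
    Tendsto (fun n : ℕ => ((n : ℝ) ^ Fintype.card ι)⁻¹ *
      ∑ x : ι → Fin n, F (fun i => (x i : ℝ) / n)) atTop
      (𝓝 (∫ y, F y ∂(Measure.pi fun _ : ι => unitVol))) := by
  have h := tendsto_integral_filter_of_dominated_convergence (l := atTop)
    (μ := Measure.pi fun _ : ι => unitVol)
    (F := fun (n : ℕ) y => F (fun i => (⌊(n : ℝ) * y i⌋ : ℝ) / n)) (f := F) (fun _ => M)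
    (Eventually.of_forall fun n => aestronglyMeasurable_grid F n _) ?_ (integrable_const _)
    (ae_tendsto_grid hF)
  · refine h.congr' ?_
    filter_upwards [eventually_gt_atTop 0] with n hn
    exact (sum_grid_eq_integral F hn).symm
  · filter_upwards [eventually_gt_atTop 0] with n hn
    have hn' : (0 : ℝ) < n := by exact_mod_cast hn
    filter_upwards [ae_mem_Ioo_pi] with y hy
    refine hM _ fun i => ⟨?_, ?_⟩
    · have : 0 ≤ ⌊(n : ℝ) * y i⌋ := Int.floor_nonneg.2 (mul_nonneg hn'.le (hy i).1.le)
      have : (0 : ℝ) ≤ ⌊(n : ℝ) * y i⌋ := by exact_mod_cast this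
      positivity
    · rw [div_le_one hn']
      exact (Int.floor_le _).trans (by nlinarith [(hy i).2])

/-! ### The method of moments -/

/-- `μ` has the moments `m`. -/
def HasMoments (μ : Measure ℝ) (m : ℕ → ℝ) : Prop :=
  ∀ k : ℕ, Integrable (fun x => x ^ k) μ ∧ ∫ x, x ^ k ∂μ = m k

/-- Truncation of real numbers to `[-T, T]`. -/
def trunc (T u : ℝ) : ℝ := max (-T) (min u T)

lemma abs_trunc_le {T : ℝ} (hT : 0 ≤ T) (u : ℝ) : |trunc T u| ≤ T := by
  rw [trunc, abs_le]
  exact ⟨le_max_left _ _, max_le (by linarith) (min_le_right _ _)⟩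

/-- An error occurs only for `|u| > T`, where it is less than `|u| ≤ u²/T`. With `u = x ^ k`,
truncation is thus controlled by the moment of order `2k`, uniformly over measures with bounded
moments. -/
lemma abs_sub_trunc_le {T : ℝ} (hT : 0 < T) (u : ℝ) : |u - trunc T u| ≤ u ^ 2 / T := by
  rw [le_div_iff₀ hT, trunc]
  rcases le_total u T with h | h
  · rw [min_eq_left h]
    rcases le_total (-T) u with h' | h'
    · rw [max_eq_right h']; simp; positivity
    · rw [max_eq_left h', abs_of_nonpos (by linarith)]; nlinarith
  · rw [min_eq_right h, max_eq_right (by linarith), abs_of_nonneg (by linarith)]; nlinarith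

lemma continuous_trunc (T : ℝ) : Continuous (trunc T) := by
  unfold trunc; fun_prop

/-- The bounded continuous function `x ↦ trunc T (x ^ k)`. -/
def truncPow (k : ℕ) (T : ℝ) (hT : 0 ≤ T) : BoundedContinuousFunction ℝ ℝ :=
  BoundedContinuousFunction.ofNormedAddCommGroup (fun x => trunc T (x ^ k))
    ((continuous_trunc T).comp (continuous_pow k)) T fun _ => abs_trunc_le hT _

lemma truncPow_apply (k : ℕ) (T : ℝ) (hT : 0 ≤ T) (x : ℝ) :
    truncPow k T hT x = trunc T (x ^ k) := rfl

lemma abs_integral_sub_truncPow_le {μ : Measure ℝ} [IsProbabilityMeasure μ] {m : ℕ → ℝ}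
    (hμ : HasMoments μ m) (k : ℕ) {T : ℝ} (hT : 0 < T) :
    |m k - ∫ x, truncPow k T hT.le x ∂μ| ≤ m (2 * k) / T := by
  rw [← (hμ k).2, ← integral_sub (hμ k).1 (BoundedContinuousFunction.integrable _ _)]
  refine abs_integral_le_integral_abs.trans ?_
  rw [← (hμ (2 * k)).2, ← integral_div]
  refine integral_mono ((hμ k).1.sub (BoundedContinuousFunction.integrable _ _)).abs
    ((hμ (2 * k)).1.div_const T) fun x => ?_
  have := abs_sub_trunc_le hT (x ^ k)
  rwa [← pow_mul, mul_comm k 2] at this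

/-- Weak limits inherit the limits of the moments. -/
lemma hasMoments_of_weak_limit {σ : ℕ → Measure ℝ} [∀ j, IsProbabilityMeasure (σ j)]
    {m' : ℕ → ℕ → ℝ} (hσ : ∀ j, HasMoments (σ j) (m' j)) {m : ℕ → ℝ}
    (hm : ∀ k, Tendsto (fun j => m' j k) atTop (𝓝 (m k))) {μ : Measure ℝ} [IsProbabilityMeasure μ]
    (hμ : ∀ f : BoundedContinuousFunction ℝ ℝ,
      Tendsto (fun j => ∫ x, f x ∂(σ j)) atTop (𝓝 (∫ x, f x ∂μ))) : HasMoments μ m := by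
  -- Convergent moments are bounded. The bound passes to the limit for each truncation, and Fatou's
  -- lemma removes the truncation.
  have heven : ∀ k, Integrable (fun x => x ^ (2 * k)) μ := by
    intro k
    obtain ⟨B, hB⟩ := (hm (2 * k)).bddAbove_range
    have hB' : ∀ j, m' j (2 * k) ≤ B := fun j => hB ⟨j, rfl⟩
    have hint : ∀ T : ℕ, ∫ x, truncPow (2 * k) (T : ℝ) (Nat.cast_nonneg T) x ∂μ ≤ B := by
      intro T
      refine le_of_tendsto (hμ _) (Eventually.of_forall fun j => ?_)
      refine le_trans ?_ (hB' j)
      rw [← (hσ j (2 * k)).2]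
      refine integral_mono (BoundedContinuousFunction.integrable _ _) (hσ j (2 * k)).1 fun x => ?_
      rw [truncPow_apply, trunc]
      have h0 : 0 ≤ x ^ (2 * k) := by rw [pow_mul]; positivity
      exact max_le (by linarith [Nat.cast_nonneg (α := ℝ) T]) (min_le_left _ _)
    have hnn : ∀ (T : ℕ) x, 0 ≤ truncPow (2 * k) (T : ℝ) (Nat.cast_nonneg T) x := by
      intro T x
      have h0 : 0 ≤ x ^ (2 * k) := by rw [pow_mul]; positivity
      exact le_max_of_le_right (le_min h0 (Nat.cast_nonneg T))
    have hle : ∫⁻ x, ENNReal.ofReal (x ^ (2 * k)) ∂μ ≤ ENNReal.ofReal B := by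
      have h1 : ∀ x : ℝ, liminf (fun T : ℕ =>
          ENNReal.ofReal (truncPow (2 * k) (T : ℝ) (Nat.cast_nonneg T) x)) atTop =
          ENNReal.ofReal (x ^ (2 * k)) := by
        intro x
        refine Tendsto.liminf_eq ?_
        refine tendsto_const_nhds.congr' ?_
        obtain ⟨T0, hT0⟩ := exists_nat_ge (x ^ (2 * k))
        filter_upwards [eventually_ge_atTop T0] with T hT
        have h0 : 0 ≤ x ^ (2 * k) := by rw [pow_mul]; positivity
        have hT' : (T0 : ℝ) ≤ T := by exact_mod_cast hT
        rw [truncPow_apply, trunc, min_eq_left (by linarith), max_eq_right (by linarith)]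
      rw [← lintegral_congr h1]
      refine (lintegral_liminf_le fun T => ?_).trans ?_
      · exact ((truncPow (2 * k) (T : ℝ) (Nat.cast_nonneg T)).continuous.measurable).ennreal_ofReal
      · refine liminf_le_of_frequently_le' (Frequently.of_forall fun T => ?_)
        rw [← ofReal_integral_eq_lintegral_ofReal (BoundedContinuousFunction.integrable _ _)
          (Eventually.of_forall (hnn T))]
        exact ENNReal.ofReal_le_ofReal (hint T)
    refine ⟨(continuous_pow _).aestronglyMeasurable, ?_⟩
    rw [hasFiniteIntegral_iff_ofReal (Eventually.of_forall fun x => by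
      show 0 ≤ x ^ (2 * k); rw [pow_mul]; positivity)]
    exact hle.trans_lt ENNReal.ofReal_lt_top
  have hI : ∀ k, Integrable (fun x => x ^ k) μ := by
    intro k
    refine ((integrable_const (1 : ℝ)).add (heven k)).mono'
      (continuous_pow _).aestronglyMeasurable (Eventually.of_forall fun x => ?_)
    simp only [Real.norm_eq_abs, Pi.add_apply]
    rw [mul_comm, pow_mul, ← sq_abs (x ^ k)]
    nlinarith [abs_nonneg (x ^ k), sq_nonneg (|x ^ k| - 1)]
  have hμm : HasMoments μ fun k => ∫ x, x ^ k ∂μ := fun k => ⟨hI k, rfl⟩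
  intro k
  refine ⟨hI k, ?_⟩
  set c := ∫ x, x ^ k ∂μ
  set a := ∫ x, x ^ (2 * k) ∂μ
  -- Both numbers are compared with the integral of the truncated power, to which weak convergence
  -- applies; the truncation errors vanish as `T → ∞`.
  have hbound : ∀ T : ℝ, 0 < T → |c - m k| ≤ (a + m (2 * k)) / T := by
    intro T hT
    have h1 := abs_integral_sub_truncPow_le hμm k hT
    have h2 : |m k - ∫ x, truncPow k T hT.le x ∂μ| ≤ m (2 * k) / T := by
      refine le_of_tendsto_of_tendsto ((hm k).sub (hμ (truncPow k T hT.le))).abs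
        ((hm (2 * k)).div_const T) (Eventually.of_forall fun j => ?_)
      exact abs_integral_sub_truncPow_le (hσ j) k hT
    rw [add_div]
    calc |c - m k| = |(c - ∫ x, truncPow k T hT.le x ∂μ) -
          (m k - ∫ x, truncPow k T hT.le x ∂μ)| := by ring_nf
      _ ≤ _ := (abs_sub _ _).trans (add_le_add h1 h2)
  have hlim : Tendsto (fun T : ℝ => (a + m (2 * k)) / T) atTop (𝓝 0) :=
    tendsto_const_nhds.div_atTop tendsto_id
  have := ge_of_tendsto hlim ((eventually_gt_atTop 0).mono hbound)
  exact sub_eq_zero.1 (abs_nonpos_iff.1 this)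

/-- Convergence of all moments implies weak convergence along a subsequence. -/
lemma exists_weak_limit_of_moments {σ : ℕ → Measure ℝ} [∀ j, IsProbabilityMeasure (σ j)]
    {m' : ℕ → ℕ → ℝ} (hσ : ∀ j, HasMoments (σ j) (m' j)) {m : ℕ → ℝ}
    (hm : ∀ k, Tendsto (fun j => m' j k) atTop (𝓝 (m k))) :
    ∃ (μ : Measure ℝ) (φ : ℕ → ℕ), IsProbabilityMeasure μ ∧ StrictMono φ ∧ HasMoments μ m ∧
      ∀ f : BoundedContinuousFunction ℝ ℝ,
        Tendsto (fun j => ∫ x, f x ∂(σ (φ j))) atTop (𝓝 (∫ x, f x ∂μ)) := by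
  let s : ℕ → ProbabilityMeasure ℝ := fun j => ⟨σ j, inferInstance⟩
  -- Tightness is Chebyshev's inequality with the bounded second moments; Prokhorov's theorem then
  -- yields the subsequence.
  have htight : IsTightMeasureSet {((μ : ProbabilityMeasure ℝ) : Measure ℝ) | μ ∈ Set.range s} := by
    rw [isTightMeasureSet_iff_exists_isCompact_measure_compl_le]
    intro ε hε
    obtain ⟨B, hB⟩ := (hm 2).bddAbove_range
    have hB' : ∀ j, m' j 2 ≤ B := fun j => hB ⟨j, rfl⟩
    have hlim : Tendsto (fun T : ℝ => ENNReal.ofReal (B / T ^ 2)) atTop (𝓝 0) := by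
      rw [← ENNReal.ofReal_zero]
      exact ENNReal.tendsto_ofReal (tendsto_const_nhds.div_atTop (tendsto_pow_atTop two_ne_zero))
    obtain ⟨T, hT, hT0⟩ := ((hlim.eventually (gt_mem_nhds hε)).and (eventually_gt_atTop 0)).exists
    refine ⟨Set.Icc (-T) T, isCompact_Icc, ?_⟩
    rintro _ ⟨_, ⟨j, rfl⟩, rfl⟩
    refine le_trans ?_ hT.le
    have h1 := mul_meas_ge_le_integral_of_nonneg (μ := σ j) (f := fun x => x ^ 2)
      (Eventually.of_forall fun x => sq_nonneg x) (hσ j 2).1 (T ^ 2)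
    rw [(hσ j 2).2] at h1
    have h2 : (Set.Icc (-T) T)ᶜ ⊆ {x : ℝ | T ^ 2 ≤ x ^ 2} := by
      intro x hx
      by_contra hcon
      simp only [Set.mem_ofPred_eq, not_le] at hcon
      exact hx (abs_le.1 (abs_le_of_sq_le_sq hcon.le hT0.le))
    show σ j _ ≤ _
    refine (measure_mono h2).trans ?_
    rw [← ENNReal.ofReal_toReal (measure_ne_top (σ j) _)]
    refine ENNReal.ofReal_le_ofReal ?_
    rw [le_div_iff₀ (by positivity), mul_comm]
    exact h1.trans (hB' j)
  obtain ⟨μ, -, φ, hφ, hlim⟩ := (isCompact_closure_of_isTightMeasureSet htight).tendsto_subseq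
    (x := s) fun j => subset_closure ⟨j, rfl⟩
  rw [ProbabilityMeasure.tendsto_iff_forall_integral_tendsto] at hlim
  exact ⟨μ, φ, inferInstance, hφ, hasMoments_of_weak_limit (fun j => hσ (φ j))
    (fun k => (hm k).comp hφ.tendsto_atTop) hlim, hlim⟩

/-- Markov's inequality for `x ^ (2k)` bounds the mass of `|x| ≥ T` by `A (R/T)^{2k}`, which tends
to `0` in `k` for every `T > R`. -/
lemma HasMoments.measure_compl_Icc {μ : Measure ℝ} [IsProbabilityMeasure μ] {m : ℕ → ℝ}
    (hμ : HasMoments μ m) {A R : ℝ} (hR : 0 ≤ R) (hm : ∀ k, m (2 * k) ≤ A * R ^ (2 * k)) :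
    μ (Set.Icc (-R) R)ᶜ = 0 := by
  have key : ∀ T, R < T → μ {x | T ≤ |x|} = 0 := by
    intro T hT
    have hT0 : 0 < T := hR.trans_lt hT
    have hb : ∀ k : ℕ, μ.real {x | T ≤ |x|} ≤ A * ((R / T) ^ 2) ^ k := by
      intro k
      have h1 := mul_meas_ge_le_integral_of_nonneg (μ := μ) (f := fun x => x ^ (2 * k))
        (Eventually.of_forall fun x => by
          show 0 ≤ x ^ (2 * k); rw [pow_mul]; positivity) (hμ (2 * k)).1 (T ^ (2 * k))
      rw [(hμ (2 * k)).2] at h1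
      have h2 : {x : ℝ | T ≤ |x|} ⊆ {x | T ^ (2 * k) ≤ x ^ (2 * k)} := by
        intro x hx
        have : T ^ (2 * k) ≤ |x| ^ (2 * k) := pow_le_pow_left₀ hT0.le hx _
        rwa [pow_mul |x|, sq_abs, ← pow_mul] at this
      have h3 := (measureReal_mono (μ := μ) h2)
      have h4 : T ^ (2 * k) * μ.real {x | T ≤ |x|} ≤ A * R ^ (2 * k) :=
        (mul_le_mul_of_nonneg_left h3 (by positivity)).trans (h1.trans (hm k))
      rw [← pow_mul, div_pow, ← mul_div_assoc, le_div_iff₀ (by positivity), mul_comm]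
      exact h4
    have hq : (R / T) ^ 2 < 1 := by
      rw [sq_lt_one_iff₀ (by positivity), div_lt_one hT0]; exact hT
    have hlim : Tendsto (fun k : ℕ => A * ((R / T) ^ 2) ^ k) atTop (𝓝 0) := by
      simpa using (tendsto_pow_atTop_nhds_zero_of_lt_one (by positivity) hq).const_mul A
    have h0 := ge_of_tendsto' hlim hb
    rw [← measureReal_eq_zero_iff]
    exact le_antisymm h0 measureReal_nonneg
  have hsub : (Set.Icc (-R) R)ᶜ ⊆ ⋃ j : ℕ, {x : ℝ | R + 1 / ((j : ℝ) + 1) ≤ |x|} := by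
    intro x hx
    have hlt : R < |x| := by
      by_contra hcon
      exact hx (abs_le.1 (not_lt.1 hcon))
    obtain ⟨j, hj⟩ := exists_nat_one_div_lt (sub_pos.2 hlt)
    exact Set.mem_iUnion.2 ⟨j, by simp only [Set.mem_ofPred_eq]; linarith⟩
  refine measure_mono_null hsub (measure_iUnion_null fun j => key _ ?_)
  have : (0 : ℝ) < 1 / ((j : ℝ) + 1) := by positivity
  linarith

/-- Moments of exponential growth determine the measure. -/
lemma HasMoments.unique {μ ν : Measure ℝ} [IsProbabilityMeasure μ] [IsProbabilityMeasure ν]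
    {m : ℕ → ℝ} (hμ : HasMoments μ m) (hν : HasMoments ν m) {A R : ℝ} (hR : 0 ≤ R)
    (hm : ∀ k, m (2 * k) ≤ A * R ^ (2 * k)) : ν = μ := by
  refine ext_of_forall_integral_eq_of_IsFiniteMeasure fun f => ?_
  have hμ0 := hμ.measure_compl_Icc hR hm
  have hν0 := hν.measure_compl_Icc hR hm
  have hpoly : ∀ (ρ : Measure ℝ) [IsProbabilityMeasure ρ], HasMoments ρ m →
      ∀ p : Polynomial ℝ, Integrable (fun x => p.eval x) ρ ∧
        ∫ x, p.eval x ∂ρ = p.sum fun k c => c * m k := by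
    intro ρ _ hρ p
    have hi : ∀ k ∈ p.support, Integrable (fun x => p.coeff k * x ^ k) ρ := fun k _ =>
      (hρ k).1.const_mul _
    simp only [Polynomial.eval_eq_sum, Polynomial.sum]
    refine ⟨integrable_finsetSum _ hi, ?_⟩
    rw [integral_finsetSum _ hi]
    exact Finset.sum_congr rfl fun k _ => by rw [integral_const_mul, (hρ k).2]
  have hclose : ∀ (ρ : Measure ℝ) [IsProbabilityMeasure ρ], HasMoments ρ m →
      ρ (Set.Icc (-R) R)ᶜ = 0 → ∀ (p : Polynomial ℝ) (ε : ℝ),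
      (∀ x ∈ Set.Icc (-R) R, |p.eval x - f x| < ε) →
      |∫ x, f x ∂ρ - p.sum fun k c => c * m k| ≤ ε := by
    intro ρ _ hρ h0 p ε hp
    obtain ⟨h1, h2⟩ := hpoly ρ hρ p
    rw [← h2, ← integral_sub (BoundedContinuousFunction.integrable _ _) h1]
    have hae : ∀ᵐ x ∂ρ, ‖f x - p.eval x‖ ≤ ε := by
      have : ∀ᵐ x ∂ρ, x ∈ Set.Icc (-R) R := by rw [ae_iff]; exact h0
      filter_upwards [this] with x hx
      rw [norm_sub_rev]
      exact (hp x hx).le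
    have := norm_integral_le_of_norm_le_const hae
    simpa using this
  refine eq_of_forall_dist_le fun ε hε => ?_
  -- Both measures are carried by `[-R, R]`, where `f` is uniformly close to a polynomial, and
  -- polynomials have the same integral under both.
  obtain ⟨p, hp⟩ := exists_polynomial_near_of_continuousOn (-R) R f f.continuous.continuousOn
    (ε / 2) (by positivity)
  have h1 := hclose μ hμ hμ0 p (ε / 2) hp
  have h2 := hclose ν hν hν0 p (ε / 2) hp
  rw [Real.dist_eq]
  rw [abs_le] at *
  constructor <;> linarith [h1.1, h1.2, h2.1, h2.2]

/-- Quantitative form of the method of moments: finitely many moments control an integral. -/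
lemma HasMoments.exists_moments_close {μ : Measure ℝ} [IsProbabilityMeasure μ] {m : ℕ → ℝ}
    (hμ : HasMoments μ m) {A R : ℝ} (hR : 0 ≤ R) (hm : ∀ k, m (2 * k) ≤ A * R ^ (2 * k))
    (f : BoundedContinuousFunction ℝ ℝ) {ε : ℝ} (hε : 0 < ε) :
    ∃ (δ : ℝ) (K : ℕ), 0 < δ ∧ ∀ (σ : Measure ℝ) (m' : ℕ → ℝ), IsProbabilityMeasure σ →
      HasMoments σ m' → (∀ k < K, |m' k - m k| < δ) → |∫ x, f x ∂σ - ∫ x, f x ∂μ| < ε := by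
  -- A failure would give, for each `j`, a measure whose first `j` moments are within `1/(j+1)` of
  -- `m` but whose integral of `f` stays away by `ε`. A weak subsequential limit has moments `m`,
  -- hence is `μ`, which is impossible.
  by_contra hcon
  push Not at hcon
  have hpos : ∀ j : ℕ, (0 : ℝ) < 1 / ((j : ℝ) + 1) := fun j => by positivity
  choose σ m' hσ hσm hclose hfar using fun j : ℕ => hcon (1 / ((j : ℝ) + 1)) j (hpos j)
  have hlim : ∀ k, Tendsto (fun j => m' j k) atTop (𝓝 (m k)) := by
    intro k
    rw [tendsto_iff_dist_tendsto_zero]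
    refine squeeze_zero' (Eventually.of_forall fun _ => dist_nonneg) ?_
      (tendsto_one_div_add_atTop_nhds_zero_nat (𝕜 := ℝ))
    filter_upwards [eventually_gt_atTop k] with j hj
    exact (hclose j k hj).le
  obtain ⟨ν, φ, hν, -, hνm, hw⟩ := exists_weak_limit_of_moments hσm hlim
  obtain rfl := hμ.unique hνm hR hm
  have h1 := ((hw f).sub_const (∫ x, f x ∂ν)).abs
  rw [sub_self, abs_zero] at h1
  exact absurd (ge_of_tendsto' h1 fun j => hfar (φ j)) (not_le.2 hε)

/-! ### Moments of the semicircle distribution -/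

/-- The moments of the semicircle distribution. -/
def semicircleMoment (k : ℕ) : ℝ := if Even k then catalan (k / 2) else 0

lemma integral_sqrt_four_sub_sq : ∫ x in (-2 : ℝ)..2, √(4 - x ^ 2) = 2 * Real.pi := by
  have h := intervalIntegral.integral_comp_mul_left (a := -1) (b := 1)
    (fun x : ℝ => √(4 - x ^ 2)) (two_ne_zero (α := ℝ))
  have h2 : ∀ x : ℝ, √(4 - (2 * x) ^ 2) = 2 * √(1 - x ^ 2) := by
    intro x
    rw [show (4 : ℝ) - (2 * x) ^ 2 = 2 ^ 2 * (1 - x ^ 2) by ring, Real.sqrt_mul (by positivity),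
      Real.sqrt_sq (by positivity)]
  simp only [h2, intervalIntegral.integral_const_mul, integral_sqrt_one_sub_sq] at h
  norm_num at h
  linarith

/-- Integrate the derivative of `x^{2k+1} (4 - x²)^{3/2}`, which vanishes at both ends of `[-2, 2]`.
-/
lemma integral_pow_mul_sqrt_four_sub_sq_succ (k : ℕ) :
    (2 * k + 4 : ℝ) * ∫ x in (-2 : ℝ)..2, x ^ (2 * (k + 1)) * √(4 - x ^ 2) =
      4 * (2 * k + 1) * ∫ x in (-2 : ℝ)..2, x ^ (2 * k) * √(4 - x ^ 2) := by
  have hder : ∀ x ∈ Set.Ioo (-2 : ℝ) 2, HasDerivAt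
      (fun x : ℝ => x ^ (2 * k + 1) * ((4 - x ^ 2) * √(4 - x ^ 2)))
      (4 * (2 * k + 1) * (x ^ (2 * k) * √(4 - x ^ 2)) -
        (2 * k + 4) * (x ^ (2 * (k + 1)) * √(4 - x ^ 2))) x := by
    intro x hx
    have hpos : 0 < 4 - x ^ 2 := by nlinarith [hx.1, hx.2]
    have hr : 0 < √(4 - x ^ 2) := Real.sqrt_pos.2 hpos
    have hsq : √(4 - x ^ 2) ^ 2 = 4 - x ^ 2 := Real.sq_sqrt hpos.le
    have h1 : HasDerivAt (fun x : ℝ => 4 - x ^ 2) (-(2 * x)) x := by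
      simpa using (hasDerivAt_pow 2 x).const_sub 4
    have h2 := h1.sqrt hpos.ne'
    have h3 := (hasDerivAt_pow (2 * k + 1) x).mul (h1.mul h2)
    refine HasDerivAt.congr_deriv (f := fun x : ℝ => x ^ (2 * k + 1) *
      ((4 - x ^ 2) * √(4 - x ^ 2))) h3 ?_
    have e : (2 * k + 1 : ℕ) - 1 = 2 * k := by omega
    simp only [Pi.mul_apply, e]
    push_cast
    have hr0 := hr.ne'
    generalize √(4 - x ^ 2) = r at *
    rw [show x ^ (2 * (k + 1)) = x ^ (2 * k) * x ^ 2 by ring,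
      show x ^ (2 * k + 1) = x ^ (2 * k) * x by ring]
    generalize x ^ (2 * k) = y
    field_simp
    linear_combination (exp := 1) (y * x ^ 2) * hsq
  have hc : ∀ j : ℕ, IntervalIntegrable (fun x : ℝ => x ^ j * √(4 - x ^ 2)) volume (-2) 2 :=
    fun j => Continuous.intervalIntegrable (by fun_prop) _ _
  have h := intervalIntegral.integral_eq_sub_of_hasDerivAt_of_le (by norm_num : (-2 : ℝ) ≤ 2)
    (by fun_prop) hder (((hc _).const_mul _).sub ((hc _).const_mul _))
  rw [intervalIntegral.integral_sub ((hc _).const_mul _) ((hc _).const_mul _),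
    intervalIntegral.integral_const_mul, intervalIntegral.integral_const_mul] at h
  norm_num at h
  linarith

lemma integral_even_pow_mul_sqrt (k : ℕ) :
    ∫ x in (-2 : ℝ)..2, x ^ (2 * k) * √(4 - x ^ 2) = 2 * Real.pi * catalan k := by
  induction k with
  | zero => simp [integral_sqrt_four_sub_sq]
  | succ k ih =>
    have h := integral_pow_mul_sqrt_four_sub_sq_succ k
    rw [ih] at h
    have h1 := succ_mul_catalan_eq_centralBinom k
    have h2 := succ_mul_catalan_eq_centralBinom (k + 1)
    have h3 := Nat.succ_mul_centralBinom_succ k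
    -- The recursion `(k+2) C_{k+1} = 2(2k+1) C_k`, matching the one satisfied by the integrals,
    -- read off from the central binomial coefficients.
    have h4 : (k + 1) * ((k + 2) * catalan (k + 1)) = (k + 1) * (2 * (2 * k + 1) * catalan k) := by
      rw [show k + 2 = k + 1 + 1 by ring, h2, h3, ← h1]; ring
    have h5 : ((k : ℝ) + 2) * catalan (k + 1) = 2 * (2 * k + 1) * catalan k := by
      exact_mod_cast Nat.eq_of_mul_eq_mul_left (Nat.succ_pos k) h4
    have hk : (2 * (k : ℝ) + 4) ≠ 0 := by positivity
    apply mul_left_cancel₀ hk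
    rw [h]
    linear_combination (-4 * Real.pi) * h5

lemma integral_odd_pow_mul_sqrt (k : ℕ) (hk : ¬ Even k) :
    ∫ x in (-2 : ℝ)..2, x ^ k * √(4 - x ^ 2) = 0 := by
  have h := intervalIntegral.integral_comp_neg (a := -2) (b := 2)
    (fun x : ℝ => x ^ k * √(4 - x ^ 2))
  have h2 : ∀ x : ℝ, (-x) ^ k * √(4 - (-x) ^ 2) = -(x ^ k * √(4 - x ^ 2)) := by
    intro x
    rw [(Nat.not_even_iff_odd.1 hk).neg_pow, neg_sq]; ring
  simp only [h2, intervalIntegral.integral_neg, neg_neg] at h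
  linarith

lemma sqrt_four_sub_sq_eq_zero {x : ℝ} (hx : x ∉ Set.Ioc (-2 : ℝ) 2) : √(4 - x ^ 2) = 0 := by
  apply Real.sqrt_eq_zero_of_nonpos
  rcases not_and_or.1 hx with h | h
  · nlinarith [not_lt.1 h]
  · nlinarith [not_le.1 h]

lemma measurable_semicircle_density :
    Measurable fun x : ℝ => ENNReal.ofReal (√(4 - x ^ 2) / (2 * Real.pi)) := by fun_prop

lemma semicircle_hasMoments : HasMoments semicircle semicircleMoment := by
  have hd : ∀ (k : ℕ) (x : ℝ), (ENNReal.ofReal (√(4 - x ^ 2) / (2 * Real.pi))).toReal • x ^ k =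
      (x ^ k * √(4 - x ^ 2)) / (2 * Real.pi) := by
    intro k x
    rw [ENNReal.toReal_ofReal (by positivity), smul_eq_mul]; ring
  intro k
  constructor
  · rw [semicircle, integrable_withDensity_iff_integrable_smul₀'
      measurable_semicircle_density.aemeasurable (Eventually.of_forall fun _ =>
        ENNReal.ofReal_lt_top)]
    simp only [hd]
    refine Integrable.div_const ?_ _
    have h1 : IntegrableOn (fun x : ℝ => x ^ k * √(4 - x ^ 2)) (Set.Ioc (-2) 2) :=
      (intervalIntegrable_iff_integrableOn_Ioc_of_le (by norm_num)).1
        (Continuous.intervalIntegrable (by fun_prop) _ _)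
    refine (integrableOn_iff_integrable_of_support_subset ?_).1 h1
    intro x hx
    by_contra hcon
    exact hx (by simp [sqrt_four_sub_sq_eq_zero hcon])
  · rw [semicircle, integral_withDensity_eq_integral_toReal_smul measurable_semicircle_density
      (Eventually.of_forall fun _ => ENNReal.ofReal_lt_top)]
    simp only [hd]
    rw [integral_div, ← setIntegral_eq_integral_of_forall_compl_eq_zero (s := Set.Ioc (-2 : ℝ) 2)
      (fun x hx => by rw [sqrt_four_sub_sq_eq_zero hx, mul_zero]),
      ← intervalIntegral.integral_of_le (by norm_num), semicircleMoment]
    split_ifs with hk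
    · obtain ⟨j, rfl⟩ := hk
      rw [← two_mul, integral_even_pow_mul_sqrt, Nat.mul_div_cancel_left _ two_pos]
      have := Real.pi_pos
      field_simp
    · rw [integral_odd_pow_mul_sqrt k hk, zero_div]

instance : IsProbabilityMeasure semicircle := by
  constructor
  have h := semicircle_hasMoments 0
  have h1 := h.1
  have h2 := h.2
  simp only [pow_zero] at h1 h2
  -- Finiteness and total mass both come from the moment of order `0`: the constant `1` is
  -- integrable and has integral `1`.
  have : IsFiniteMeasure semicircle := by
    rcases integrable_const_iff.1 h1 with h | h
    · exact absurd h one_ne_zero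
    · exact h
  rw [integral_const, smul_eq_mul, mul_one, measureReal_def] at h2
  rw [← ENNReal.toReal_eq_one_iff, h2]
  simp [semicircleMoment]

lemma catalan_le (k : ℕ) : catalan k ≤ 4 ^ k := by
  have h := succ_mul_catalan_eq_centralBinom k
  have h2 : k.centralBinom ≤ 4 ^ k := by
    rw [Nat.centralBinom_eq_two_mul_choose]
    refine (Nat.choose_le_two_pow (2 * k) k).trans ?_
    rw [pow_mul]; norm_num
  nlinarith [Nat.zero_le (k * catalan k)]

lemma semicircleMoment_le (k : ℕ) : semicircleMoment (2 * k) ≤ 1 * 2 ^ (2 * k) := by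
  rw [semicircleMoment, if_pos (even_two_mul k), Nat.mul_div_cancel_left _ two_pos, one_mul, pow_mul]
  norm_num
  exact_mod_cast catalan_le k

/-! ### Pairings and their partner functions -/

section Linked
variable {k : ℕ} {π : Ptn k}

lemma part_eq_part_iff {i j : Fin k} :
    π.part i = π.part j ↔ ∃ B ∈ π.parts, i ∈ B ∧ j ∈ B := by
  constructor
  · intro h
    exact ⟨π.part i, π.part_mem.2 (Finset.mem_univ _), π.mem_part (Finset.mem_univ _),
      h ▸ π.mem_part (Finset.mem_univ _)⟩
  · rintro ⟨B, hB, hi, hj⟩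
    rw [π.part_eq_of_mem hB hi, π.part_eq_of_mem hB hj]

lemma linked_coe_iff {i j : Fin k} : Linked π i j ↔ π.part i = π.part j := by
  rw [part_eq_part_iff]
  constructor
  · rintro ⟨B, hB, ⟨x, hx, hxi⟩, y, hy, hyj⟩
    rw [Fin.ext hxi] at hx
    rw [Fin.ext hyj] at hy
    exact ⟨B, hB, hx, hy⟩
  · rintro ⟨B, hB, hi, hj⟩
    exact ⟨B, hB, ⟨i, hi, rfl⟩, j, hj, rfl⟩

lemma Linked.lt_left {i j : ℕ} (h : Linked π i j) : i < k := by
  obtain ⟨_, _, ⟨x, _, rfl⟩, _⟩ := h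
  exact x.2

lemma Linked.lt_right {i j : ℕ} (h : Linked π i j) : j < k := by
  obtain ⟨_, _, _, x, _, rfl⟩ := h
  exact x.2

lemma linked_iff {i j : ℕ} :
    Linked π i j ↔ ∃ (hi : i < k) (hj : j < k), π.part ⟨i, hi⟩ = π.part ⟨j, hj⟩ := by
  constructor
  · intro h
    exact ⟨h.lt_left, h.lt_right, linked_coe_iff.1 h⟩
  · rintro ⟨hi, hj, h⟩
    exact linked_coe_iff.2 h

lemma ptn_ext {π' : Ptn k} (h : ∀ i j : Fin k, π.part i = π.part j ↔ π'.part i = π'.part j) :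
    π = π' := by
  have h2 : ∀ i, π.part i = π'.part i := by
    intro i
    ext j
    rw [π.mem_part_iff_part_eq_part (Finset.mem_univ _) (Finset.mem_univ _), h,
      π'.mem_part_iff_part_eq_part (Finset.mem_univ _) (Finset.mem_univ _)]
  have key : ∀ (σ τ : Ptn k), (∀ i, σ.part i = τ.part i) → ∀ B ∈ σ.parts, B ∈ τ.parts := by
    intro σ τ hst B hB
    obtain ⟨x, hx⟩ := σ.nonempty_of_mem_parts hB
    rw [← σ.part_eq_of_mem hB hx, hst]
    exact τ.part_mem.2 (Finset.mem_univ _)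
  exact Finpartition.ext (Finset.Subset.antisymm (key _ _ h2) (key _ _ fun i => (h2 i).symm))

lemma pair_mem_parts_iff (h2 : ∀ B ∈ π.parts, B.card = 2) {i j : Fin k} (hij : i ≠ j) :
    ({i, j} : Finset (Fin k)) ∈ π.parts ↔ π.part i = π.part j := by
  rw [part_eq_part_iff]
  constructor
  · intro h
    exact ⟨_, h, by simp, by simp⟩
  · rintro ⟨B, hB, hi, hj⟩
    have : ({i, j} : Finset (Fin k)) = B := by
      refine Finset.eq_of_subset_of_card_le ?_ (by rw [h2 B hB, Finset.card_pair hij])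
      intro x hx
      rcases Finset.mem_insert.1 hx with rfl | hx
      · exact hi
      · rwa [Finset.mem_singleton.1 hx]
    rwa [this]

lemma isNonCrossingPairing_of_part
    (h1 : ∀ i : Fin k, ∃ j, j ≠ i ∧ ∀ l, π.part i = π.part l ↔ l = i ∨ l = j)
    (h2 : ∀ a b c d : Fin k, a < b → b < c → c < d → π.part a = π.part c →
      π.part b = π.part d → False) : IsNonCrossingPairing π := by
  have h3 : ∀ B ∈ π.parts, B.card = 2 := by
    intro B hB
    obtain ⟨x, hx⟩ := π.nonempty_of_mem_parts hB
    obtain ⟨j, hj, hl⟩ := h1 x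
    have : B = {x, j} := by
      ext l
      rw [← π.part_eq_of_mem hB hx,
        π.mem_part_iff_part_eq_part (Finset.mem_univ _) (Finset.mem_univ _), eq_comm, hl]
      simp
    rw [this, Finset.card_pair hj.symm]
  refine ⟨h3, ?_⟩
  rintro ⟨a, b, c, d, hab, hbc, hcd, h4, h5⟩
  exact h2 a b c d hab hbc hcd ((pair_mem_parts_iff h3 (hab.trans hbc).ne).1 h4)
    ((pair_mem_parts_iff h3 (hbc.trans hcd).ne).1 h5)

end Linked

/-- `f` is a non-crossing fixed-point-free involution of `[a, b)`, extended by the identity. -/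
structure NCInv (a b : ℕ) (f : ℕ → ℕ) : Prop where
  out : ∀ i, i < a ∨ b ≤ i → f i = i
  maps : ∀ i, a ≤ i → i < b → a ≤ f i ∧ f i < b
  ne : ∀ i, a ≤ i → i < b → f i ≠ i
  invol : ∀ i, f (f i) = i
  nc : ∀ i j, i < j → j < f i → f i < f j → False

/-- `f` is the partner function of `π`. -/
def IsPartner {k : ℕ} (π : Ptn k) (f : ℕ → ℕ) : Prop :=
  ∀ i j, Linked π i j ↔ i < k ∧ (j = i ∨ j = f i)

/-- Replacing a pairing by its partner function on `ℕ` turns cutting, gluing and deleting blocks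
into linear arithmetic on indices. -/
lemma IsNonCrossingPairing.exists_partner {k : ℕ} {π : Ptn k} (hπ : IsNonCrossingPairing π) :
    ∃ f, NCInv 0 k f ∧ IsPartner π f := by
  have h1 : ∀ i : Fin k, ∃ j : Fin k, j ≠ i ∧ ∀ l : Fin k, π.part i = π.part l ↔ l = i ∨ l = j := by
    intro i
    have hm : i ∈ π.part i := π.mem_part (Finset.mem_univ _)
    have hc := hπ.1 (π.part i) (π.part_mem.2 (Finset.mem_univ _))
    obtain ⟨x, y, hxy, he⟩ := Finset.card_eq_two.1 hc
    have hmem : ∀ l, π.part i = π.part l ↔ l = x ∨ l = y := by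
      intro l
      rw [eq_comm, ← π.mem_part_iff_part_eq_part (Finset.mem_univ _) (Finset.mem_univ _), he]
      simp
    rw [he] at hm
    rcases Finset.mem_insert.1 hm with rfl | hm
    · exact ⟨y, hxy.symm, hmem⟩
    · rw [Finset.mem_singleton] at hm
      subst hm
      exact ⟨x, hxy, fun l => (hmem l).trans or_comm⟩
  choose g hg1 hg2 using h1
  let f : ℕ → ℕ := fun i => if h : i < k then g ⟨i, h⟩ else i
  have hf : ∀ i : Fin k, f i = g i := fun i => by simp [f]
  have hgg : ∀ i, g (g i) = i := by
    intro i
    have h2 : π.part i = π.part (g i) := (hg2 i _).2 (Or.inr rfl)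
    rcases (hg2 (g i) i).1 h2.symm with h | h
    · exact absurd h.symm (hg1 i)
    · exact h.symm
  have hout : ∀ i, k ≤ i → f i = i := fun i hi => by simp [f, hi]
  refine ⟨f, ⟨fun i hi => hout i (by omega), fun i _ hi => ?_, fun i _ hi => ?_, fun i => ?_,
    fun i j hij h3 h4 => ?_⟩, fun i j => ?_⟩
  · rw [show i = (⟨i, hi⟩ : Fin k) from rfl, hf]; omega
  · rw [show i = (⟨i, hi⟩ : Fin k) from rfl, hf]
    intro h
    exact hg1 ⟨i, hi⟩ (Fin.ext h)
  · rcases lt_or_ge i k with hi | hi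
    · rw [show i = (⟨i, hi⟩ : Fin k) from rfl, hf, hf, hgg]
    · rw [hout i hi, hout i hi]
  · have hj : j < k := by
      by_contra hj
      rcases lt_or_ge i k with hi | hi
      · rw [show i = (⟨i, hi⟩ : Fin k) from rfl, hf] at h3
        have := (g ⟨i, hi⟩).2
        omega
      · rw [hout i hi] at h3; omega
    have hfi : f i = g ⟨i, by omega⟩ := hf ⟨i, by omega⟩
    have hfj : f j = g ⟨j, hj⟩ := hf ⟨j, hj⟩
    rw [hfi] at h3 h4
    rw [hfj] at h4
    refine hπ.2 ⟨⟨i, by omega⟩, ⟨j, hj⟩, g ⟨i, by omega⟩, g ⟨j, hj⟩, hij, h3, h4, ?_, ?_⟩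
    · exact (pair_mem_parts_iff hπ.1 (hg1 _).symm).2 ((hg2 _ _).2 (Or.inr rfl))
    · exact (pair_mem_parts_iff hπ.1 (hg1 _).symm).2 ((hg2 _ _).2 (Or.inr rfl))
  · rw [linked_iff]
    constructor
    · rintro ⟨hi, hj, h⟩
      refine ⟨hi, ?_⟩
      rw [show i = (⟨i, hi⟩ : Fin k) from rfl, hf]
      rcases (hg2 _ _).1 h with h | h
      · left; exact congrArg Fin.val h
      · right; exact congrArg Fin.val h
    · rintro ⟨hi, rfl | h⟩
      · exact ⟨hi, hi, rfl⟩
      · rw [show i = (⟨i, hi⟩ : Fin k) from rfl, hf] at h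
        subst h
        exact ⟨hi, (g ⟨i, hi⟩).2, (hg2 _ _).2 (Or.inr rfl)⟩

lemma NCInv.exists_ptn {k : ℕ} {f : ℕ → ℕ} (hf : NCInv 0 k f) :
    ∃ π : Ptn k, IsNonCrossingPairing π ∧ IsPartner π f := by
  classical
  have hlt : ∀ i : Fin k, f i < k := fun i => (hf.maps i (Nat.zero_le _) i.2).2
  let s : Setoid (Fin k) :=
    ⟨fun i j => (j : ℕ) = i ∨ (j : ℕ) = f i, fun i => Or.inl rfl, fun {i j} h => by
      rcases h with h | h
      · exact Or.inl h.symm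
      · right; rw [h, hf.invol], fun {i j l} h h' => by
      rcases h with h | h <;> rcases h' with h' | h'
      · left; omega
      · right; rw [h', h]
      · right; rw [h', h]
      · left; rw [h', h, hf.invol]⟩
  have hpart : ∀ i j : Fin k, (Finpartition.ofSetoid s).part i = (Finpartition.ofSetoid s).part j ↔
      (j : ℕ) = i ∨ (j : ℕ) = f i := by
    intro i j
    rw [eq_comm, ← Finpartition.mem_part_iff_part_eq_part _ (Finset.mem_univ _) (Finset.mem_univ _),
      Finpartition.mem_part_ofSetoid_iff_rel]
    rfl
  refine ⟨Finpartition.ofSetoid s, isNonCrossingPairing_of_part (fun i => ?_) ?_, fun i j => ?_⟩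
  · refine ⟨⟨f i, hlt i⟩, fun h => hf.ne i (Nat.zero_le _) i.2 (congrArg Fin.val h), fun l => ?_⟩
    rw [hpart, Fin.ext_iff, Fin.ext_iff]
  · intro a b c d hab hbc hcd h1 h2
    rw [hpart] at h1 h2
    have h3 : (a : ℕ) < b := hab
    have h4 : (b : ℕ) < c := hbc
    have h5 : (c : ℕ) < d := hcd
    exact hf.nc a b hab (by omega) (by omega)
  · rw [linked_iff]
    constructor
    · rintro ⟨hi, hj, h⟩
      exact ⟨hi, (hpart _ _).1 h⟩
    · rintro ⟨hi, h⟩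
      have hj : j < k := by
        rcases h with h | h
        · omega
        · rw [h]; exact hlt ⟨i, hi⟩
      exact ⟨hi, hj, (hpart ⟨i, hi⟩ ⟨j, hj⟩).2 h⟩

lemma IsPartner.ptn_eq {k : ℕ} {π π' : Ptn k} {f : ℕ → ℕ} (h : IsPartner π f)
    (h' : IsPartner π' f) : π = π' :=
  ptn_ext fun i j => by rw [← linked_coe_iff, ← linked_coe_iff, h, h']

lemma IsPartner.fun_eq {k : ℕ} {π : Ptn k} {f g : ℕ → ℕ} (hf : IsPartner π f)
    (hg : IsPartner π g) (hf' : NCInv 0 k f) (hg' : NCInv 0 k g) : f = g := by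
  funext i
  rcases lt_or_ge i k with hi | hi
  · have h1 := (hg i (f i)).1 ((hf i (f i)).2 ⟨hi, Or.inr rfl⟩)
    rcases h1.2 with h | h
    · exact absurd h (hf'.ne i (Nat.zero_le _) hi)
    · exact h
  · rw [hf'.out i (Or.inr hi), hg'.out i (Or.inr hi)]

/-! ### Counting non-crossing pairings -/

/-- Join two involutions and the block `{a, c}`. -/
def glue (a c : ℕ) (g h : ℕ → ℕ) (i : ℕ) : ℕ :=
  if i = a then c else if i = c then a else if i < c then g i else h i

/-- Restrict a function to `[a, b)`, extending by the identity. -/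
def restrictIco (a b : ℕ) (f : ℕ → ℕ) (i : ℕ) : ℕ := if a ≤ i ∧ i < b then f i else i

lemma NCInv.glue {a b c : ℕ} {g h : ℕ → ℕ} (hac : a < c) (hcb : c < b) (hg : NCInv (a + 1) c g)
    (hh : NCInv (c + 1) b h) : NCInv a b (glue a c g h) := by
  -- A table of the possible positions of `i` relative to `a < c < b`, with the value and its range
  -- in each. Apart from substituting the involution identities, the axioms follow from it by
  -- arithmetic.
  have e : ∀ i, (i < a ∧ WeightedEnsemble.glue a c g h i = i) ∨
      (i = a ∧ WeightedEnsemble.glue a c g h i = c) ∨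
      (a < i ∧ i < c ∧ WeightedEnsemble.glue a c g h i = g i ∧ a < g i ∧ g i < c ∧ g i ≠ i) ∨
      (i = c ∧ WeightedEnsemble.glue a c g h i = a) ∨
      (c < i ∧ i < b ∧ WeightedEnsemble.glue a c g h i = h i ∧ c < h i ∧ h i < b ∧ h i ≠ i) ∨
      (b ≤ i ∧ WeightedEnsemble.glue a c g h i = i) := by
    intro i
    rcases lt_trichotomy i a with h1 | h1 | h1
    · have h2 := hg.out i (by omega)
      have h3 : WeightedEnsemble.glue a c g h i = g i := by
        rw [WeightedEnsemble.glue, if_neg (by omega), if_neg (by omega), if_pos (by omega)]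
      omega
    · have h3 : WeightedEnsemble.glue a c g h i = c := by
        rw [WeightedEnsemble.glue, if_pos h1]
      omega
    · rcases lt_trichotomy i c with h2 | h2 | h2
      · have h3 := hg.maps i h1 h2
        have h4 := hg.ne i h1 h2
        have h5 : WeightedEnsemble.glue a c g h i = g i := by
          rw [WeightedEnsemble.glue, if_neg (by omega), if_neg (by omega), if_pos (by omega)]
        omega
      · have h3 : WeightedEnsemble.glue a c g h i = a := by
          rw [WeightedEnsemble.glue, if_neg (by omega), if_pos h2]
        omega
      · have h5 : WeightedEnsemble.glue a c g h i = h i := by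
          rw [WeightedEnsemble.glue, if_neg (by omega), if_neg (by omega), if_neg (by omega)]
        rcases lt_or_ge i b with h4 | h4
        · have := hh.maps i h2 h4
          have := hh.ne i h2 h4
          omega
        · have := hh.out i (by omega)
          omega
  refine ⟨fun i hi => ?_, fun i h1 h2 => ?_, fun i h1 h2 => ?_, fun i => ?_, fun i j h1 h2 h3 => ?_⟩
  · have := e i; omega
  · have := e i; omega
  · have := e i; omega
  · have h1 := e i
    have h2 := e (WeightedEnsemble.glue a c g h i)
    have h3 := hg.invol i
    have h4 := hh.invol i
    rcases h1 with h1 | h1 | h1 | h1 | h1 | h1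
    · omega
    · omega
    · rw [h1.2.2.1] at h2 ⊢; omega
    · omega
    · rw [h1.2.2.1] at h2 ⊢; omega
    · omega
  · have h4 := e i
    have h5 := e j
    have h6 : ¬ (j < g i ∧ g i < g j) := fun h => hg.nc i j h1 h.1 h.2
    have h7 : ¬ (j < h i ∧ h i < h j) := fun h => hh.nc i j h1 h.1 h.2
    omega

lemma NCInv.lt_apply {a b : ℕ} {f : ℕ → ℕ} (hf : NCInv a b f) (hab : a < b) :
    a < f a ∧ f a < b := by
  have h1 := hf.maps a le_rfl hab
  have h2 := hf.ne a le_rfl hab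
  omega

/-- A non-crossing involution leaves invariant the interval enclosed by a block. -/
lemma NCInv.maps_inside {a b : ℕ} {f : ℕ → ℕ} (hf : NCInv a b f) {i j : ℕ} (h1 : i < j)
    (h2 : j < f i) : i < f j ∧ f j < f i := by
  have h3 := hf.nc i j h1 h2
  have h4 : f j ≠ f i := fun h => by
    have := congrArg f h
    rw [hf.invol, hf.invol] at this; omega
  have h5 : f j ≠ i := fun h => by
    have := congrArg f h
    rw [hf.invol] at this; omega
  -- If `f j < i`, then `f j < i < j < f i` would be a crossing of the blocks of `f j` and `i`.
  have h6 := hf.nc (f j) i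
  rw [hf.invol] at h6
  have h7 : ¬ f j < i := fun h => h6 h (by omega) h2
  constructor
  · omega
  · by_contra hcon
    exact h3 (by omega)

lemma NCInv.restrict {a b : ℕ} {f : ℕ → ℕ} (hf : NCInv a b f) {c d : ℕ} (hac : a ≤ c) (hdb : d ≤ b)
    (hcd : ∀ i, c ≤ i → i < d → c ≤ f i ∧ f i < d) : NCInv c d (restrictIco c d f) := by
  have e : ∀ i, (c ≤ i ∧ i < d ∧ restrictIco c d f i = f i) ∨
      (¬ (c ≤ i ∧ i < d) ∧ restrictIco c d f i = i) := by
    intro i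
    unfold restrictIco
    by_cases h : c ≤ i ∧ i < d
    · exact Or.inl ⟨h.1, h.2, if_pos h⟩
    · exact Or.inr ⟨h, if_neg h⟩
  refine ⟨fun i hi => ?_, fun i h1 h2 => ?_, fun i h1 h2 => ?_, fun i => ?_, fun i j h1 h2 h3 => ?_⟩
  · have := e i; omega
  · have := e i; have := hcd i h1 h2; omega
  · have := e i; have := hf.ne i (by omega) (by omega); omega
  · rcases e i with h1 | h1
    · rw [h1.2.2]
      have h2 := hcd i h1.1 h1.2.1
      have h3 := e (f i)
      have h4 := hf.invol i
      omega
    · rw [h1.2, h1.2]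
  · have h4 := e i
    have h5 := e j
    have h6 : ¬ (j < f i ∧ f i < f j) := fun h => hf.nc i j h1 h.1 h.2
    omega

lemma NCInv.restrict_left {a b : ℕ} {f : ℕ → ℕ} (hf : NCInv a b f) (hab : a < b) :
    NCInv (a + 1) (f a) (restrictIco (a + 1) (f a) f) :=
  hf.restrict (by omega) (hf.lt_apply hab).2.le fun i h1 h2 => hf.maps_inside h1 h2

/-- A point to the right of `f a` cannot have its partner in `[a, f a]`, since that interval is
invariant under `f`. -/
lemma NCInv.restrict_right {a b : ℕ} {f : ℕ → ℕ} (hf : NCInv a b f) (hab : a < b) :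
    NCInv (f a + 1) b (restrictIco (f a + 1) b f) := by
  have h3 := hf.lt_apply hab
  refine hf.restrict (by omega) le_rfl fun i h1 h2 => ?_
  have h4 := hf.maps i (by omega) h2
  have h5 := hf.invol i
  have h6 : f i ≠ a := fun h => by rw [h] at h5; omega
  have h7 : f i ≠ f a := fun h => by
    have := hf.invol a
    rw [← h, h5] at this; omega
  have h8 := fun h h' => hf.maps_inside (i := a) (j := f i) h h'
  rw [h5] at h8
  have h9 : ¬ f i < f a := fun h => by
    have := h8 (by omega) h
    omega
  omega

/-- Decomposition of a non-crossing involution at the partner of the first point. -/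
def ncInvEquiv {a b : ℕ} (hab : a < b) : {f // NCInv a b f} ≃
    Σ c : Finset.Ioo a b, {g // NCInv (a + 1) c g} × {h // NCInv (c + 1) b h} where
  toFun f := ⟨⟨f.1 a, Finset.mem_Ioo.2 (f.2.lt_apply hab)⟩,
    ⟨restrictIco (a + 1) (f.1 a) f.1, f.2.restrict_left hab⟩,
    ⟨restrictIco (f.1 a + 1) b f.1, f.2.restrict_right hab⟩⟩
  invFun x := ⟨glue a x.1 x.2.1.1 x.2.2.1, NCInv.glue (Finset.mem_Ioo.1 x.1.2).1
    (Finset.mem_Ioo.1 x.1.2).2 x.2.1.2 x.2.2.2⟩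
  left_inv f := by
    apply Subtype.ext
    funext i
    have h1 := f.2.lt_apply hab
    have h2 := f.2.invol a
    have h3 := f.2.out i
    simp only [glue, restrictIco]
    split_ifs with h4 h5 h6 h7 h8
    · rw [h4]
    · rw [h5, h2]
    · rfl
    · rw [h3]; omega
    · rfl
    · rw [h3]; omega
  right_inv x := by
    obtain ⟨⟨c, hc⟩, ⟨g, hg⟩, ⟨h, hh⟩⟩ := x
    have hc' := Finset.mem_Ioo.1 hc
    replace hg : NCInv (a + 1) c g := hg
    replace hh : NCInv (c + 1) b h := hh
    have e1 : glue a c g h a = c := by simp [glue]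
    have e2 : restrictIco (a + 1) c (glue a c g h) = g := by
      funext i
      have h3 := hg.out i
      simp only [glue, restrictIco]
      split_ifs <;> omega
    have e3 : restrictIco (c + 1) b (glue a c g h) = h := by
      funext i
      have h3 := hh.out i
      simp only [glue, restrictIco]
      split_ifs <;> omega
    have key : ∀ (c' : ℕ) (hc'' : c' ∈ Finset.Ioo a b) (g' h' : ℕ → ℕ) (hg' : NCInv (a + 1) c' g')
        (hh' : NCInv (c' + 1) b h'), c' = c → g' = g → h' = h →
        (⟨⟨c', hc''⟩, ⟨g', hg'⟩, ⟨h', hh'⟩⟩ : Σ c : Finset.Ioo a b,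
          {g // NCInv (a + 1) c g} × {h // NCInv (c + 1) b h}) =
        ⟨⟨c, hc⟩, ⟨g, hg⟩, ⟨h, hh⟩⟩ := by
      rintro c' hc'' g' h' hg' hh' rfl rfl rfl
      rfl
    refine key _ _ _ _ _ _ e1 ?_ ?_
    · simp only [e1]; exact e2
    · simp only [e1]; exact e3

/-- The number of non-crossing pairings of `l` points. -/
def pairingCount (l : ℕ) : ℕ := if Even l then catalan (l / 2) else 0

/-- This is the Catalan convolution, with lengths counted in points instead of pairs; the terms of
odd length vanish. -/
lemma pairingCount_succ (l : ℕ) :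
    pairingCount (l + 1) = ∑ i ∈ Finset.range l, pairingCount i * pairingCount (l - 1 - i) := by
  by_cases hl : Even (l + 1)
  · obtain ⟨n, hn⟩ : ∃ n, l = 2 * n + 1 := by
      obtain ⟨r, hr⟩ := hl; exact ⟨r - 1, by omega⟩
    subst hn
    have e0 : pairingCount (2 * n + 1 + 1) = catalan (n + 1) := by
      rw [pairingCount, if_pos hl]; congr 1; omega
    have e1 : ∀ i, pairingCount (2 * i) = catalan i := fun i => by
      rw [pairingCount, if_pos (even_two_mul i), Nat.mul_div_cancel_left _ two_pos]
    have e2 : ∀ i, pairingCount (2 * i + 1) = 0 := fun i => by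
      rw [pairingCount, if_neg (by simp)]
    rw [e0, catalan_succ, Finset.sum_fin_eq_sum_range]
    have hsplit : ∀ (m : ℕ) (F : ℕ → ℕ), (∀ i, F (2 * i + 1) = 0) →
        ∑ i ∈ Finset.range (2 * m + 1), F i = ∑ i ∈ Finset.range (m + 1), F (2 * i) := by
      intro m F hF
      induction m with
      | zero => simp
      | succ m ih =>
        rw [show 2 * (m + 1) + 1 = 2 * m + 1 + 1 + 1 by ring, Finset.sum_range_succ,
          Finset.sum_range_succ, ih, Finset.sum_range_succ _ (m + 1), hF,
          show 2 * m + 1 + 1 = 2 * (m + 1) by ring]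
        ring
    rw [hsplit n _ fun i => by rw [e2, zero_mul]]
    refine Finset.sum_congr rfl fun i hi => ?_
    have hi' := Finset.mem_range.1 hi
    rw [dif_pos (show i < n.succ from hi'), e1,
      show 2 * n + 1 - 1 - 2 * i = 2 * (n - i) by omega, e1]
  · rw [pairingCount, if_neg hl, eq_comm]
    refine Finset.sum_eq_zero fun i hi => ?_
    have hi' := Finset.mem_range.1 hi
    by_cases h1 : Even i
    · have : ¬ Even (l - 1 - i) := by
        rw [Nat.even_iff] at *; omega
      rw [pairingCount, pairingCount, if_neg this, mul_zero]
    · rw [pairingCount, if_neg h1, zero_mul]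

/-- Strong induction on the length. The partner of the first point splits the remaining points into
two intervals of total length `l - 1` that are paired independently. The left end `a` is arbitrary
because the two parts start at shifted positions. -/
lemma card_ncInv (l : ℕ) : ∀ a : ℕ, Finite {f // NCInv a (a + l) f} ∧
    Nat.card {f // NCInv a (a + l) f} = pairingCount l := by
  induction l using Nat.strong_induction_on with
  | _ l ih =>
    intro a
    rcases Nat.eq_zero_or_pos l with rfl | hl
    · have huniq : ∀ f, NCInv a (a + 0) f ↔ f = id := by
        intro f
        constructor
        · intro h
          funext i
          exact h.out i (by omega)
        · rintro rfl
          exact ⟨fun _ _ => rfl, by omega, by omega, fun _ => rfl, fun i j h1 h2 => by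
            simp only [id] at h2; omega⟩
      have : Unique {f // NCInv a (a + 0) f} :=
        ⟨⟨⟨id, (huniq _).2 rfl⟩⟩, fun f => Subtype.ext ((huniq _).1 f.2)⟩
      exact ⟨inferInstance, by rw [Nat.card_unique]; simp [pairingCount]⟩
    · obtain ⟨l, rfl⟩ : ∃ l', l = l' + 1 := ⟨l - 1, by omega⟩
      have e := ncInvEquiv (show a < a + (l + 1) by omega)
      have hL : ∀ c : Finset.Ioo a (a + (l + 1)), Finite {g // NCInv (a + 1) c g} ∧
          Nat.card {g // NCInv (a + 1) c g} = pairingCount (c - (a + 1)) := by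
        rintro ⟨c, hc⟩
        have hc' := Finset.mem_Ioo.1 hc
        have := ih (c - (a + 1)) (by omega) (a + 1)
        rwa [show a + 1 + (c - (a + 1)) = c by omega] at this
      have hR : ∀ c : Finset.Ioo a (a + (l + 1)), Finite {g // NCInv (c + 1) (a + (l + 1)) g} ∧
          Nat.card {g // NCInv (c + 1) (a + (l + 1)) g} =
            pairingCount (a + (l + 1) - (c + 1)) := by
        rintro ⟨c, hc⟩
        have hc' := Finset.mem_Ioo.1 hc
        have := ih (a + (l + 1) - (c + 1)) (by omega) (c + 1)
        rwa [show c + 1 + (a + (l + 1) - (c + 1)) = a + (l + 1) by omega] at this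
      have := fun c => (hL c).1
      have := fun c => (hR c).1
      refine ⟨Finite.of_equiv _ e.symm, ?_⟩
      rw [Nat.card_congr e, Nat.card_sigma, pairingCount_succ]
      simp only [Nat.card_prod, fun c => (hL c).2, fun c => (hR c).2]
      rw [Finset.sum_coe_sort (Finset.Ioo a (a + (l + 1)))
        fun c => pairingCount (c - (a + 1)) * pairingCount (a + (l + 1) - (c + 1))]
      refine Finset.sum_nbij' (fun c => c - (a + 1)) (fun i => a + 1 + i) ?_ ?_ ?_ ?_ ?_
      · intro c hc; have := Finset.mem_Ioo.1 hc; simp only [Finset.mem_range]; omega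
      · intro c hc; have := Finset.mem_range.1 hc; simp only [Finset.mem_Ioo]; omega
      · intro c hc; have := Finset.mem_Ioo.1 hc; omega
      · intro c hc; omega
      · intro c hc
        have := Finset.mem_Ioo.1 hc
        congr 2; omega

lemma mem_ncPairings {k : ℕ} {π : Ptn k} : π ∈ ncPairings k ↔ IsNonCrossingPairing π := by
  simp [ncPairings]

lemma card_ncPairings (k : ℕ) : (ncPairings k).card = pairingCount k := by
  have h := (card_ncInv k 0).2
  rw [zero_add] at h
  have hc : (ncPairings k).card = Nat.card {x // x ∈ ncPairings k} := by
    rw [Nat.card_eq_fintype_card, Fintype.card_coe]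
  rw [← h, hc]
  have hex : ∀ π : {x // x ∈ ncPairings k}, ∃ f, NCInv 0 k f ∧ IsPartner π.1 f := fun π =>
    (mem_ncPairings.1 π.2).exists_partner
  choose F hF using hex
  refine Nat.card_eq_of_bijective (fun π => (⟨F π, (hF π).1⟩ : {f // NCInv 0 k f})) ⟨?_, ?_⟩
  · intro π π' he
    have he' : F π = F π' := congrArg Subtype.val he
    exact Subtype.ext ((hF π).2.ptn_eq (he' ▸ (hF π').2))
  · rintro ⟨f, hf⟩
    obtain ⟨π, hπ, hp⟩ := hf.exists_ptn
    refine ⟨⟨π, mem_ncPairings.2 hπ⟩, Subtype.ext ?_⟩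
    exact (hF _).2.fun_eq hp (hF _).1 hf

/-! ### The canonical path of a non-crossing pairing -/

/-- The path `q` with `k` edges traverses the edges paired by `f` in opposite directions. -/
def Backtracks {X : Type*} (k : ℕ) (f : ℕ → ℕ) (q : ℕ → X) : Prop :=
  ∀ i < k, i < f i → q (f i) = q (i + 1) ∧ q (f i + 1) = q i

/-- The number of opening points of the pairing `f` below `l`. -/
def openCount (f : ℕ → ℕ) (l : ℕ) : ℕ := ((Finset.range l).filter fun i => i < f i).card

lemma openCount_succ_of_lt {f : ℕ → ℕ} {l : ℕ} (h : l < f l) :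
    openCount f (l + 1) = openCount f l + 1 := by
  rw [openCount, Finset.range_add_one, Finset.filter_insert, if_pos h,
    Finset.card_insert_of_notMem (by simp), openCount]

lemma openCount_succ_of_not_lt {f : ℕ → ℕ} {l : ℕ} (h : ¬ l < f l) :
    openCount f (l + 1) = openCount f l := by
  rw [openCount, Finset.range_add_one, Finset.filter_insert, if_neg h, openCount]

/-- The involution `f` exchanges opening and closing points. -/
lemma NCInv.two_mul_openCount {k : ℕ} {f : ℕ → ℕ} (hf : NCInv 0 k f) : 2 * openCount f k = k := by
  have h1 : ((Finset.range k).filter fun i => ¬ i < f i).card = openCount f k := by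
    refine Finset.card_nbij' f f ?_ ?_ (fun i _ => hf.invol i) (fun i _ => hf.invol i)
    · intro i hi
      simp only [Finset.coe_filter, Finset.mem_range, Set.mem_ofPred_eq] at hi ⊢
      have := hf.maps i (Nat.zero_le _) hi.1
      have := hf.ne i (Nat.zero_le _) hi.1
      have := hf.invol i
      omega
    · intro i hi
      simp only [Finset.coe_filter, Finset.mem_range, Set.mem_ofPred_eq] at hi ⊢
      have := hf.maps i (Nat.zero_le _) hi.1
      have := hf.invol i
      omega
  have h2 := Finset.card_filter_add_card_filter_not (s := Finset.range k) fun i => i < f i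
  rw [h1, Finset.card_range] at h2
  rw [openCount] at *
  omega

section Path
variable {k : ℕ} {π : Ptn k} {f : ℕ → ℕ}

lemma canonicalPath_zero : canonicalPath π 0 = 0 := by
  rw [canonicalPath]

lemma IsPartner.linked_lt_iff (hp : IsPartner π f) (hf : NCInv 0 k f) {i l : ℕ} :
    i < l ∧ Linked π i l ↔ i < l ∧ l < k ∧ i = f l := by
  rw [hp]
  constructor
  · rintro ⟨h1, h2, rfl | rfl⟩
    · omega
    · exact ⟨h1, (hf.maps i (Nat.zero_le _) h2).2, (hf.invol i).symm⟩
  · rintro ⟨h1, h2, rfl⟩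
    exact ⟨h1, by omega, Or.inr (hf.invol l).symm⟩

lemma IsPartner.canonicalPath_closing (hp : IsPartner π f) (hf : NCInv 0 k f) {l : ℕ} (hl : l < k)
    (h : f l < l) : canonicalPath π (l + 1) = canonicalPath π (f l) := by
  have hex : ∃ i, i < l ∧ Linked π i l := ⟨f l, (hp.linked_lt_iff hf).2 ⟨h, hl, rfl⟩⟩
  rw [canonicalPath, dif_pos hex]
  exact congrArg _ ((hp.linked_lt_iff hf).1 (Nat.find_spec hex)).2.2

/-- New labels are taken in order, one per opening point, so the labels used so far form an initial
segment. The three claims are proved together: the value at a new label is the maximum so far plus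
one, and computing that maximum needs the first two. -/
lemma IsPartner.canonicalPath_range (hp : IsPartner π f) (hf : NCInv 0 k f) {l : ℕ} (hl : l ≤ k) :
    (∀ i ≤ l, canonicalPath π i ≤ openCount f l) ∧
      (∀ v ≤ openCount f l, ∃ i ≤ l, canonicalPath π i = v) ∧
      (∀ i < l, i < f i → canonicalPath π (i + 1) = openCount f i + 1) := by
  induction l with
  | zero =>
    refine ⟨fun i hi => ?_, fun v hv => ⟨0, le_rfl, ?_⟩, fun i hi => by omega⟩
    · rw [Nat.le_zero.1 hi, canonicalPath_zero]; exact Nat.zero_le _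
    · rw [canonicalPath_zero]; simp [openCount] at hv; exact hv.symm
  | succ l ih =>
    obtain ⟨h1, h2, h3⟩ := ih (by omega)
    have hne := hf.ne l (Nat.zero_le _) (by omega)
    by_cases h : l < f l
    · have hnew : canonicalPath π (l + 1) = openCount f l + 1 := by
        have hex : ¬ ∃ i, i < l ∧ Linked π i l := by
          rintro ⟨i, hi⟩
          have := (hp.linked_lt_iff hf).1 hi
          omega
        rw [canonicalPath, dif_neg hex]
        congr 1
        apply le_antisymm
        · exact Finset.sup_le fun i _ => h1 i (by omega)
        · obtain ⟨i, hi, hv⟩ := h2 _ le_rfl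
          rw [← hv]
          exact Finset.le_sup (f := fun i : Fin (l + 1) => canonicalPath π i)
            (Finset.mem_univ ⟨i, by omega⟩)
      rw [openCount_succ_of_lt h]
      refine ⟨fun i hi => ?_, fun v hv => ?_, fun i hi hi' => ?_⟩
      · rcases Nat.lt_or_ge l i with h4 | h4
        · rw [show i = l + 1 by omega, hnew]
        · have := h1 i h4; omega
      · rcases Nat.lt_or_ge (openCount f l) v with h4 | h4
        · exact ⟨l + 1, le_rfl, by rw [hnew]; omega⟩
        · obtain ⟨i, hi, hv⟩ := h2 v h4
          exact ⟨i, by omega, hv⟩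
      · rcases Nat.lt_or_ge i l with h4 | h4
        · exact h3 i h4 hi'
        · rw [show i = l by omega, hnew]
    · rw [openCount_succ_of_not_lt h]
      refine ⟨fun i hi => ?_, fun v hv => ?_, fun i hi hi' => ?_⟩
      · rcases Nat.lt_or_ge l i with h4 | h4
        · rw [show i = l + 1 by omega, hp.canonicalPath_closing hf (by omega) (by omega)]
          exact h1 _ (by omega)
        · exact h1 i h4
      · obtain ⟨i, hi, hv⟩ := h2 v hv
        exact ⟨i, by omega, hv⟩
      · rcases Nat.lt_or_ge i l with h4 | h4
        · exact h3 i h4 hi'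
        · exact absurd hi' (by rw [show i = l by omega]; exact h)

lemma IsPartner.canonicalPath_opening (hp : IsPartner π f) (hf : NCInv 0 k f) {l : ℕ} (hl : l < k)
    (h : l < f l) : canonicalPath π (l + 1) = openCount f l + 1 :=
  (hp.canonicalPath_range hf (l := l + 1) hl).2.2 l (by omega) h

/-- The path returns to its start after an interval that is a union of blocks. -/
lemma IsPartner.canonicalPath_eq_of_closed (hp : IsPartner π f) (hf : NCInv 0 k f) {b : ℕ}
    (hb : b ≤ k) : ∀ d a : ℕ, b = a + d → (∀ i, a ≤ i → i < b → a ≤ f i ∧ f i < b) →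
      canonicalPath π b = canonicalPath π a := by
  intro d
  induction d using Nat.strong_induction_on with
  | _ d ih =>
    intro a hab hcl
    rcases Nat.eq_zero_or_pos d with rfl | hd
    · rw [hab, add_zero]
    · have h1 := hcl a le_rfl (by omega)
      have h2 := hf.ne a (Nat.zero_le _) (by omega)
      have h3 := hf.invol a
      have h4 := hp.canonicalPath_closing hf (l := f a) (by omega) (by omega)
      rw [h3] at h4
      rw [← h4]
      refine ih (b - (f a + 1)) (by omega) (f a + 1) (by omega) fun i hi hib => ?_
      have h5 := hcl i (by omega) hib
      have h6 := hf.invol i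
      have h7 : f i ≠ a := fun h => by rw [h] at h6; omega
      have h8 : f i ≠ f a := fun h => by
        rw [h, h3] at h6; omega
      have h9 := fun h h' => hf.maps_inside (i := a) (j := f i) h h'
      rw [h6] at h9
      have h10 : ¬ f i < f a := fun h => by
        have := h9 (by omega) h
        omega
      omega

lemma IsPartner.canonicalPath_length (hp : IsPartner π f) (hf : NCInv 0 k f) :
    canonicalPath π k = 0 := by
  rw [hp.canonicalPath_eq_of_closed hf le_rfl k 0 (by omega)
    fun i _ hi => hf.maps i (Nat.zero_le _) hi, canonicalPath_zero]

/-- The points strictly between `i` and `f i` form a union of blocks, so edge `f i` starts where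
edge `i` ended; the rule for closing edges then brings the path back to the start of edge `i`. -/
lemma IsPartner.backtracks (hp : IsPartner π f) (hf : NCInv 0 k f) :
    Backtracks k f (canonicalPath π) := by
  intro i hi h
  have h1 := hf.maps i (Nat.zero_le _) hi
  have h3 := hf.invol i
  constructor
  · refine hp.canonicalPath_eq_of_closed hf h1.2.le (f i - (i + 1)) (i + 1) (by omega)
      fun j hj hj' => hf.maps_inside (by omega) hj'
  · have h4 := hp.canonicalPath_closing hf (l := f i) h1.2 (by omega)
    rw [h4, h3]

/-- An opening edge leads to a label not used before, and a closing edge is an opening edge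
reversed. That no edge is a loop is needed for almost everywhere continuity of the path weight. -/
lemma IsPartner.canonicalPath_succ_ne (hp : IsPartner π f) (hf : NCInv 0 k f) {l : ℕ} (hl : l < k) :
    canonicalPath π l ≠ canonicalPath π (l + 1) := by
  have key : ∀ i < k, i < f i → canonicalPath π i ≠ canonicalPath π (i + 1) := by
    intro i hi h
    rw [hp.canonicalPath_opening hf hi h]
    have := (hp.canonicalPath_range hf hi.le).1 i le_rfl
    omega
  rcases lt_or_gt_of_ne (hf.ne l (Nat.zero_le _) hl).symm with h | h
  · exact key l hl h
  · have h1 := hf.maps l (Nat.zero_le _) hl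
    have h2 := hp.backtracks hf (f l) h1.2 (by rw [hf.invol]; exact h)
    rw [hf.invol] at h2
    rw [h2.1, h2.2]
    exact (key (f l) h1.2 (by rw [hf.invol]; exact h)).symm

/-- Every backtracking path factors through the canonical one. -/
lemma IsPartner.eq_of_canonicalPath_eq (hp : IsPartner π f) (hf : NCInv 0 k f) {X : Type*}
    {q : ℕ → X} (hq : Backtracks k f q) :
    ∀ l ≤ k, ∀ i ≤ l, ∀ j ≤ l, canonicalPath π i = canonicalPath π j → q i = q j := by
  intro l
  induction l with
  | zero =>
    intro _ i hi j hj _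
    rw [Nat.le_zero.1 hi, Nat.le_zero.1 hj]
  | succ l ih =>
    intro hl
    have hne := hf.ne l (Nat.zero_le _) (by omega)
    -- Only the newest vertex matters. After a closing edge both paths are back at the start of the
    -- partner edge; after an opening edge the canonical label is new, so no coincidence occurs.
    have key : ∀ j ≤ l, canonicalPath π (l + 1) = canonicalPath π j → q (l + 1) = q j := by
      intro j hj h
      rcases lt_or_gt_of_ne hne with h1 | h1
      · rw [hp.canonicalPath_closing hf (by omega) h1] at h
        have h2 := hq (f l) (by omega) (by rw [hf.invol]; exact h1)
        rw [hf.invol] at h2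
        rw [h2.2]
        exact ih (by omega) _ h1.le _ hj h
      · rw [hp.canonicalPath_opening hf (by omega) h1] at h
        have := (hp.canonicalPath_range hf (l := l) (by omega)).1 j hj
        omega
    intro i hi j hj h
    rcases Nat.lt_or_ge l i with h1 | h1 <;> rcases Nat.lt_or_ge l j with h2 | h2
    · rw [show i = j by omega]
    · rw [show i = l + 1 by omega] at h ⊢
      exact key j h2 h
    · rw [show j = l + 1 by omega] at h ⊢
      exact (key i h1 h.symm).symm
    · exact ih (by omega) i h1 j h2 h

lemma IsPartner.pathVertices_eq (hp : IsPartner π f) (hf : NCInv 0 k f) :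
    pathVertices π = Finset.range (openCount f k + 1) := by
  obtain ⟨h1, h2, -⟩ := hp.canonicalPath_range hf le_rfl
  ext v
  rw [pathVertices, Finset.mem_insert, Finset.mem_image, Finset.mem_range]
  constructor
  · rintro (rfl | ⟨i, hi, rfl⟩)
    · omega
    · have := h1 i (Finset.mem_range.1 hi).le
      omega
  · intro hv
    obtain ⟨i, hi, rfl⟩ := h2 v (by omega)
    rcases Nat.lt_or_ge i k with h | h
    · exact Or.inr ⟨i, Finset.mem_range.2 h, rfl⟩
    · left
      rw [show i = k by omega, hp.canonicalPath_length hf]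

lemma IsPartner.card_pathVertices (hp : IsPartner π f) (hf : NCInv 0 k f) :
    2 * Fintype.card (pathVertices π) = k + 2 := by
  rw [Fintype.card_coe, hp.pathVertices_eq hf, Finset.card_range]
  have := hf.two_mul_openCount
  omega

lemma IsPartner.canonicalPath_mem (hp : IsPartner π f) (hf : NCInv 0 k f) {i : ℕ} (hi : i ≤ k) :
    canonicalPath π i ∈ pathVertices π := by
  rw [hp.pathVertices_eq hf, Finset.mem_range]
  have := (hp.canonicalPath_range hf le_rfl).1 i hi
  omega

lemma IsPartner.exists_canonicalPath_eq (hp : IsPartner π f) (hf : NCInv 0 k f) {v : ℕ}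
    (hv : v ∈ pathVertices π) : ∃ i ≤ k, canonicalPath π i = v := by
  rw [hp.pathVertices_eq hf, Finset.mem_range] at hv
  exact (hp.canonicalPath_range hf le_rfl).2.1 v (by omega)

lemma IsPartner.canonicalPath_mod (hp : IsPartner π f) (hf : NCInv 0 k f) {i : ℕ} (hi : i < k) :
    canonicalPath π ((i + 1) % k) = canonicalPath π (i + 1) := by
  rcases Nat.lt_or_ge (i + 1) k with h | h
  · rw [Nat.mod_eq_of_lt h]
  · rw [show i + 1 = k by omega, Nat.mod_self, hp.canonicalPath_length hf, canonicalPath_zero]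

end Path

/-! ### Integration of one variable of a cube -/

/-- Combine the value `s` of one variable with the values `y` of the others. -/
def insertVar {A B : Type*} (e : Option A ≃ B) (y : A → ℝ) (s : ℝ) (b : B) : ℝ :=
  (e.symm b).elim s y

@[simp] lemma insertVar_some {A B : Type*} (e : Option A ≃ B) (y : A → ℝ) (s : ℝ) (a : A) :
    insertVar e y s (e (some a)) = y a := by simp [insertVar]

@[simp] lemma insertVar_none {A B : Type*} (e : Option A ≃ B) (y : A → ℝ) (s : ℝ) :
    insertVar e y s (e none) = s := by simp [insertVar]

/-- Checked on boxes. An arbitrary equivalence with `Option A` lets any coordinate be split off;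
this is used for the tip of a removed excursion and for the vertex on which `Jcond` conditions. -/
lemma measurePreserving_insertVar {A B : Type*} [Fintype A] [Fintype B] (e : Option A ≃ B) :
    MeasurePreserving (fun p : (A → ℝ) × ℝ => insertVar e p.1 p.2)
      ((Measure.pi fun _ : A => unitVol).prod unitVol) (Measure.pi fun _ : B => unitVol) := by
  have hm : Measurable fun p : (A → ℝ) × ℝ => insertVar e p.1 p.2 := by
    refine measurable_pi_lambda _ fun b => ?_
    obtain ⟨o, rfl⟩ := e.surjective b
    cases o with
    | none => simpa using measurable_snd
    | some a => simpa [Function.comp_def] using (measurable_pi_apply a).comp measurable_fst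
  refine ⟨hm, (Measure.pi_eq fun s hs => ?_).symm⟩
  have hpre : (fun p : (A → ℝ) × ℝ => insertVar e p.1 p.2) ⁻¹' Set.univ.pi s =
      (Set.univ.pi fun a => s (e (some a))) ×ˢ s (e none) := by
    ext p
    simp only [Set.mem_preimage, Set.mem_univ_pi, Set.mem_prod]
    rw [← e.forall_congr_right, Option.forall]
    simp [and_comm]
  rw [Measure.map_apply hm (MeasurableSet.univ_pi hs), hpre, Measure.prod_prod, Measure.pi_pi,
    ← e.prod_comp, Fintype.prod_option, mul_comm]

lemma integral_insertVar {A B : Type*} [Fintype A] [Fintype B] (e : Option A ≃ B)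
    {G : (B → ℝ) → ℝ} (hG : Integrable G (Measure.pi fun _ : B => unitVol)) :
    Integrable (fun p : (A → ℝ) × ℝ => G (insertVar e p.1 p.2))
      ((Measure.pi fun _ : A => unitVol).prod unitVol) ∧
    ∫ y, G y ∂(Measure.pi fun _ : B => unitVol) =
      ∫ p, G (insertVar e p.1 p.2) ∂((Measure.pi fun _ : A => unitVol).prod unitVol) := by
  have h := measurePreserving_insertVar e
  refine ⟨h.integrable_comp_of_integrable hG, ?_⟩
  rw [← h.map_eq, integral_map h.measurable.aemeasurable]
  rw [h.map_eq]
  exact hG.aestronglyMeasurable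

lemma integral_insertVar_fst {A B : Type*} [Fintype A] [Fintype B] (e : Option A ≃ B)
    {G : (B → ℝ) → ℝ} (hG : Integrable G (Measure.pi fun _ : B => unitVol)) :
    Integrable (fun y => ∫ s, G (insertVar e y s) ∂unitVol) (Measure.pi fun _ : A => unitVol) ∧
    ∫ y, G y ∂(Measure.pi fun _ : B => unitVol) =
      ∫ y, ∫ s, G (insertVar e y s) ∂unitVol ∂(Measure.pi fun _ : A => unitVol) := by
  obtain ⟨h1, h2⟩ := integral_insertVar e hG
  exact ⟨h1.integral_prod_left, by rw [h2, integral_prod _ h1]⟩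

lemma integral_insertVar_snd {A B : Type*} [Fintype A] [Fintype B] (e : Option A ≃ B)
    {G : (B → ℝ) → ℝ} (hG : Integrable G (Measure.pi fun _ : B => unitVol)) :
    ∫ y, G y ∂(Measure.pi fun _ : B => unitVol) =
      ∫ s, ∫ y, G (insertVar e y s) ∂(Measure.pi fun _ : A => unitVol) ∂unitVol := by
  obtain ⟨h1, h2⟩ := integral_insertVar e hG
  rw [h2, integral_prod_symm _ h1]

/-! ### The path weight -/

lemma pathWeight_extendBy_abs_le {w : ℝ → ℝ} {M : ℝ} (hM : ∀ x ∈ Set.Icc (0 : ℝ) 1, |w x| ≤ M)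
    {k : ℕ} (π : Ptn k) {x : ℕ → ℝ} (hx : ∀ i, x i ∈ Set.Icc (0 : ℝ) 1) :
    |pathWeight w π x| ≤ M ^ k := by
  rw [pathWeight, Finset.abs_prod]
  refine (Finset.prod_le_prod (fun _ _ => abs_nonneg _) fun i _ => hM _ ?_).trans
    (by rw [Finset.prod_const, Finset.card_range])
  have h1 := hx (canonicalPath π i)
  have h2 := hx (canonicalPath π ((i + 1) % k))
  refine ⟨abs_nonneg _, abs_le.2 ⟨?_, ?_⟩⟩ <;> linarith [h1.1, h1.2, h2.1, h2.2]

lemma extendBy_mem {V : Finset ℕ} {y : V → ℝ} {c : ℝ} (hy : ∀ i, y i ∈ Set.Icc (0 : ℝ) 1)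
    (hc : c ∈ Set.Icc (0 : ℝ) 1) (i : ℕ) : extendBy y c i ∈ Set.Icc (0 : ℝ) 1 := by
  rw [extendBy]
  split_ifs
  · exact hy _
  · exact hc

lemma extendBy_of_mem {V : Finset ℕ} {y : V → ℝ} {c : ℝ} {i : ℕ} (hi : i ∈ V) :
    extendBy y c i = y ⟨i, hi⟩ := dif_pos hi

lemma ae_continuousAt_comp_abs_sub {w : ℝ → ℝ} (hw : RiemannIntegrableUnit w) {ι : Type*}
    [Fintype ι] {a b : ι} (hab : a ≠ b) :
    ∀ᵐ y ∂(Measure.pi fun _ : ι => unitVol), ContinuousAt (fun y : ι → ℝ => w |y a - y b|) y := by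
  -- Continuity of `w` is known only at almost every point of the open interval, so the distance `0`
  -- has to be excluded as well.
  have h0 : ∀ᵐ x : ℝ, x ≠ 0 := by simp [ae_iff]
  filter_upwards [ae_abs_sub_pi hab (hw.ae_continuousAt.and h0), ae_mem_Ioo_pi] with y hy hy01
  have h1 := hy01 a
  have h2 := hy01 b
  have hmem : |y a - y b| ∈ Set.Ioo (0 : ℝ) 1 :=
    ⟨lt_of_le_of_ne (abs_nonneg _) hy.2.symm, abs_lt.2 ⟨by linarith [h1.1, h2.2],
      by linarith [h1.2, h2.1]⟩⟩
  have hc : ContinuousAt (fun y : ι → ℝ => |y a - y b|) y := by fun_prop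
  exact ContinuousAt.comp (f := fun y : ι → ℝ => |y a - y b|) (g := w) (hy.1 hmem) hc

section
variable {w : ℝ → ℝ} {k : ℕ} {π : Ptn k} {f : ℕ → ℕ}

lemma IsPartner.ae_continuousAt_pathWeight (hp : IsPartner π f) (hf : NCInv 0 k f)
    (hw : RiemannIntegrableUnit w) :
    ∀ᵐ y ∂(Measure.pi fun _ : pathVertices π => unitVol),
      ContinuousAt (fun y => pathWeight w π (extendBy y 0)) y := by
  have h : ∀ i : Fin k, ∀ᵐ y ∂(Measure.pi fun _ : pathVertices π => unitVol),
      ContinuousAt (fun y : pathVertices π → ℝ => w |extendBy y 0 (canonicalPath π i) -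
        extendBy y 0 (canonicalPath π ((i + 1) % k))|) y := by
    intro i
    rw [hp.canonicalPath_mod hf i.2]
    have h1 := hp.canonicalPath_mem hf i.2.le
    have h2 := hp.canonicalPath_mem hf (i := i + 1) i.2
    simp only [extendBy_of_mem h1, extendBy_of_mem h2]
    exact ae_continuousAt_comp_abs_sub hw fun h =>
      hp.canonicalPath_succ_ne hf i.2 (congrArg Subtype.val h)
  filter_upwards [ae_all_iff.2 h] with y hy
  simp only [pathWeight]
  exact tendsto_finsetProd _ fun i hi => hy ⟨i, Finset.mem_range.1 hi⟩

lemma IsPartner.integrable_pathWeight (hp : IsPartner π f) (hf : NCInv 0 k f)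
    (hw : RiemannIntegrableUnit w) :
    Integrable (fun y => pathWeight w π (extendBy y 0))
      (Measure.pi fun _ : pathVertices π => unitVol) := by
  obtain ⟨M, -, hM⟩ := hw.bounded
  refine Integrable.of_bound
    (aestronglyMeasurable_of_ae_continuousAt (hp.ae_continuousAt_pathWeight hf hw)) (M ^ k) ?_
  filter_upwards [ae_mem_Ioo_pi] with y hy
  exact pathWeight_extendBy_abs_le hM π
    (extendBy_mem (fun i => Set.Ioo_subset_Icc_self (hy i)) (by simp))

lemma J_eq_integral (w : ℝ → ℝ) (π : Ptn k) :
    J w π = ∫ y, pathWeight w π (extendBy y 0) ∂(Measure.pi fun _ : pathVertices π => unitVol) := by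
  rw [J, restrict_cube]

lemma Jcond_eq_integral (w : ℝ → ℝ) (π : Ptn k) (v : ℕ) (c : ℝ) :
    Jcond w π v c = ∫ y, pathWeight w π (extendBy y c)
      ∂(Measure.pi fun _ : (pathVertices π).erase v => unitVol) := by
  rw [Jcond, restrict_cube]

lemma abs_J_le {M : ℝ} (hM : ∀ x ∈ Set.Icc (0 : ℝ) 1, |w x| ≤ M) (π : Ptn k) :
    |J w π| ≤ M ^ k := by
  rw [J_eq_integral]
  have h : ∀ᵐ y ∂(Measure.pi fun _ : pathVertices π => unitVol),
      ‖pathWeight w π (extendBy y 0)‖ ≤ M ^ k := by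
    filter_upwards [ae_mem_Ioo_pi] with y hy
    exact pathWeight_extendBy_abs_le hM π
      (extendBy_mem (fun i => Set.Ioo_subset_Icc_self (hy i)) (by simp))
  simpa using norm_integral_le_of_norm_le_const h

end

/-- The element `v` of `V` as an additional point of `V.erase v`. -/
def optionEraseEquiv {V : Finset ℕ} {v : ℕ} (hv : v ∈ V) : Option (V.erase v) ≃ V where
  toFun o := o.elim ⟨v, hv⟩ fun u => ⟨u, Finset.mem_of_mem_erase u.2⟩
  invFun u := if h : (u : ℕ) = v then none else some ⟨u, Finset.mem_erase.2 ⟨h, u.2⟩⟩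
  left_inv o := by
    cases o with
    | none => simp
    | some u => simp [Finset.ne_of_mem_erase u.2]
  right_inv u := by
    dsimp only
    split_ifs with h
    · exact Subtype.ext h.symm
    · rfl

lemma extendBy_insertVar_erase {V : Finset ℕ} {v : ℕ} (hv : v ∈ V) (y : V.erase v → ℝ) (s : ℝ)
    {u : ℕ} (hu : u ∈ V) :
    extendBy (insertVar (optionEraseEquiv hv) y s) 0 u = extendBy y s u := by
  rw [extendBy_of_mem hu]
  by_cases h : u = v
  · subst h
    rw [extendBy, dif_neg (Finset.notMem_erase u V)]
    exact insertVar_none (optionEraseEquiv hv) y s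
  · have hu' : u ∈ V.erase v := Finset.mem_erase.2 ⟨h, hu⟩
    rw [extendBy_of_mem hu']
    exact insertVar_some (optionEraseEquiv hv) y s ⟨u, hu'⟩

/-! ### Removing a pair of neighbours -/

/-- The increasing map that skips `m` and `m + 1`. -/
def skipNat (m i : ℕ) : ℕ := if i < m then i else i + 2

/-- A left inverse of `skipNat m`. -/
def unskipNat (m i : ℕ) : ℕ := if i < m then i else i - 2

lemma skipPair_coe {k : ℕ} (m : Fin (k + 1)) (i : Fin k) :
    (skipPair m i : ℕ) = skipNat m i := by
  rw [skipPair, skipNat]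
  split_ifs <;> rfl

/-- The pairing `f` with the pair `{m, m + 1}` removed. -/
def removeInv (m : ℕ) (f : ℕ → ℕ) (i : ℕ) : ℕ := unskipNat m (f (skipNat m i))

lemma unskipNat_spec {m i : ℕ} : (i < m ∧ unskipNat m i = i) ∨ (m ≤ i ∧ unskipNat m i = i - 2) := by
  rw [unskipNat]; split_ifs <;> omega

lemma skipNat_spec {m i : ℕ} : (i < m ∧ skipNat m i = i) ∨ (m ≤ i ∧ skipNat m i = i + 2) := by
  rw [skipNat]; split_ifs <;> omega

section Remove
variable {k m : ℕ} {f : ℕ → ℕ}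

/-- The partner of a point outside `{m, m + 1}` is again outside, so nothing is lost by `unskipNat`.
-/
lemma NCInv.skipNat_removeInv (hf : NCInv 0 (k + 2) f) (h1 : f m = m + 1)
    (i : ℕ) : skipNat m (removeInv m f i) = f (skipNat m i) := by
  have h2 := hf.invol (skipNat m i)
  have h3 : f (m + 1) = m := by rw [← h1, hf.invol]
  have h4 := @skipNat_spec m i
  have h5 : f (skipNat m i) ≠ m := fun h => by rw [h, h1] at h2; omega
  have h6 : f (skipNat m i) ≠ m + 1 := fun h => by rw [h, h3] at h2; omega
  have h7 := @unskipNat_spec m (f (skipNat m i))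
  have h8 := @skipNat_spec m (removeInv m f i)
  rw [removeInv] at *
  omega

lemma NCInv.removeInv (hf : NCInv 0 (k + 2) f) (hm : m ≤ k) (h1 : f m = m + 1) :
    NCInv 0 k (removeInv m f) := by
  have key := hf.skipNat_removeInv h1
  refine ⟨fun i hi => ?_, fun i _ hi => ?_, fun i _ hi => ?_, fun i => ?_, fun i j h2 h3 h4 => ?_⟩
  · have h2 := @skipNat_spec m i
    have h3 := hf.out (skipNat m i) (by omega)
    have h4 := @unskipNat_spec m (f (skipNat m i))
    rw [WeightedEnsemble.removeInv]; omega
  · have h2 := @skipNat_spec m i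
    have h3 := hf.maps (skipNat m i) (Nat.zero_le _) (by omega)
    have h4 := @skipNat_spec m (WeightedEnsemble.removeInv m f i)
    have := key i
    omega
  · have h2 := @skipNat_spec m i
    have h3 := hf.ne (skipNat m i) (Nat.zero_le _) (by omega)
    intro h
    have h4 := key i
    rw [h] at h4
    exact h3 h4.symm
  · have h2 := key (WeightedEnsemble.removeInv m f i)
    rw [key i, hf.invol] at h2
    have h3 := @skipNat_spec m i
    have h4 := @skipNat_spec m (WeightedEnsemble.removeInv m f (WeightedEnsemble.removeInv m f i))
    omega
  · have hmono : ∀ a b, a < b → skipNat m a < skipNat m b := by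
      intro a b hab
      have h3 := @skipNat_spec m a
      have h4 := @skipNat_spec m b
      omega
    have h5 := hmono _ _ h2
    have h6 := hmono _ _ h3
    have h7 := hmono _ _ h4
    rw [key] at h6 h7
    rw [key] at h7
    exact hf.nc _ _ h5 h6 h7

lemma removePair_part_eq_iff {π : Ptn (k + 2)} {m : Fin (k + 1)} (i j : Fin k) :
    (removePair π m).part i = (removePair π m).part j ↔
      π.part (skipPair m i) = π.part (skipPair m j) := by
  classical
  rw [eq_comm, ← Finpartition.mem_part_iff_part_eq_part _ (Finset.mem_univ _) (Finset.mem_univ _),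
    removePair, Finpartition.mem_part_ofSetoid_iff_rel]
  rfl

lemma IsPartner.removePair {π : Ptn (k + 2)} (hp : IsPartner π f) (hf : NCInv 0 (k + 2) f)
    {m : Fin (k + 1)} (h1 : f m = m + 1) :
    IsPartner (removePair π m) (removeInv m f) := by
  have key := hf.skipNat_removeInv h1
  have hf' := hf.removeInv (by omega) h1
  intro i j
  rw [linked_iff]
  have hinj : ∀ a b, skipNat m a = skipNat m b ↔ a = b := by
    intro a b
    have h3 := @skipNat_spec m a
    have h4 := @skipNat_spec m b
    omega
  have main : ∀ i j : Fin k, (WeightedEnsemble.removePair π m).part i =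
      (WeightedEnsemble.removePair π m).part j ↔ (j : ℕ) = i ∨ (j : ℕ) = removeInv m f i := by
    intro i j
    rw [removePair_part_eq_iff, ← linked_coe_iff, hp, skipPair_coe, skipPair_coe, hinj, ← key, hinj]
    have := (skipPair m i).2
    rw [skipPair_coe] at this
    simp [this]
  constructor
  · rintro ⟨hi, hj, h⟩
    exact ⟨hi, (main ⟨i, hi⟩ ⟨j, hj⟩).1 h⟩
  · rintro ⟨hi, h⟩
    have hj : j < k := by
      rcases h with h | h
      · omega
      · rw [h]; exact (hf'.maps i (Nat.zero_le _) hi).2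
    exact ⟨hi, hj, (main ⟨i, hi⟩ ⟨j, hj⟩).2 h⟩

lemma openCount_removeInv (hf : NCInv 0 (k + 2) f) (h1 : f m = m + 1) {i : ℕ} (hi : i ≤ m) :
    openCount (removeInv m f) i = openCount f i := by
  unfold openCount
  congr 1
  refine Finset.filter_congr fun j hj => ?_
  have hj' := Finset.mem_range.1 hj
  have h2 := hf.skipNat_removeInv h1 j
  have h3 := @skipNat_spec m j
  have h4 := @skipNat_spec m (removeInv m f j)
  rw [show skipNat m j = j by omega] at h2
  omega

variable {π : Ptn (k + 2)}

/-- Up to index `m` the two constructions see the same opening and closing points. In particular,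
the vertex at which the excursion starts carries the same label in both paths, as the recursion
formula for `J` presupposes. -/
lemma canonicalPath_removePair_of_le (hp : IsPartner π f) (hf : NCInv 0 (k + 2) f) {m : Fin (k + 1)}
    (h1 : f m = m + 1) {i : ℕ} (hi : i ≤ m) :
    canonicalPath (removePair π m) i = canonicalPath π i := by
  have hp' := hp.removePair hf h1
  have hf' := hf.removeInv (show (m : ℕ) ≤ k by omega) h1
  have hmk := m.2
  induction i using Nat.strong_induction_on with
  | _ i ih =>
    rcases Nat.eq_zero_or_pos i with rfl | hi0
    · rw [canonicalPath_zero, canonicalPath_zero]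
    · obtain ⟨i, rfl⟩ : ∃ j, i = j + 1 := ⟨i - 1, by omega⟩
      have h2 := hf.skipNat_removeInv h1 i
      have h3 := @skipNat_spec m i
      have h4 := @skipNat_spec m (removeInv m f i)
      rw [show skipNat m i = i by omega] at h2
      have h5 := hf.ne i (Nat.zero_le _) (by omega)
      rcases lt_or_gt_of_ne h5 with h | h
      · have h6 : removeInv m f i = f i := by omega
        rw [hp.canonicalPath_closing hf (by omega) h,
          hp'.canonicalPath_closing hf' (by omega) (by omega), h6]
        exact ih _ (by omega) (by omega)
      · rw [hp.canonicalPath_opening hf (by omega) h,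
          hp'.canonicalPath_opening hf' (by omega) (by omega), openCount_removeInv hf h1 (by omega)]

/-- The only jump of the skipping map is across the excursion, whose two ends coincide. -/
lemma canonicalPath_skip_succ (hp : IsPartner π f) (hf : NCInv 0 (k + 2) f) (hm : m ≤ k)
    (h1 : f m = m + 1) (i : ℕ) :
    canonicalPath π (skipNat m (i + 1)) = canonicalPath π (skipNat m i + 1) := by
  have h2 := @skipNat_spec m i
  have h3 := @skipNat_spec m (i + 1)
  by_cases h : i + 1 = m
  · have h4 := (hp.backtracks hf m (by omega) (by omega)).2
    rw [h1] at h4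
    rw [show skipNat m (i + 1) = m + 1 + 1 by omega, h4, show skipNat m i + 1 = m by omega]
  · rw [show skipNat m (i + 1) = skipNat m i + 1 by omega]

/-- The canonical path of `removePair π m` is, up to relabelling, the canonical path of `π` with
the excursion along the removed pair cut out. -/
lemma canonicalPath_removePair_eq_iff (hp : IsPartner π f) (hf : NCInv 0 (k + 2) f)
    {m : Fin (k + 1)} (h1 : f m = m + 1) {i j : ℕ} (hi : i ≤ k) (hj : j ≤ k) :
    (canonicalPath (removePair π m) i = canonicalPath (removePair π m) j ↔
      canonicalPath π (skipNat m i) = canonicalPath π (skipNat m j)) ∧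
    canonicalPath π (skipNat m i) ≠ canonicalPath π (m + 1) := by
  have hmk := m.2
  have hp' := hp.removePair hf h1
  have hf' := hf.removeInv (show (m : ℕ) ≤ k by omega) h1
  have key := hf.skipNat_removeInv h1
  have hsk : ∀ i : ℕ, (i < (m : ℕ) ∧ skipNat m i = i) ∨ ((m : ℕ) ≤ i ∧ skipNat m i = i + 2) := fun i => skipNat_spec
  -- The reduced path with an excursion to a fresh vertex `none` inserted at `m`. It backtracks
  -- along `f`, so it factors through the canonical path of `π`; this shows that the tip is a
  -- separate vertex and that no further identifications occur.
  let q : ℕ → Option ℕ := fun i => if i ≤ m then some (canonicalPath (removePair π m) i) else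
    if i = m + 1 then none else some (canonicalPath (removePair π m) (i - 2))
  have hq1 : ∀ i, q (skipNat m i) = some (canonicalPath (removePair π m) i) := by
    intro i
    have h2 := hsk i
    simp only [q]
    split_ifs with h3 h4
    · rw [show skipNat m i = i by omega]
    · omega
    · rw [show skipNat m i - 2 = i by omega]
  have hq2 : ∀ i, q (skipNat m i + 1) = some (canonicalPath (removePair π m) (i + 1)) := by
    intro i
    have h2 := hsk i
    simp only [q]
    split_ifs with h3 h4
    · rw [show skipNat m i = i by omega]
    · omega
    · rw [show skipNat m i + 1 - 2 = i + 1 by omega]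
  have hq3 : q (m + 1) = none := by simp [q]
  have hqB : Backtracks (k + 2) f q := by
    intro i hi hif
    by_cases h2 : i = m
    · rw [h2, h1]
      refine ⟨rfl, ?_⟩
      simp [q]
    · have h3 : i ≠ m + 1 := by
        rintro rfl
        rw [← h1, hf.invol] at hif
        omega
      obtain ⟨i0, hi0, rfl⟩ : ∃ i0, i0 < k ∧ i = skipNat m i0 := by
        rcases Nat.lt_or_ge i m with h | h
        · exact ⟨i, by omega, by have := hsk i; omega⟩
        · exact ⟨i - 2, by omega, by have := hsk (i - 2); omega⟩
      rw [← key] at hif ⊢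
      have h4 : i0 < removeInv m f i0 := by
        have := hsk i0
        have := hsk (removeInv m f i0)
        omega
      have h5 := hp'.backtracks hf' i0 hi0 h4
      rw [hq1, hq2, hq2, hq1, h5.1, h5.2]
      exact ⟨rfl, rfl⟩
  -- Conversely, the canonical path of `π` with the excursion cut out backtracks along the reduced
  -- pairing, hence factors through the reduced canonical path.
  have hpB : Backtracks k (removeInv m f) fun i => canonicalPath π (skipNat m i) := by
    intro i hi hif
    have h2 : skipNat m i < f (skipNat m i) := by
      rw [← key]
      have := hsk i
      have := hsk (removeInv m f i)
      omega
    have h3 := hp.backtracks hf (skipNat m i) (by have := hsk i; omega) h2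
    simp only [canonicalPath_skip_succ hp hf (show (m : ℕ) ≤ k by omega) h1, key]
    exact h3
  have hle : ∀ i, i ≤ k → skipNat m i ≤ k + 2 := fun i hi => by have := hsk i; omega
  refine ⟨⟨fun h => ?_, fun h => ?_⟩, fun h => ?_⟩
  · exact hp'.eq_of_canonicalPath_eq hf' hpB k le_rfl i hi j hj h
  · have := hp.eq_of_canonicalPath_eq hf hqB (k + 2) le_rfl _ (hle i hi) _ (hle j hj) h
    rw [hq1, hq1] at this
    exact Option.some.inj this
  · have := hp.eq_of_canonicalPath_eq hf hqB (k + 2) le_rfl _ (hle i hi) _ (by omega) h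
    rw [hq1, hq3] at this
    exact Option.some_ne_none _ this

/-- The vertices of `π` are those of the reduced pairing, possibly renamed, together with the tip of
the excursion. This is the change of variables behind the recursion for `J`. -/
lemma exists_vertexEquiv (hp : IsPartner π f) (hf : NCInv 0 (k + 2) f)
    {m : Fin (k + 1)} (h1 : f m = m + 1) :
    ∃ e : Option (pathVertices (removePair π m)) ≃ pathVertices π,
      (e none : ℕ) = canonicalPath π (m + 1) ∧
      ∀ (i : ℕ) (_ : i ≤ k) (h : canonicalPath (removePair π m) i ∈ pathVertices (removePair π m)),
        (e (some ⟨canonicalPath (removePair π m) i, h⟩) : ℕ) = canonicalPath π (skipNat m i) := by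
  have hmk := m.2
  have hp' := hp.removePair hf h1
  have hf' := hf.removeInv (show (m : ℕ) ≤ k by omega) h1
  have hsk : ∀ i : ℕ, (i < (m : ℕ) ∧ skipNat m i = i) ∨ ((m : ℕ) ≤ i ∧ skipNat m i = i + 2) := fun i => skipNat_spec
  have hex : ∀ v : pathVertices (removePair π m), ∃ i, i ≤ k ∧
      canonicalPath (removePair π m) i = v := fun v => hp'.exists_canonicalPath_eq hf' v.2
  choose g hg1 hg2 using hex
  let E : Option (pathVertices (removePair π m)) → pathVertices π := fun o =>
    o.elim ⟨canonicalPath π (m + 1), hp.canonicalPath_mem hf (by omega)⟩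
      fun v => ⟨canonicalPath π (skipNat m (g v)), hp.canonicalPath_mem hf (by
        have := hsk (g v); have := hg1 v; omega)⟩
  have hE : ∀ (i : ℕ) (_ : i ≤ k)
      (h : canonicalPath (removePair π m) i ∈ pathVertices (removePair π m)),
      (E (some ⟨canonicalPath (removePair π m) i, h⟩) : ℕ) = canonicalPath π (skipNat m i) :=
    fun i hi h => (canonicalPath_removePair_eq_iff hp hf h1 (hg1 _) hi).1.1 (hg2 ⟨_, h⟩)
  have hbij : Function.Bijective E := by
    constructor
    · intro o o' h
      have h2 : (E o : ℕ) = E o' := congrArg Subtype.val h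
      rcases o with _ | v <;> rcases o' with _ | v'
      · rfl
      · exact absurd h2.symm (canonicalPath_removePair_eq_iff hp hf h1 (hg1 v') (hg1 v')).2
      · exact absurd h2 (canonicalPath_removePair_eq_iff hp hf h1 (hg1 v) (hg1 v)).2
      · have h3 := (canonicalPath_removePair_eq_iff hp hf h1 (hg1 v) (hg1 v')).1.2 h2
        rw [hg2, hg2] at h3
        rw [Subtype.ext h3]
    · rintro ⟨v, hv⟩
      obtain ⟨i, hi, rfl⟩ := hp.exists_canonicalPath_eq hf hv
      by_cases h2 : i = m + 1
      · exact ⟨none, Subtype.ext (by subst h2; rfl)⟩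
      · have h3 : ∃ i0 ≤ k, canonicalPath π (skipNat m i0) = canonicalPath π i := by
          rcases Nat.lt_or_ge i m with h | h
          · exact ⟨i, by omega, by rw [show skipNat m i = i by have := hsk i; omega]⟩
          · rcases Nat.eq_or_lt_of_le h with h | h
            · have h4 := (hp.backtracks hf m (by omega) (by omega)).2
              rw [h1] at h4
              exact ⟨m, by omega, by
                rw [show skipNat m m = m + 1 + 1 by have := hsk m; omega, h4, h]⟩
            · exact ⟨i - 2, by omega, by
                rw [show skipNat m (i - 2) = i by have := hsk (i - 2); omega]⟩
        obtain ⟨i0, hi0, h4⟩ := h3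
        exact ⟨some ⟨_, hp'.canonicalPath_mem hf' hi0⟩, Subtype.ext ((hE i0 hi0 _).trans h4)⟩
  exact ⟨Equiv.ofBijective E hbij, rfl, hE⟩

lemma prod_range_skip {R : Type*} [CommMonoid R] (F : ℕ → R) (hm : m ≤ k) :
    ∏ i ∈ Finset.range (k + 2), F i =
      F m * F (m + 1) * ∏ i ∈ Finset.range k, F (skipNat m i) := by
  obtain ⟨r, rfl⟩ := Nat.exists_eq_add_of_le hm
  have h1 : ∏ i ∈ Finset.range m, F (skipNat m i) = ∏ i ∈ Finset.range m, F i :=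
    Finset.prod_congr rfl fun i hi => by rw [skipNat, if_pos (Finset.mem_range.1 hi)]
  have h2 : ∏ i ∈ Finset.range r, F (skipNat m (m + i)) = ∏ i ∈ Finset.range r, F (m + 2 + i) :=
    Finset.prod_congr rfl fun i hi => by
      rw [skipNat, if_neg (by omega)]; congr 1; omega
  rw [show m + r + 2 = m + 2 + r by ring, Finset.prod_range_add, Finset.prod_range_succ,
    Finset.prod_range_succ, Finset.prod_range_add _ m r, h1, h2]
  simp only [mul_assoc, mul_comm, mul_left_comm]

lemma phi_eq_integral (w : ℝ → ℝ) (x : ℝ) : phi w x = ∫ s, w |x - s| ^ 2 ∂unitVol := by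
  rw [phi, intervalIntegral.integral_of_le zero_le_one, integral_Icc_eq_integral_Ioc]

/-- Recursive calculation of `J w π` by removing a pair of neighbours. -/
theorem J_eq_integral_removePair {w : ℝ → ℝ} (hw : RiemannIntegrableUnit w)
    (hp : IsPartner π f) (hf : NCInv 0 (k + 2) f) {m : Fin (k + 1)} (h1 : f m = m + 1) :
    J w π = ∫ x in (0 : ℝ)..1, phi w x * Jcond w (removePair π m) (canonicalPath π m) x := by
  have hmk := m.2
  have hp' := hp.removePair hf h1
  have hf' := hf.removeInv (show (m : ℕ) ≤ k by omega) h1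
  have hv : canonicalPath π m ∈ pathVertices (removePair π m) := by
    rw [← canonicalPath_removePair_of_le hp hf h1 le_rfl]
    exact hp'.canonicalPath_mem hf' (by omega)
  set π' := removePair π m with hπ'
  set v := canonicalPath π m with hv'
  obtain ⟨e, he1, he2⟩ := exists_vertexEquiv hp hf h1
  have hvm : canonicalPath π' m = v := canonicalPath_removePair_of_le hp hf h1 le_rfl
  have hskm : skipNat m m = m + 2 := by simp [skipNat]
  have hbt : canonicalPath π (m + 2) = v := by
    have h4 := (hp.backtracks hf m (by omega) (by omega)).2
    rwa [h1] at h4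
  have hsome : ∀ (y : pathVertices π' → ℝ) (s : ℝ) (i : ℕ), i ≤ k →
      extendBy (insertVar e y s) 0 (canonicalPath π (skipNat m i)) =
        extendBy y 0 (canonicalPath π' i) := by
    intro y s i hi
    have h2 := hp'.canonicalPath_mem hf' hi
    have h3 := he2 i hi h2
    rw [← h3, extendBy_of_mem (e (some ⟨_, h2⟩)).2, extendBy_of_mem h2, Subtype.coe_eta,
      insertVar_some]
  have hnone : ∀ (y : pathVertices π' → ℝ) (s : ℝ),
      extendBy (insertVar e y s) 0 (canonicalPath π (m + 1)) = s := by
    intro y s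
    rw [← he1, extendBy_of_mem (e none).2, Subtype.coe_eta, insertVar_none]
  -- The two removed edges join the vertex `v` to the tip and back, giving `w²`; the tip variable
  -- `s` occurs nowhere else. Integrating over `s` yields `φ`, after which the variable of `v` is
  -- singled out.
  have hweight : ∀ (y : pathVertices π' → ℝ) (s : ℝ),
      pathWeight w π (extendBy (insertVar e y s) 0) =
        w |extendBy y 0 v - s| ^ 2 * pathWeight w π' (extendBy y 0) := by
    intro y s
    have hmod : ∀ i ∈ Finset.range (k + 2), w |extendBy (insertVar e y s) 0 (canonicalPath π i) -
        extendBy (insertVar e y s) 0 (canonicalPath π ((i + 1) % (k + 2)))| =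
        w |extendBy (insertVar e y s) 0 (canonicalPath π i) -
        extendBy (insertVar e y s) 0 (canonicalPath π (i + 1))| := fun i hi => by
      rw [hp.canonicalPath_mod hf (Finset.mem_range.1 hi)]
    rw [pathWeight, Finset.prod_congr rfl hmod, prod_range_skip (m := m) _ (by omega), pathWeight]
    have hv2 : extendBy (insertVar e y s) 0 v = extendBy y 0 v := by
      have := hsome y s m (by omega)
      rwa [hskm, hbt, hvm] at this
    congr 1
    · rw [hnone, show (m : ℕ) + 1 + 1 = m + 2 by ring, hbt, ← hv', hv2, abs_sub_comm s, sq]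
    · refine Finset.prod_congr rfl fun i hi => ?_
      have hi' := Finset.mem_range.1 hi
      rw [hp'.canonicalPath_mod hf' hi', ← canonicalPath_skip_succ hp hf (by omega) h1,
        hsome y s i hi'.le, hsome y s (i + 1) hi']
  obtain ⟨hi1, hi2⟩ := integral_insertVar_fst e (hp.integrable_pathWeight hf hw)
  rw [J_eq_integral, hi2]
  have hinner : ∀ y : pathVertices π' → ℝ,
      ∫ s, pathWeight w π (extendBy (insertVar e y s) 0) ∂unitVol =
        phi w (extendBy y 0 v) * pathWeight w π' (extendBy y 0) := by
    intro y
    simp only [hweight]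
    rw [integral_mul_const, phi_eq_integral]
  simp only [hinner] at hi1 ⊢
  rw [integral_insertVar_snd (optionEraseEquiv hv) hi1, intervalIntegral.integral_of_le zero_le_one,
    ← integral_Icc_eq_integral_Ioc]
  refine integral_congr_ae (Eventually.of_forall fun x => ?_)
  simp only
  rw [Jcond_eq_integral, ← integral_const_mul]
  refine integral_congr_ae (Eventually.of_forall fun y => ?_)
  simp only
  congr 1
  · rw [extendBy_insertVar_erase hv y x hv, extendBy, dif_neg (Finset.notMem_erase v _)]
  · rw [pathWeight, pathWeight]
    refine Finset.prod_congr rfl fun i hi => ?_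
    have hi' := Finset.mem_range.1 hi
    rw [hp'.canonicalPath_mod hf' hi',
      extendBy_insertVar_erase hv y x (hp'.canonicalPath_mem hf' hi'.le),
      extendBy_insertVar_erase hv y x (hp'.canonicalPath_mem hf' hi')]

end Remove

/-! ### The variance profile -/

section Profile
variable {w : ℝ → ℝ}

lemma RiemannIntegrableUnit.aestronglyMeasurable (hw : RiemannIntegrableUnit w) :
    AEStronglyMeasurable w unitVol := by
  refine aestronglyMeasurable_of_tendsto_ae (f := fun (n : ℕ) x => w ((⌊(n : ℝ) * x⌋ : ℝ) / n))
    atTop (fun n => ?_) ?_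
  · have h2 : Measurable fun z : ℤ => w ((z : ℝ) / n) := .of_discrete
    exact (h2.comp (measurable_id.const_mul _).floor).aestronglyMeasurable
  · have h : ∀ᵐ x ∂unitVol, x ∈ Set.Ioo (0 : ℝ) 1 := by
      rw [unitVol, ← restrict_Ioo_eq_restrict_Icc]
      exact ae_restrict_mem measurableSet_Ioo
    filter_upwards [h, ae_restrict_of_ae hw.ae_continuousAt] with x hx hx'
    exact (hx' hx).tendsto.comp (tendsto_floor_div x)

lemma RiemannIntegrableUnit.integrable_sq (hw : RiemannIntegrableUnit w) :
    Integrable (fun x => w x ^ 2) unitVol := by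
  obtain ⟨M, -, hM⟩ := hw.bounded
  refine Integrable.of_bound (hw.aestronglyMeasurable.pow 2) (M ^ 2) ?_
  filter_upwards [ae_restrict_mem measurableSet_Icc] with x hx
  rw [Real.norm_eq_abs, abs_pow]
  exact pow_le_pow_left₀ (abs_nonneg _) (hM x hx) 2

lemma intervalIntegral_eq_unitVol (g : ℝ → ℝ) : ∫ x in (0 : ℝ)..1, g x = ∫ x, g x ∂unitVol := by
  rw [intervalIntegral.integral_of_le zero_le_one, integral_Icc_eq_integral_Ioc]

lemma RiemannIntegrableUnit.intervalIntegrable_sq (hw : RiemannIntegrableUnit w) {a b : ℝ}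
    (ha : a ∈ Set.Icc (0 : ℝ) 1) (hb : b ∈ Set.Icc (0 : ℝ) 1) :
    IntervalIntegrable (fun x => w x ^ 2) volume a b := by
  have h : IntervalIntegrable (fun x => w x ^ 2) volume 0 1 := by
    rw [intervalIntegrable_iff_integrableOn_Icc_of_le zero_le_one]
    exact hw.integrable_sq
  refine h.mono_set ?_
  rw [Set.uIcc_of_le zero_le_one]
  exact Set.uIcc_subset_Icc ha hb

/-- The primitive of `w²`. -/
def sqPrimitive (w : ℝ → ℝ) (x : ℝ) : ℝ := ∫ y in (0 : ℝ)..x, w y ^ 2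

/-- Split the integral at `y = x` and substitute `x - y` and `y - x` in the two halves. -/
lemma phi_eq (hw : RiemannIntegrableUnit w) {x : ℝ} (hx : x ∈ Set.Icc (0 : ℝ) 1) :
    phi w x = sqPrimitive w x + sqPrimitive w (1 - x) := by
  have h1x : 1 - x ∈ Set.Icc (0 : ℝ) 1 := ⟨by linarith [hx.2], by linarith [hx.1]⟩
  have e1 : Set.EqOn (fun y => w |x - y| ^ 2) (fun y => w (x - y) ^ 2) (Set.uIcc 0 x) := by
    intro y hy
    rw [Set.uIcc_of_le hx.1] at hy
    simp only [abs_of_nonneg (sub_nonneg.2 hy.2)]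
  have e2 : Set.EqOn (fun y => w |x - y| ^ 2) (fun y => w (y - x) ^ 2) (Set.uIcc x 1) := by
    intro y hy
    rw [Set.uIcc_of_le hx.2] at hy
    simp only [abs_sub_comm x y, abs_of_nonneg (sub_nonneg.2 hy.1)]
  have i1 : IntervalIntegrable (fun y => w |x - y| ^ 2) volume 0 x := by
    have h := (hw.intervalIntegrable_sq (a := x) (b := 0) hx (by simp)).comp_sub_left x
    rw [sub_self, sub_zero] at h
    exact h.congr_uIoo fun y hy => (e1 (Set.Ioo_subset_Icc_self hy)).symm
  have i2 : IntervalIntegrable (fun y => w |x - y| ^ 2) volume x 1 := by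
    have h := (hw.intervalIntegrable_sq (a := 0) (b := 1 - x) (by simp) h1x).comp_sub_right x
    rw [zero_add, sub_add_cancel] at h
    exact h.congr_uIoo fun y hy => (e2 (Set.Ioo_subset_Icc_self hy)).symm
  rw [phi, ← intervalIntegral.integral_add_adjacent_intervals i1 i2,
    intervalIntegral.integral_congr e1, intervalIntegral.integral_congr e2,
    intervalIntegral.integral_comp_sub_left (fun y => w y ^ 2),
    intervalIntegral.integral_comp_sub_right (fun y => w y ^ 2), sub_self, sub_zero, sqPrimitive,
    sqPrimitive]

lemma continuousOn_sqPrimitive (hw : RiemannIntegrableUnit w) :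
    ContinuousOn (sqPrimitive w) (Set.Icc 0 1) := by
  have h := intervalIntegral.continuousOn_primitive_interval'
    (hw.intervalIntegrable_sq (a := 0) (b := 1) (by simp) (by simp)) (a := 0) (by simp)
  rwa [Set.uIcc_of_le zero_le_one] at h

lemma continuousOn_phi (hw : RiemannIntegrableUnit w) : ContinuousOn (phi w) (Set.Icc 0 1) := by
  have h := continuousOn_sqPrimitive hw
  have h2 : ContinuousOn (fun x => sqPrimitive w x + sqPrimitive w (1 - x)) (Set.Icc 0 1) := by
    refine h.add (h.comp (by fun_prop) fun x hx => ?_)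
    exact ⟨by linarith [hx.2], by linarith [hx.1]⟩
  exact h2.congr fun x hx => phi_eq hw hx

/-- Fubini on the triangle `y ≤ x`: for fixed `y` the variable `x` ranges over an interval of length
`1 - y`. -/
lemma integral_sqPrimitive (hw : RiemannIntegrableUnit w) :
    ∫ x in (0 : ℝ)..1, sqPrimitive w x = ∫ x in (0 : ℝ)..1, (1 - x) * w x ^ 2 := by
  have hint : Integrable (Function.uncurry fun x y : ℝ => (Set.Iic x).indicator
      (fun y => w y ^ 2) y) (unitVol.prod unitVol) := by
    have h1 : Integrable (fun p : ℝ × ℝ => w p.2 ^ 2) (unitVol.prod unitVol) :=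
      hw.integrable_sq.comp_snd unitVol
    have h2 := h1.indicator (s := {p : ℝ × ℝ | p.2 ≤ p.1})
      (measurableSet_le measurable_snd measurable_fst)
    refine h2.congr (Eventually.of_forall fun p => ?_)
    simp only [Function.uncurry, Set.indicator, Set.mem_ofPred_eq, Set.mem_Iic]
  have hswap := integral_integral_swap hint
  rw [intervalIntegral_eq_unitVol, intervalIntegral_eq_unitVol]
  refine Eq.trans ?_ (hswap.trans ?_)
  · refine integral_congr_ae ?_
    filter_upwards [ae_restrict_mem measurableSet_Icc] with x hx
    rw [integral_indicator measurableSet_Iic, Measure.restrict_restrict measurableSet_Iic,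
      sqPrimitive, intervalIntegral.integral_of_le hx.1, ← integral_Icc_eq_integral_Ioc]
    congr 2
    ext y
    simp only [Set.mem_Icc, Set.mem_inter_iff, Set.mem_Iic]
    constructor
    · rintro ⟨h1, h2⟩; exact ⟨h2, h1, h2.trans hx.2⟩
    · rintro ⟨h1, h2, -⟩; exact ⟨h2, h1⟩
  · refine integral_congr_ae ?_
    filter_upwards [ae_restrict_mem measurableSet_Icc] with y hy
    have e : (fun x : ℝ => (Set.Iic x).indicator (fun y => w y ^ 2) y) =
        (Set.Ici y).indicator fun _ => w y ^ 2 := by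
      funext x
      simp only [Set.indicator, Set.mem_Iic, Set.mem_Ici]
    rw [e, integral_indicator measurableSet_Ici, Measure.restrict_restrict measurableSet_Ici]
    have e2 : Set.Ici y ∩ Set.Icc 0 1 = Set.Icc y 1 := by
      ext x
      simp only [Set.mem_Icc, Set.mem_inter_iff, Set.mem_Ici]
      constructor
      · rintro ⟨h1, -, h2⟩; exact ⟨h1, h2⟩
      · rintro ⟨h1, h2⟩; exact ⟨h1, hy.1.trans h1, h2⟩
    rw [e2, setIntegral_const, Real.volume_real_Icc_of_le hy.2, smul_eq_mul]

lemma phi0_eq (hw : RiemannIntegrableUnit w) :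
    phi0 w = 2 * ∫ x in (0 : ℝ)..1, (1 - x) * w x ^ 2 := by
  have h := continuousOn_sqPrimitive hw
  have i1 : IntervalIntegrable (sqPrimitive w) volume 0 1 :=
    ContinuousOn.intervalIntegrable (by rwa [Set.uIcc_of_le zero_le_one])
  have i2 : IntervalIntegrable (fun x => sqPrimitive w (1 - x)) volume 0 1 := by
    simpa using (i1.comp_sub_left 1).symm
  have e : Set.EqOn (phi w) (fun x => sqPrimitive w x + sqPrimitive w (1 - x)) (Set.uIcc 0 1) := by
    rw [Set.uIcc_of_le zero_le_one]
    exact fun x hx => phi_eq hw hx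
  rw [phi0, intervalIntegral.integral_congr e, intervalIntegral.integral_add i1 i2,
    intervalIntegral.integral_comp_sub_left (sqPrimitive w), sub_self, sub_zero,
    ← integral_sqPrimitive hw]
  ring

lemma phi0_eq_zero_iff (hw : RiemannIntegrableUnit w) :
    phi0 w = 0 ↔ ∀ᵐ x ∂(volume.restrict (Set.Icc (0 : ℝ) 1)), w x = 0 := by
  rw [phi0_eq hw, intervalIntegral_eq_unitVol, mul_eq_zero, or_iff_right two_ne_zero,
    integral_eq_zero_iff_of_nonneg_ae]
  · have h1 : ∀ᵐ x ∂unitVol, x ≠ 1 := ae_restrict_of_ae (by simp [ae_iff])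
    constructor
    · intro h
      filter_upwards [h, h1] with x hx hx1
      have : (1 - x) * w x ^ 2 = 0 := hx
      rcases mul_eq_zero.1 this with h2 | h2
      · exact absurd (sub_eq_zero.1 h2).symm hx1
      · exact pow_eq_zero_iff two_ne_zero |>.1 h2
    · intro h
      filter_upwards [h] with x hx
      simp [hx]
  · filter_upwards [ae_restrict_mem measurableSet_Icc] with x hx
    exact mul_nonneg (sub_nonneg.2 hx.2) (sq_nonneg _)
  · have h1 : ∀ᵐ x ∂unitVol, ‖1 - x‖ ≤ (1 : ℝ) := by
      filter_upwards [ae_restrict_mem measurableSet_Icc] with x hx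
      rw [Real.norm_eq_abs, abs_le]
      constructor <;> linarith [hx.1, hx.2]
    exact hw.integrable_sq.bdd_mul (by fun_prop) h1

/-- Let `G` be the primitive of `w²`. The integral of `w(1-y)²` over `[0, x]` is `G(1) - G(1-x)`, so
`φ(x) = G(x) + G(1-x)` equals `G(1)` for all `x` exactly when `w(y)² - w(1-y)²` has vanishing
integral over every `[0, x]`. By Lebesgue differentiation the integrand then vanishes almost
everywhere. -/
lemma phi_const_iff_symm (hw : RiemannIntegrableUnit w) :
    (∀ x ∈ Set.Icc (0 : ℝ) 1, phi w x = ∫ z in (0 : ℝ)..1, w z ^ 2) ↔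
      ∀ᵐ x ∂(volume.restrict (Set.Icc (0 : ℝ) 1)), w x ^ 2 = w (1 - x) ^ 2 := by
  have hsym : ∀ x ∈ Set.Icc (0 : ℝ) 1, 1 - x ∈ Set.Icc (0 : ℝ) 1 := fun x hx =>
    ⟨by linarith [hx.2], by linarith [hx.1]⟩
  have hrefl : ∀ x ∈ Set.Icc (0 : ℝ) 1,
      ∫ y in (0 : ℝ)..x, w (1 - y) ^ 2 = (∫ z in (0 : ℝ)..1, w z ^ 2) - sqPrimitive w (1 - x) := by
    intro x hx
    rw [intervalIntegral.integral_comp_sub_left (fun y => w y ^ 2), sub_zero, sqPrimitive,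
      ← intervalIntegral.integral_add_adjacent_intervals
        (hw.intervalIntegrable_sq (a := 0) (b := 1 - x) (by simp) (hsym x hx))
        (hw.intervalIntegrable_sq (b := 1) (hsym x hx) (by simp))]
    ring
  have i2 : ∀ x ∈ Set.Icc (0 : ℝ) 1, IntervalIntegrable (fun y => w (1 - y) ^ 2) volume 0 x := by
    intro x hx
    have h := (hw.intervalIntegrable_sq (a := 1) (b := 1 - x) (by simp) (hsym x hx)).comp_sub_left 1
    simpa using h
  constructor
  · intro h
    have hzero : ∀ x ∈ Set.Icc (0 : ℝ) 1, ∫ y in (0 : ℝ)..x, (w y ^ 2 - w (1 - y) ^ 2) = 0 := by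
      intro x hx
      rw [intervalIntegral.integral_sub (hw.intervalIntegrable_sq (by simp) hx) (i2 x hx),
        hrefl x hx, ← h x hx, phi_eq hw hx, sqPrimitive]
      ring
    have hI : IntervalIntegrable (fun y => w y ^ 2 - w (1 - y) ^ 2) volume 0 1 :=
      (hw.intervalIntegrable_sq (by simp) (by simp)).sub (i2 1 (by simp))
    have hd := hI.ae_hasDerivAt_integral
    rw [← restrict_Ioo_eq_restrict_Icc, ae_restrict_iff' measurableSet_Ioo]
    filter_upwards [hd] with x hx hx01
    have h1 := hx (by rw [Set.uIcc_of_le zero_le_one]; exact Set.Ioo_subset_Icc_self hx01) 0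
      (by simp)
    have h2 : (fun x => ∫ y in (0 : ℝ)..x, (w y ^ 2 - w (1 - y) ^ 2)) =ᶠ[𝓝 x] fun _ => 0 := by
      filter_upwards [isOpen_Ioo.mem_nhds hx01] with z hz
      exact hzero z (Set.Ioo_subset_Icc_self hz)
    have h3 := h1.unique ((hasDerivAt_const x (0 : ℝ)).congr_of_eventuallyEq h2)
    exact sub_eq_zero.1 h3
  · intro h x hx
    have e : sqPrimitive w x = ∫ y in (0 : ℝ)..x, w (1 - y) ^ 2 := by
      rw [sqPrimitive]
      refine intervalIntegral.integral_congr_ae ?_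
      rw [ae_restrict_iff' measurableSet_Icc] at h
      filter_upwards [h] with y hy hy'
      rw [Set.uIoc_of_le hx.1] at hy'
      exact hy ⟨hy'.1.le, hy'.2.trans hx.2⟩
    rw [phi_eq hw hx, e, hrefl x hx]
    ring

lemma phi_zero (hw : RiemannIntegrableUnit w) : phi w 0 = ∫ z in (0 : ℝ)..1, w z ^ 2 := by
  rw [phi_eq hw (by simp)]
  simp [sqPrimitive]

lemma phi0_of_const {c : ℝ} (h : ∀ x ∈ Set.Icc (0 : ℝ) 1, phi w x = c) : phi0 w = c := by
  have e : Set.EqOn (phi w) (fun _ => c) (Set.uIcc 0 1) := by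
    rw [Set.uIcc_of_le zero_le_one]
    exact h
  rw [phi0, intervalIntegral.integral_congr e]
  simp

/-- Equality in the Cauchy-Schwarz inequality for the continuous function `φ`. -/
lemma phi_eq_phi0_of_integral_sq (hw : RiemannIntegrableUnit w)
    (h : ∫ x in (0 : ℝ)..1, phi w x ^ 2 = phi0 w ^ 2) :
    ∀ x ∈ Set.Icc (0 : ℝ) 1, phi w x = phi0 w := by
  have hc := continuousOn_phi hw
  have hc2 : ContinuousOn (fun x => (phi w x - phi0 w) ^ 2) (Set.Icc 0 1) :=
    (hc.sub continuousOn_const).pow 2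
  by_contra hcon
  push Not at hcon
  obtain ⟨x, hx, hne⟩ := hcon
  have hpos := intervalIntegral.integral_pos zero_lt_one hc2 (fun _ _ => sq_nonneg _)
    ⟨x, hx, by have := sub_ne_zero.2 hne; positivity⟩
  have i1 : IntervalIntegrable (phi w) volume 0 1 :=
    ContinuousOn.intervalIntegrable (by rwa [Set.uIcc_of_le zero_le_one])
  have i2 : IntervalIntegrable (fun x => phi w x ^ 2) volume 0 1 :=
    ContinuousOn.intervalIntegrable (by rw [Set.uIcc_of_le zero_le_one]; exact hc.pow 2)
  have e : ∫ x in (0 : ℝ)..1, (phi w x - phi0 w) ^ 2 = 0 := by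
    have e1 : ∀ x, (phi w x - phi0 w) ^ 2 = phi w x ^ 2 - 2 * phi0 w * phi w x + phi0 w ^ 2 :=
      fun x => by ring
    simp only [e1]
    rw [intervalIntegral.integral_add (i2.sub (i1.const_mul _)) (by simp),
      intervalIntegral.integral_sub i2 (i1.const_mul _), h, intervalIntegral.integral_const_mul,
      ← phi0]
    simp
    ring
  linarith

end Profile

/-! ### The limiting moments -/

/-- The `k`-th moment of the limiting measure. -/
def limitMoment (w : ℝ → ℝ) (k : ℕ) : ℝ := ∑ π ∈ ncPairings k, J w π

section Moments
variable {w : ℝ → ℝ}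

/-- A non-crossing pairing has a pair of neighbours. -/
lemma NCInv.exists_neighbours {k : ℕ} {f : ℕ → ℕ} (hf : NCInv 0 (k + 2) f) :
    ∃ m ≤ k, f m = m + 1 := by
  classical
  have h0 := hf.lt_apply (by omega)
  -- Take the largest opening point `i`. If `i + 1` were not its partner, it would lie inside the
  -- block of `i` with its partner inside too, and would be a larger opening point.
  have h1 := Nat.findGreatest_spec (P := fun i => i < f i) (n := k + 1) (Nat.zero_le _) h0.1
  set i := Nat.findGreatest (fun i => i < f i) (k + 1)
  have h2 : i ≤ k + 1 := Nat.findGreatest_le _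
  have h3 := hf.maps i (Nat.zero_le _) (by omega)
  refine ⟨i, by omega, ?_⟩
  by_contra hne
  have h4 := hf.maps_inside (i := i) (j := i + 1) (by omega) (by omega)
  have h5 := hf.ne (i + 1) (Nat.zero_le _) (by omega)
  exact Nat.findGreatest_is_greatest (P := fun i => i < f i) (n := k + 1) (k := i + 1)
    (Nat.lt_succ_self _) (by omega) (by omega)

lemma J_zero (π : Ptn 0) : J w π = 1 := by
  rw [J_eq_integral]
  simp [pathWeight]

lemma Jcond_zero (π : Ptn 0) (v : ℕ) (c : ℝ) : Jcond w π v c = 1 := by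
  rw [Jcond_eq_integral]
  simp [pathWeight]

lemma limitMoment_of_not_even {k : ℕ} (hk : ¬ Even k) : limitMoment w k = 0 := by
  have h := card_ncPairings k
  rw [pairingCount, if_neg hk, Finset.card_eq_zero] at h
  rw [limitMoment, h, Finset.sum_empty]

lemma limitMoment_zero : limitMoment w 0 = 1 := by
  have h := card_ncPairings 0
  rw [limitMoment, Finset.sum_congr rfl fun π _ => J_zero π, Finset.sum_const, h]
  simp [pairingCount]

lemma J_two (hw : RiemannIntegrableUnit w) {π : Ptn 2} (hπ : IsNonCrossingPairing π) :
    J w π = phi0 w := by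
  obtain ⟨f, hf, hp⟩ := hπ.exists_partner
  obtain ⟨m, hm, h1⟩ := hf.exists_neighbours (k := 0)
  rw [J_eq_integral_removePair hw hp hf (m := ⟨m, by omega⟩) h1]
  simp only [Jcond_zero, mul_one, phi0]

lemma limitMoment_two (hw : RiemannIntegrableUnit w) : limitMoment w 2 = phi0 w := by
  have h := card_ncPairings 2
  rw [limitMoment, Finset.sum_congr rfl fun π hπ => J_two hw (mem_ncPairings.1 hπ),
    Finset.sum_const, h]
  simp [pairingCount]

/-- The path is one edge traversed twice, so fixing either end leaves the integral of `w²` over the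
other. -/
lemma Jcond_two {π : Ptn 2} (hπ : IsNonCrossingPairing π) {v : ℕ} (hv : v ∈ pathVertices π)
    (c : ℝ) : Jcond w π v c = phi w c := by
  obtain ⟨f, hf, hp⟩ := hπ.exists_partner
  have hf0 : f 0 = 1 := by
    have := hf.lt_apply (by omega); omega
  have hV : pathVertices π = {0, 1} := by
    rw [hp.pathVertices_eq hf]
    have := hf.two_mul_openCount
    rw [show openCount f 2 = 1 by omega]
    rfl
  have ht1 : canonicalPath π 1 = 1 := by
    rw [hp.canonicalPath_opening hf (l := 0) (by omega) (by omega)]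
    simp [openCount]
  obtain ⟨u, hu, huv⟩ : ∃ u, (pathVertices π).erase v = {u} ∧ (v = 0 ∧ u = 1 ∨ v = 1 ∧ u = 0) := by
    rw [hV] at hv ⊢
    rcases Finset.mem_insert.1 hv with rfl | hv
    · exact ⟨1, by decide, by simp⟩
    · rw [Finset.mem_singleton] at hv
      subst hv
      exact ⟨0, by decide, by simp⟩
  have huE : u ∈ (pathVertices π).erase v := by rw [hu]; simp
  have huniq : ∀ x ∈ (pathVertices π).erase v, x = u := fun x hx => by
    rwa [hu, Finset.mem_singleton] at hx
  let _ : Unique ((pathVertices π).erase v) :=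
    ⟨⟨⟨u, huE⟩⟩, fun x => Subtype.ext (huniq x x.2)⟩
  have hdef : ((default : (pathVertices π).erase v) : ℕ) = u := rfl
  have hmp : MeasurePreserving (MeasurableEquiv.funUnique ((pathVertices π).erase v) ℝ)
      (Measure.pi fun _ => unitVol) unitVol := by
    convert measurePreserving_funUnique unitVol ((pathVertices π).erase v)
  rw [Jcond_eq_integral, phi_eq_integral, ← hmp.integral_comp']
  refine integral_congr_ae (Eventually.of_forall fun y => ?_)
  have hyu : extendBy y c u = y default := extendBy_of_mem huE
  have hyv : extendBy y c v = c := by rw [extendBy, dif_neg (Finset.notMem_erase _ _)]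
  have hmul : pathWeight w π (extendBy y c) =
      w |extendBy y c 0 - extendBy y c 1| * w |extendBy y c 1 - extendBy y c 0| := by
    rw [pathWeight, Finset.prod_range_succ, Finset.prod_range_one, canonicalPath_zero]
    norm_num
    rw [ht1]
  simp only [hmul, MeasurableEquiv.funUnique_apply]
  rw [abs_sub_comm (extendBy y c 1), ← sq]
  rcases huv with ⟨rfl, rfl⟩ | ⟨rfl, rfl⟩
  · rw [hyu, hyv]
  · rw [hyu, hyv, abs_sub_comm]

/-- Removing a neighbouring pair gives one factor `φ`; the remaining edge gives a second one at the
same vertex, whichever of its ends that is. -/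
lemma J_four (hw : RiemannIntegrableUnit w) {π : Ptn 4} (hπ : IsNonCrossingPairing π) :
    J w π = ∫ x in (0 : ℝ)..1, phi w x ^ 2 := by
  obtain ⟨f, hf, hp⟩ := hπ.exists_partner
  obtain ⟨m, hm, h1⟩ := hf.exists_neighbours (k := 2)
  have h2 : f ((⟨m, by omega⟩ : Fin 3) : ℕ) = ((⟨m, by omega⟩ : Fin 3) : ℕ) + 1 := h1
  have hp' := hp.removePair hf h2
  have hf' := hf.removeInv hm h1
  have hπ' : IsNonCrossingPairing (removePair π ⟨m, by omega⟩) := by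
    obtain ⟨σ, hσ, hσ'⟩ := hf'.exists_ptn
    rwa [hp'.ptn_eq hσ']
  rw [J_eq_integral_removePair hw hp hf h2]
  have hv : canonicalPath π m ∈ pathVertices (removePair π ⟨m, by omega⟩) := by
    have h3 := canonicalPath_removePair_of_le hp hf h2 le_rfl
    rw [← show canonicalPath (removePair π ⟨m, by omega⟩) m = canonicalPath π m from h3]
    exact hp'.canonicalPath_mem hf' hm
  simp only [Jcond_two hπ' hv, sq]

lemma limitMoment_four (hw : RiemannIntegrableUnit w) :
    limitMoment w 4 = 2 * ∫ x in (0 : ℝ)..1, phi w x ^ 2 := by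
  have h := card_ncPairings 4
  rw [limitMoment, Finset.sum_congr rfl fun π hπ => J_four hw (mem_ncPairings.1 hπ),
    Finset.sum_const, h]
  rw [pairingCount, if_pos (by decide), show 4 / 2 = 2 by rfl, catalan_two, nsmul_eq_mul]
  norm_num

/-- In the recursion the constant `φ` comes out of the integral, and integrating `Jcond` over the
fixed variable restores `J` of the reduced pairing. -/
lemma J_of_phi_const (hw : RiemannIntegrableUnit w)
    (h : ∀ x ∈ Set.Icc (0 : ℝ) 1, phi w x = phi0 w) :
    ∀ (j : ℕ) (π : Ptn (2 * j)), IsNonCrossingPairing π → J w π = phi0 w ^ j := by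
  intro j
  induction j with
  | zero => intro π _; rw [pow_zero]; exact J_zero π
  | succ j ih =>
    intro π hπ
    change Ptn (2 * j + 2) at π
    obtain ⟨f, hf, hp⟩ := hπ.exists_partner
    obtain ⟨m, hm, h1⟩ := hf.exists_neighbours (k := 2 * j)
    have h2 : f ((⟨m, by omega⟩ : Fin (2 * j + 1)) : ℕ) =
      ((⟨m, by omega⟩ : Fin (2 * j + 1)) : ℕ) + 1 := h1
    have hp' := hp.removePair hf h2
    have hf' := hf.removeInv hm h1
    have hπ' : IsNonCrossingPairing (removePair π ⟨m, by omega⟩) := by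
      obtain ⟨σ, hσ, hσ'⟩ := hf'.exists_ptn
      rwa [hp'.ptn_eq hσ']
    have hv : canonicalPath π m ∈ pathVertices (removePair π ⟨m, by omega⟩) := by
      have h3 := canonicalPath_removePair_of_le hp hf h2 le_rfl
      rw [← show canonicalPath (removePair π ⟨m, by omega⟩) m = canonicalPath π m from h3]
      exact hp'.canonicalPath_mem hf' hm
    have e1 : Set.EqOn (fun x => phi w x * Jcond w (removePair π ⟨m, by omega⟩)
        (canonicalPath π m) x) (fun x => phi0 w * Jcond w (removePair π ⟨m, by omega⟩)
        (canonicalPath π m) x) (Set.uIcc 0 1) := by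
      rw [Set.uIcc_of_le zero_le_one]
      intro x hx
      simp only [h x hx]
    rw [show J w π = _ from J_eq_integral_removePair hw hp hf h2]
    rw [intervalIntegral.integral_congr e1, intervalIntegral.integral_const_mul, pow_succ',
      ← ih _ hπ']
    congr 1
    rw [J_eq_integral, integral_insertVar_snd (optionEraseEquiv hv)
      (hp'.integrable_pathWeight hf' hw), intervalIntegral_eq_unitVol]
    refine integral_congr_ae (Eventually.of_forall fun x => ?_)
    simp only
    rw [Jcond_eq_integral]
    refine integral_congr_ae (Eventually.of_forall fun y => ?_)
    simp only
    rw [pathWeight, pathWeight]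
    refine Finset.prod_congr rfl fun i hi => ?_
    have hi' := Finset.mem_range.1 hi
    rw [hp'.canonicalPath_mod hf' hi',
      extendBy_insertVar_erase hv y x (hp'.canonicalPath_mem hf' hi'.le),
      extendBy_insertVar_erase hv y x (hp'.canonicalPath_mem hf' hi')]

lemma limitMoment_of_phi_const (hw : RiemannIntegrableUnit w)
    (h : ∀ x ∈ Set.Icc (0 : ℝ) 1, phi w x = phi0 w) (k : ℕ) :
    limitMoment w k = phi0 w ^ (k / 2) * semicircleMoment k := by
  by_cases hk : Even k
  · obtain ⟨j, rfl⟩ := hk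
    rw [← two_mul]
    have hc := card_ncPairings (2 * j)
    rw [limitMoment, Finset.sum_congr rfl fun π hπ => J_of_phi_const hw h j π (mem_ncPairings.1 hπ),
      Finset.sum_const, hc, pairingCount, semicircleMoment, if_pos (even_two_mul j),
      if_pos (even_two_mul j), Nat.mul_div_cancel_left _ two_pos, nsmul_eq_mul, mul_comm]
  · rw [limitMoment_of_not_even hk, semicircleMoment, if_neg hk, mul_zero]

/-- There are at most `4 ^ k` pairings, each contributing at most `M ^ (2k)`. This growth rate
yields compact support in `[-2M, 2M]` and determinacy. -/
lemma limitMoment_le {M : ℝ} (hM : ∀ x ∈ Set.Icc (0 : ℝ) 1, |w x| ≤ M) (k : ℕ) :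
    limitMoment w (2 * k) ≤ 1 * (2 * M) ^ (2 * k) := by
  have hM0 : 0 ≤ M := (abs_nonneg _).trans (hM 0 (by simp))
  have h1 : limitMoment w (2 * k) ≤ (ncPairings (2 * k)).card • M ^ (2 * k) :=
    Finset.sum_le_card_nsmul _ _ _ fun π _ => (le_abs_self _).trans (abs_J_le hM π)
  rw [card_ncPairings, pairingCount, if_pos (even_two_mul k), Nat.mul_div_cancel_left _ two_pos,
    nsmul_eq_mul] at h1
  refine h1.trans ?_
  rw [one_mul, mul_pow, pow_mul 2]
  refine mul_le_mul_of_nonneg_right ?_ (by positivity)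
  norm_num
  exact_mod_cast catalan_le k

end Moments

/-! ### Counting labelled circuits -/

section Counting

variable {ι τ κ : Type*} [Fintype ι] [DecidableEq ι] [DecidableEq κ] {n B : ℕ}
  {R : Setoid (Fin n × Fin n)}

/-- Labellings in which every label is free, or a function of `g f`, or determined up to `B`
choices by labels of lower rank. -/
theorem card_le_of_determined (hB1 : 1 ≤ B) (hB : ∀ p q r, countE2 R p q r ≤ B)
    (S : Finset (ι → Fin n)) (T : Finset τ) (g : (ι → Fin n) → τ) (hg : ∀ f ∈ S, g f ∈ T)
    (F : Finset ι) (r : ι → ℕ)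
    (h : ∀ v, v ∈ F ∨ (∀ f ∈ S, ∀ f' ∈ S, g f = g f' → f v = f' v) ∨
      ∃ u y z, r u < r v ∧ r y < r v ∧ r z < r v ∧ ∀ f ∈ S, R (f y, f z) (f u, f v)) :
    S.card ≤ T.card * n ^ F.card * B ^ Fintype.card ι := by
  classical
  -- By (E2) the at most `B` solutions `s` of `(p,q) ∼ (r,s)` can be numbered.
  have hcode : ∀ p q r : Fin n, ∃ c : Fin n → Fin B, Set.InjOn c {s | R (p, q) (r, s)} := by
    intro p q r
    have h1 : Fintype.card {s : Fin n | R (p, q) (r, s)} ≤ Fintype.card (Fin B) := by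
      rw [Fintype.card_fin, ← Nat.card_eq_fintype_card]
      exact hB p q r
    obtain ⟨e⟩ := Function.Embedding.nonempty_of_card_le h1
    refine ⟨fun s => if hs : s ∈ {s : Fin n | R (p, q) (r, s)} then e ⟨s, hs⟩ else ⟨0, hB1⟩, ?_⟩
    intro s hs s' hs' hss
    simp only [dif_pos hs, dif_pos hs'] at hss
    exact congrArg Subtype.val (e.injective hss)
  choose code hcode using hcode
  have h' : ∀ v, ∃ u y z, v ∈ F ∨ (∀ f ∈ S, ∀ f' ∈ S, g f = g f' → f v = f' v) ∨
      (r u < r v ∧ r y < r v ∧ r z < r v ∧ ∀ f ∈ S, R (f y, f z) (f u, f v)) := by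
    intro v
    rcases h v with h | h | ⟨u, y, z, h⟩
    · exact ⟨v, v, v, Or.inl h⟩
    · exact ⟨v, v, v, Or.inr (Or.inl h)⟩
    · exact ⟨u, y, z, Or.inr (Or.inr h)⟩
  choose u y z huyz using h'
  -- A labelling is encoded by `g f`, its free labels, and the number of each label among the
  -- solutions allowed by labels of lower rank; it is decoded by induction on the rank.
  let Φ : (ι → Fin n) → τ × (F → Fin n) × (ι → Fin B) := fun f =>
    (g f, fun v => f v, fun v => code (f (y v)) (f (z v)) (f (u v)) (f v))
  have hcard : (T ×ˢ (Finset.univ : Finset ((F → Fin n) × (ι → Fin B)))).card =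
      T.card * n ^ F.card * B ^ Fintype.card ι := by
    rw [Finset.card_product, Finset.card_univ, Fintype.card_prod]
    simp [mul_assoc]
  rw [← hcard]
  refine Finset.card_le_card_of_injOn Φ (fun f hf => ?_) ?_
  · simp only [Finset.coe_product, Set.mem_prod, Finset.mem_coe, Finset.mem_univ, and_true]
    exact hg f hf
  · intro f hf f' hf' hff
    simp only [Φ, Prod.mk.injEq] at hff
    obtain ⟨h1, h2, h3⟩ := hff
    have key : ∀ m v, r v = m → f v = f' v := by
      intro m
      induction m using Nat.strong_induction_on with
      | _ m ih =>
        intro v hv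
        rcases huyz v with h | h | ⟨hu, hy, hz, h⟩
        · exact congrFun h2 ⟨v, h⟩
        · exact h f hf f' hf' h1
        · have eu := ih _ (hv ▸ hu) (u v) rfl
          have ey := ih _ (hv ▸ hy) (y v) rfl
          have ez := ih _ (hv ▸ hz) (z v) rfl
          have h4 := congrFun h3 v
          rw [eu, ey, ez] at h4
          have m1 := h f hf
          rw [eu, ey, ez] at m1
          exact hcode _ _ _ m1 (h f' hf') h4
    exact funext fun v => key _ v rfl

/-- Labellings with equivalent edges of equal colour, explored edge by edge: only the vertices
of `F₀` and one vertex for each colour outside `κ₀` are free. -/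
theorem card_le_of_exploration (hn : 0 < n) (hB1 : 1 ≤ B) (hB : ∀ p q r, countE2 R p q r ≤ B)
    (hsw : ∀ p q, R (p, q) (q, p))
    (S : Finset (ι → Fin n)) (T : Finset τ) (g : (ι → Fin n) → τ) (hg : ∀ f ∈ S, g f ∈ T)
    (nx : ι → ι) (c : ι → κ)
    (hc : ∀ f ∈ S, ∀ x y, c x = c y → R (f x, f (nx x)) (f y, f (nx y)))
    (F₀ : Finset ι) (r : ι → ℕ) (hr : Function.Injective r) (κ₀ : Finset κ)
    (h : ∀ v, v ∈ F₀ ∨ (∀ f ∈ S, ∀ f' ∈ S, g f = g f' → f v = f' v) ∨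
      ∃ x, (nx x = v ∧ r x < r v ∨ x = v ∧ r (nx x) < r v) ∧
        (c x ∈ κ₀ → ∃ y, c y = c x ∧ r y < r v ∧ r (nx y) < r v)) :
    S.card ≤ T.card * n ^ (F₀.card + (Finset.univ.image c \ κ₀).card) * B ^ Fintype.card ι := by
  classical
  have h' : ∀ v, ∃ x, v ∈ F₀ ∨ (∀ f ∈ S, ∀ f' ∈ S, g f = g f' → f v = f' v) ∨
      ((nx x = v ∧ r x < r v ∨ x = v ∧ r (nx x) < r v) ∧
        (c x ∈ κ₀ → ∃ y, c y = c x ∧ r y < r v ∧ r (nx y) < r v)) := by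
    intro v
    rcases h v with h | h | ⟨x, h⟩
    · exact ⟨v, Or.inl h⟩
    · exact ⟨v, Or.inr (Or.inl h)⟩
    · exact ⟨x, Or.inr (Or.inr h)⟩
  choose e he using h'
  -- Vertices discovered along an edge of a colour not seen on an edge of lower rank. Of two such
  -- vertices with the same colour, the later one would already have seen it, so each colour yields
  -- at most one of them, and colours in `κ₀` yield none.
  let F₁ : Finset ι := Finset.univ.filter fun v =>
    ((nx (e v) = v ∧ r (e v) < r v ∨ e v = v ∧ r (nx (e v)) < r v) ∧
        (c (e v) ∈ κ₀ → ∃ y, c y = c (e v) ∧ r y < r v ∧ r (nx y) < r v)) ∧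
    ¬ ∃ y, c y = c (e v) ∧ r y < r v ∧ r (nx y) < r v
  have hends : ∀ v ∈ F₁, r (e v) ≤ r v ∧ r (nx (e v)) ≤ r v := by
    intro v hv
    rcases (Finset.mem_filter.1 hv).2.1.1 with ⟨h1, h2⟩ | ⟨h1, h2⟩
    · exact ⟨h2.le, by rw [h1]⟩
    · exact ⟨by rw [h1], h2.le⟩
  have hF₁ : F₁.card ≤ (Finset.univ.image c \ κ₀).card := by
    refine Finset.card_le_card_of_injOn (fun v => c (e v)) (fun v hv => ?_) ?_
    · have := (Finset.mem_filter.1 hv).2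
      simp only [Finset.coe_sdiff, Set.mem_sdiff, Finset.mem_coe]
      exact ⟨Finset.mem_image_of_mem _ (Finset.mem_univ _), fun h => this.2 (this.1.2 h)⟩
    · intro v hv v' hv' hvv
      rcases lt_trichotomy (r v) (r v') with hlt | heq | hlt
      · exact ((Finset.mem_filter.1 hv').2.2 ⟨e v, hvv, (hends v hv).1.trans_lt hlt,
          (hends v hv).2.trans_lt hlt⟩).elim
      · exact hr heq
      · exact ((Finset.mem_filter.1 hv).2.2 ⟨e v', hvv.symm, (hends v' hv').1.trans_lt hlt,
          (hends v' hv').2.trans_lt hlt⟩).elim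
  refine (card_le_of_determined hB1 hB S T g hg (F₀ ∪ F₁) r fun v => ?_).trans ?_
  · rcases he v with h | h | h
    · exact Or.inl (Finset.mem_union_left _ h)
    · exact Or.inr (Or.inl h)
    · by_cases hy : ∃ y, c y = c (e v) ∧ r y < r v ∧ r (nx y) < r v
      · obtain ⟨y, hy1, hy2, hy3⟩ := hy
        refine Or.inr (Or.inr ?_)
        rcases h.1 with ⟨h1, h2⟩ | ⟨h1, h2⟩
        · refine ⟨e v, y, nx y, h2, hy2, hy3, fun f hf => ?_⟩
          have := hc f hf y (e v) hy1
          rwa [h1] at this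
        · refine ⟨nx (e v), y, nx y, h2, hy2, hy3, fun f hf => ?_⟩
          have := R.trans (hc f hf y (e v) hy1) (hsw _ _)
          rwa [show f (e v) = f v by rw [h1]] at this
      · exact Or.inl (Finset.mem_union_right _ (Finset.mem_filter.2 ⟨Finset.mem_univ _, h, hy⟩))
  · gcongr
    exact (Finset.card_union_le _ _).trans (by omega)

/-- The set of edges equivalent to the edge `x`. -/
def edgeClass (R : Setoid (Fin n × Fin n)) (nx : ι → ι) (f : ι → Fin n) (x : ι) : Finset ι :=
  open Classical in Finset.univ.filter fun y => R (f x, f (nx x)) (f y, f (nx y))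

theorem mem_edgeClass {nx : ι → ι} {f : ι → Fin n} {x y : ι} :
    y ∈ edgeClass R nx f x ↔ R (f x, f (nx x)) (f y, f (nx y)) := by
  simp [edgeClass]

theorem edgeClass_eq_iff {nx : ι → ι} {f : ι → Fin n} {x y : ι} :
    edgeClass R nx f x = edgeClass R nx f y ↔ R (f x, f (nx x)) (f y, f (nx y)) := by
  constructor
  · intro h
    have : y ∈ edgeClass R nx f y := mem_edgeClass.2 (R.refl _)
    rw [← h] at this
    exact mem_edgeClass.1 this
  · intro h
    ext z
    rw [mem_edgeClass, mem_edgeClass]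
    exact ⟨fun h' => R.trans (R.symm h) h', fun h' => R.trans h h'⟩

/-- The classes of an equivalence relation on a finite type, as a function. -/
def IsClassMap (c : ι → Finset ι) : Prop := ∀ x y, y ∈ c x ↔ c x = c y

theorem isClassMap_edgeClass (nx : ι → ι) (f : ι → Fin n) : IsClassMap (edgeClass R nx f) :=
  fun _ _ => mem_edgeClass.trans edgeClass_eq_iff.symm

theorem IsClassMap.self_mem {c : ι → Finset ι} (hc : IsClassMap c) (x : ι) : x ∈ c x :=
  (hc x x).2 rfl

/-- Sums over edges are regrouped by class, so that inequalities between counts of edges and classes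
can be checked one class at a time. -/
theorem IsClassMap.sum_eq {c : ι → Finset ι} (hc : IsClassMap c) (φ : ℕ → ℕ) :
    ∑ x, φ (c x).card = ∑ A ∈ Finset.univ.image c, A.card * φ A.card := by
  rw [← Finset.sum_fiberwise_of_maps_to (s := Finset.univ) (t := Finset.univ.image c) (g := c)
    (fun x _ => Finset.mem_image_of_mem _ (Finset.mem_univ _))]
  refine Finset.sum_congr rfl fun A hA => ?_
  obtain ⟨x, -, rfl⟩ := Finset.mem_image.1 hA
  have h1 : (Finset.univ.filter fun y => c y = c x) = c x := by
    ext y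
    simp only [Finset.mem_filter, Finset.mem_univ, true_and]
    rw [hc x y]
    exact eq_comm
  rw [h1, Finset.sum_congr rfl (g := fun _ => φ (c x).card), Finset.sum_const, smul_eq_mul]
  intro y hy
  rw [(hc x y).1 hy]

theorem IsClassMap.two_mul_card_image {c : ι → Finset ι} (hc : IsClassMap c)
    (h2 : ∀ x, (c x).card = 2) : 2 * (Finset.univ.image c).card = Fintype.card ι := by
  have h := hc.sum_eq fun _ => 1
  simp only [mul_one, Finset.sum_const, Finset.card_univ, smul_eq_mul] at h
  rw [h, mul_comm, ← smul_eq_mul, ← Finset.sum_const]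
  refine Finset.sum_congr rfl fun A hA => ?_
  obtain ⟨x, -, rfl⟩ := Finset.mem_image.1 hA
  exact (h2 x).symm

/-- For a class of size `m` the claim is `6 + m·[m ≥ 3] ≤ 3m + 3·[m = 1]`. Pairs and singletons give
equality, and every element of a larger class is counted as a gain. -/
theorem IsClassMap.six_mul_card_image_add_le {c : ι → Finset ι} (hc : IsClassMap c) :
    6 * (Finset.univ.image c).card + (Finset.univ.filter fun x => 3 ≤ (c x).card).card ≤
      3 * Fintype.card ι + 3 * (Finset.univ.filter fun x => (c x).card = 1).card := by
  rw [Finset.card_filter, Finset.card_filter, hc.sum_eq fun m => if 3 ≤ m then 1 else 0,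
    hc.sum_eq fun m => if m = 1 then 1 else 0, ← Finset.card_univ, Finset.card_eq_sum_ones,
    Finset.card_eq_sum_ones, hc.sum_eq fun _ => 1, Finset.mul_sum, Finset.mul_sum, Finset.mul_sum,
    ← Finset.sum_add_distrib, ← Finset.sum_add_distrib]
  refine Finset.sum_le_sum fun A hA => ?_
  obtain ⟨x, -, rfl⟩ := Finset.mem_image.1 hA
  have h1 : 1 ≤ (c x).card := Finset.card_pos.2 ⟨x, hc.self_mem x⟩
  rcases (by omega : (c x).card = 1 ∨ (c x).card = 2 ∨ 3 ≤ (c x).card) with h | h | h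
  · simp [h]
  · simp [h]
  · rw [if_pos h, if_neg (by omega)]
    omega

end Counting

/-- The successor of a vertex in a family of circuits of length `k + 1`. -/
def circNext {N k : ℕ} (x : Fin N × Fin (k + 1)) : Fin N × Fin (k + 1) := (x.1, x.2 + 1)

/-- Exploration rank in a family of circuits: circuit `j` is visited at time `o j`, starting
from `s j`. -/
def circRank {N k : ℕ} (o : Fin N → ℕ) (s : Fin N → Fin (k + 1)) (x : Fin N × Fin (k + 1)) : ℕ :=
  o x.1 * (k + 1) + ((x.2 - s x.1 : Fin (k + 1)) : ℕ)

/-! ### The order in which a family of circuits is explored -/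

section CircRank

variable {N k : ℕ} {o : Fin N → ℕ} {s : Fin N → Fin (k + 1)}

theorem circRank_lt (x y : Fin N × Fin (k + 1)) (h : o x.1 < o y.1) :
    circRank o s x < circRank o s y := by
  have h1 := (x.2 - s x.1).isLt
  have h2 : (o x.1 + 1) * (k + 1) ≤ o y.1 * (k + 1) := Nat.mul_le_mul_right _ h
  unfold circRank
  rw [add_mul] at h2
  omega

theorem circRank_injective (ho : Function.Injective o) :
    Function.Injective (circRank o s) := by
  intro x y h
  rcases lt_trichotomy (o x.1) (o y.1) with h1 | h1 | h1
  · exact absurd h (circRank_lt x y h1).ne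
  · have h2 := ho h1
    have h3 : ((x.2 - s x.1 : Fin (k + 1)) : ℕ) = ((y.2 - s y.1 : Fin (k + 1)) : ℕ) := by
      unfold circRank at h
      rw [h1] at h
      omega
    have h4 := Fin.ext h3
    rw [h2] at h4
    exact Prod.ext h2 (sub_left_injective h4)
  · exact absurd h (circRank_lt y x h1).ne'

theorem circRank_start_le (j : Fin N) (i : Fin (k + 1)) :
    circRank o s (j, s j) ≤ circRank o s (j, i) := by
  simp [circRank]

theorem circRank_next (x : Fin N × Fin (k + 1)) (h : x.2 + 1 ≠ s x.1) :
    circRank o s (circNext x) = circRank o s x + 1 := by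
  have h1 : x.2 - s x.1 ≠ Fin.last k := by
    intro h'
    apply h
    have : x.2 - s x.1 + 1 = 0 := by rw [h', Fin.last_add_one]
    rw [← sub_eq_zero, ← this, sub_add_eq_add_sub]
  have h2 : x.2 + 1 - s x.1 = (x.2 - s x.1) + 1 := (sub_add_eq_add_sub _ _ _).symm
  unfold circRank circNext
  simp only
  rw [h2, Fin.val_add_one_of_lt (Fin.lt_last_iff_ne_last.2 h1), add_assoc]

theorem circRank_next_le (x : Fin N × Fin (k + 1)) :
    circRank o s (circNext x) ≤ circRank o s x + 1 := by
  by_cases h : x.2 + 1 = s x.1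
  · have h1 : circNext x = (x.1, s x.1) := Prod.ext rfl h
    rw [h1]
    exact (circRank_start_le x.1 x.2).trans (Nat.le_succ _)
  · rw [circRank_next x h]

end CircRank

/-! ### Families of circuits none of which is paired within itself -/

section Families

variable {n B N k : ℕ} {R : Setoid (Fin n × Fin n)}

/-- Every circuit has a marked edge that is not in a pair class of its own circuit; the circuits
are explored in the order `o`, each from the vertex after the marked edge. -/
theorem card_le_of_marked (hn : 0 < n) (hB1 : 1 ≤ B) (hB : ∀ p q r, countE2 R p q r ≤ B)
    (hsw : ∀ p q, R (p, q) (q, p)) (c : Fin N × Fin (k + 1) → Finset (Fin N × Fin (k + 1)))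
    (S : Finset (Fin N × Fin (k + 1) → Fin n))
    (hS : ∀ f ∈ S, edgeClass R circNext f = c)
    (x : Fin N → Fin (k + 1)) (o : Fin N → ℕ) (ho : Function.Injective o) (A : Finset (Fin N))
    (hA : ∀ j ∈ A, ∀ y ∈ c (j, x j), y ≠ (j, x j) → o j < o y.1) :
    S.card ≤ n ^ (N + ((Finset.univ.image c).card - A.card)) * B ^ (N * (k + 1)) := by
  rcases S.eq_empty_or_nonempty with rfl | ⟨f₀, hf₀⟩
  · simp
  have hcm : IsClassMap c := by
    rw [← hS f₀ hf₀]; exact isClassMap_edgeClass _ _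
  -- Starting just after the marked edge makes it the closing edge of its circuit, so it is never
  -- used to discover a vertex.
  set s : Fin N → Fin (k + 1) := fun j => x j + 1 with hs
  have hinj : Set.InjOn (fun j => c (j, x j)) A := by
    intro j hj j' hj' h
    by_contra hne
    have h1 : (j', x j') ∈ c (j, x j) := (hcm _ _).2 h
    have h2 : (j, x j) ∈ c (j', x j') := (hcm _ _).2 h.symm
    have h3 := hA j hj _ h1 (fun h => hne (congrArg Prod.fst h).symm)
    have h4 := hA j' hj' _ h2 (fun h => hne (congrArg Prod.fst h))
    exact lt_asymm h3 h4
  have key := card_le_of_exploration (τ := Unit) hn hB1 hB hsw S {()} (fun _ => ())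
    (fun _ _ => by simp) circNext c
    (fun f hf y z hyz => by rw [← hS f hf] at hyz; exact edgeClass_eq_iff.1 hyz)
    (Finset.univ.image fun j => (j, s j)) (circRank o s) (circRank_injective ho)
    (A.image fun j => c (j, x j)) ?_
  · refine key.trans (le_of_eq ?_)
    rw [Finset.card_singleton, one_mul, Fintype.card_prod, Fintype.card_fin, Fintype.card_fin,
      Finset.card_image_of_injective _ (fun a b h => congrArg Prod.fst h), Finset.card_univ,
      Fintype.card_fin, Finset.card_sdiff_of_subset, Finset.card_image_of_injOn hinj]
    exact fun B hB => by
      obtain ⟨j, -, rfl⟩ := Finset.mem_image.1 hB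
      exact Finset.mem_image_of_mem _ (Finset.mem_univ _)
  · rintro ⟨j, i⟩
    by_cases hi : i = s j
    · left
      exact Finset.mem_image.2 ⟨j, Finset.mem_univ _, by rw [hi]⟩
    · right; right
      have hnx : circNext (j, i - 1) = (j, i) := by simp [circNext]
      have hrk : circRank o s (j, i) = circRank o s (j, i - 1) + 1 := by
        rw [← hnx]
        exact circRank_next _ (by simpa using hi)
      refine ⟨(j, i - 1), Or.inl ⟨hnx, by omega⟩, fun hm => ?_⟩
      obtain ⟨l, hl, hlc⟩ := Finset.mem_image.1 hm
      -- A discovering edge with the colour of a marked edge is not that edge itself. For marks in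
      -- `A` it therefore lies in a later circuit, when all vertices of circuit `l` are already
      -- known.
      have hne : (j, i - 1) ≠ (l, x l) := by
        intro h
        apply hi
        rw [Prod.mk.injEq] at h
        obtain ⟨rfl, h⟩ := h
        rw [hs]
        simp only [← h, sub_add_cancel]
      have hlt := circRank_lt (s := s) (l, x l) (j, i - 1) (hA l hl _ ((hcm _ _).2 hlc) hne)
      refine ⟨(l, x l), hlc, by omega, ?_⟩
      have : circRank o s (circNext (l, x l)) ≤ circRank o s (l, x l) :=
        circRank_start_le (s := s) l (x l)
      omega

/-- Mark in each circuit an edge whose class does not meet the circuit in exactly two edges. A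
circuit is good for the forward order (`A₁`), good for the reverse order (`A₂`), or its marked class
has at least three elements (`A₃`). Otherwise the class has a second element in this or an earlier
circuit and one in this or a later circuit; being of size two, it would be a pair inside the
circuit. The better of the two orders is used. -/
theorem card_le_of_not_paired (hn : 0 < n) (hB1 : 1 ≤ B) (hB : ∀ p q r, countE2 R p q r ≤ B)
    (hsw : ∀ p q, R (p, q) (q, p)) (c : Fin N × Fin (k + 1) → Finset (Fin N × Fin (k + 1)))
    (S : Finset (Fin N × Fin (k + 1) → Fin n))
    (hS : ∀ f ∈ S, edgeClass R circNext f = c)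
    (hc : ∀ j, ∃ i, ((c (j, i)).filter fun y => y.1 = j).card ≠ 2) :
    ∃ m, S.card ≤ n ^ m * B ^ (N * (k + 1)) ∧
      6 * m + N ≤ 6 * N + 3 * (N * (k + 1)) +
        3 * (Finset.univ.filter fun x => (c x).card = 1).card := by
  rcases S.eq_empty_or_nonempty with rfl | ⟨f₀, hf₀⟩
  · exact ⟨0, by simp, by omega⟩
  have hcm : IsClassMap c := by
    rw [← hS f₀ hf₀]; exact isClassMap_edgeClass _ _
  choose x hx using hc
  set A₁ : Finset (Fin N) := Finset.univ.filter fun j =>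
    ∀ y ∈ c (j, x j), y ≠ (j, x j) → (j : ℕ) < y.1
  set A₂ : Finset (Fin N) := Finset.univ.filter fun j =>
    ∀ y ∈ c (j, x j), y ≠ (j, x j) → N - (j : ℕ) < N - y.1
  set A₃ : Finset (Fin N) := Finset.univ.filter fun j => 3 ≤ (c (j, x j)).card
  have h1 := card_le_of_marked hn hB1 hB hsw c S hS x (fun j => j) Fin.val_injective A₁
    (fun j hj => (Finset.mem_filter.1 hj).2)
  have h2 := card_le_of_marked hn hB1 hB hsw c S hS x (fun j => N - j)
    (fun a b h => Fin.ext (by have := a.isLt; have := b.isLt; simp only at h; omega)) A₂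
    (fun j hj => (Finset.mem_filter.1 hj).2)
  have hcover : (Finset.univ : Finset (Fin N)) ⊆ A₁ ∪ A₂ ∪ A₃ := by
    intro j _
    by_contra hj
    simp only [Finset.mem_union, not_or, A₁, A₂, A₃, Finset.mem_filter, Finset.mem_univ,
      true_and, not_forall] at hj
    obtain ⟨⟨⟨y, hy, hyne, hylt⟩, ⟨y', hy', hyne', hylt'⟩⟩, h3⟩ := hj
    have hyy : y = y' := by
      by_contra hne
      apply h3
      have hsub : ({(j, x j), y, y'} : Finset (Fin N × Fin (k + 1))) ⊆ c (j, x j) := by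
        intro z hz
        simp only [Finset.mem_insert, Finset.mem_singleton] at hz
        rcases hz with rfl | rfl | rfl
        · exact hcm.self_mem _
        · exact hy
        · exact hy'
      have := Finset.card_le_card hsub
      rwa [Finset.card_eq_three.2 ⟨_, _, _, hyne.symm, hyne'.symm, hne, rfl⟩] at this
    subst hyy
    have hyj : y.1 = j := by
      have := y.1.isLt
      have := j.isLt
      exact Fin.ext (by omega)
    apply hx j
    have hle : ((c (j, x j)).filter fun y => y.1 = j).card ≤ (c (j, x j)).card :=
      Finset.card_le_card (Finset.filter_subset _ _)
    have hge : ({(j, x j), y} : Finset (Fin N × Fin (k + 1))) ⊆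
        (c (j, x j)).filter fun y => y.1 = j := by
      intro z hz
      simp only [Finset.mem_insert, Finset.mem_singleton] at hz
      rcases hz with rfl | rfl
      · exact Finset.mem_filter.2 ⟨hcm.self_mem _, rfl⟩
      · exact Finset.mem_filter.2 ⟨hy, hyj⟩
    have := Finset.card_le_card hge
    rw [Finset.card_pair hyne.symm] at this
    omega
  have hcov : N ≤ A₁.card + A₂.card + A₃.card := by
    have h4 := Finset.card_le_card hcover
    rw [Finset.card_univ, Fintype.card_fin] at h4
    have h5 := Finset.card_union_le (A₁ ∪ A₂) A₃
    have h6 := Finset.card_union_le A₁ A₂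
    omega
  have hA₃ : A₃.card ≤ (Finset.univ.filter fun y => 3 ≤ (c y).card).card := by
    refine Finset.card_le_card_of_injOn (fun j => (j, x j)) (fun j hj => ?_)
      (fun a _ b _ h => congrArg Prod.fst h)
    simpa using (Finset.mem_filter.1 hj).2
  have hA₃' : A₃.card ≤ N := by simpa using Finset.card_le_univ A₃
  have h6 := hcm.six_mul_card_image_add_le
  rw [Fintype.card_prod, Fintype.card_fin, Fintype.card_fin] at h6
  have himg : ∀ A : Finset (Fin N), ∀ o : Fin N → ℕ,
      (∀ j ∈ A, ∀ y ∈ c (j, x j), y ≠ (j, x j) → o j < o y.1) →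
      A.card ≤ (Finset.univ.image c).card := by
    intro A o hA
    refine Finset.card_le_card_of_injOn (fun j => c (j, x j))
      (fun j _ => by simp) ?_
    intro j hj j' hj' h
    by_contra hne
    have h3 := hA j hj _ ((hcm _ _).2 h) (fun h => hne (congrArg Prod.fst h).symm)
    have h4 := hA j' hj' _ ((hcm _ _).2 h.symm) (fun h => hne (congrArg Prod.fst h))
    exact lt_asymm h3 h4
  have i1 := himg A₁ (fun j => j) (fun j hj => (Finset.mem_filter.1 hj).2)
  have i2 := himg A₂ (fun j => N - j) (fun j hj => (Finset.mem_filter.1 hj).2)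
  -- The larger of `A₁`, `A₂` has at least `(N - |A₃|)/2` elements. Six times this, plus the gain
  -- `|A₃|` from the large classes, is at least `3N - 2|A₃| ≥ N`: a saving of `1/6` in the exponent
  -- per circuit.
  rcases le_total A₁.card A₂.card with h | h
  · exact ⟨_, h2, by omega⟩
  · exact ⟨_, h1, by omega⟩

end Families

/-! ### Paired circuits -/

/-- A path that backtracks along the blocks of a non-crossing pairing returns to its start after
an interval that is a union of blocks. -/
theorem NCInv.apply_eq_of_closed {K : ℕ} {f : ℕ → ℕ} (hf : NCInv 0 K f) {X : Type*} {q : ℕ → X}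
    {b : ℕ} (hb : b ≤ K) : ∀ d a : ℕ, b = a + d → (∀ i, a ≤ i → i < b → a ≤ f i ∧ f i < b) →
      (∀ i, a ≤ i → i < f i → f i < b → q (f i + 1) = q i) → q b = q a := by
  intro d
  induction d using Nat.strong_induction_on with
  | _ d ih =>
    intro a hab hcl hq
    rcases Nat.eq_zero_or_pos d with rfl | hd
    · rw [hab, add_zero]
    · have h1 := hcl a le_rfl (by omega)
      have h2 := hf.ne a (Nat.zero_le _) (by omega)
      rw [ih (b - (f a + 1)) (by omega) (f a + 1) (by omega) ?_ fun i h3 h4 h5 =>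
        hq i (by omega) h4 h5, hq a le_rfl (by omega) h1.2]
      intro i h3 h4
      have h5 := hcl i (by omega) h4
      refine ⟨?_, h5.2⟩
      have h6 := hf.invol i
      have h7 := hf.invol a
      by_contra hlt
      rcases Nat.lt_trichotomy (f i) (f a) with h | h | h
      · rcases Nat.lt_or_ge a (f i) with h8 | h8
        · have := hf.maps_inside h8 h
          omega
        · have : f i = a := by omega
          rw [this] at h6
          omega
      · have h8 := congrArg f h
        rw [h6, h7] at h8
        omega
      · omega

/-! ### Circuits whose edge classes are pairs -/

section

variable {n B k : ℕ} {R : Setoid (Fin n × Fin n)}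

/-- The classes of the edges of a single circuit. -/
abbrev circClass (R : Setoid (Fin n × Fin n)) (p : Fin (k + 1) → Fin n) :
    Fin (k + 1) → Finset (Fin (k + 1)) := edgeClass R (fun i => i + 1) p

/-- A circuit as a periodic path. -/
def circPath {X : Type*} (p : Fin (k + 1) → X) (l : ℕ) : X := p (Fin.ofNat (k + 1) l)

theorem circPath_val {X : Type*} (p : Fin (k + 1) → X) (i : Fin (k + 1)) :
    circPath p i = p i := by
  rw [circPath, Fin.ofNat_eq_cast, Fin.cast_val_eq_self]

theorem circPath_val_add_one {X : Type*} (p : Fin (k + 1) → X) (i : Fin (k + 1)) :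
    circPath p (i + 1) = p (i + 1) := by
  have : Fin.ofNat (k + 1) ((i : ℕ) + 1) = i + 1 := by
    apply Fin.ext
    simp [Fin.val_add]
  rw [circPath, this]

/-- A circuit whose edge classes form a non-crossing pairing along which it backtracks. -/
def IsTreeLike (R : Setoid (Fin n × Fin n)) (p : Fin (k + 1) → Fin n) : Prop :=
  ∃ f, NCInv 0 (k + 1) f ∧ Backtracks (k + 1) f (circPath p) ∧
    ∀ i j : Fin (k + 1), j ∈ circClass R p i ↔ j = i ∨ (j : ℕ) = f i

theorem IsTreeLike.card_eq_two {p : Fin (k + 1) → Fin n} (h : IsTreeLike R p) (i : Fin (k + 1)) :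
    (circClass R p i).card = 2 := by
  obtain ⟨f, hf, -, hc⟩ := h
  have h1 := hf.maps i (Nat.zero_le _) i.isLt
  have h2 := hf.ne i (Nat.zero_le _) i.isLt
  rw [Finset.card_eq_two]
  refine ⟨i, ⟨f i, h1.2⟩, fun h => h2 (congrArg Fin.val h).symm, ?_⟩
  ext j
  rw [hc, Finset.mem_insert, Finset.mem_singleton, Fin.ext_iff (b := ⟨f i, h1.2⟩)]

/-- A paired circuit either is tree-like, or has two crossing blocks, or has a block that is not
traversed backwards although the path is closed in between. -/
theorem isTreeLike_or {p : Fin (k + 1) → Fin n} (h2 : ∀ i, (circClass R p i).card = 2) :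
    IsTreeLike R p ∨
    (∃ a b c d : Fin (k + 1), a < b ∧ b < c ∧ c < d ∧ circClass R p a = {a, c} ∧
      circClass R p b = {b, d}) ∨
    (∃ i j : Fin (k + 1), i < j ∧ circClass R p i = {i, j} ∧ p j = p (i + 1) ∧
      p (j + 1) ≠ p i) := by
  classical
  have hcm : IsClassMap (circClass R p) := isClassMap_edgeClass _ _
  have h3 : ∀ i, ∃ j, j ≠ i ∧ circClass R p i = {i, j} := by
    intro i
    obtain ⟨x, y, hxy, he⟩ := Finset.card_eq_two.1 (h2 i)
    have hi := hcm.self_mem i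
    rw [he] at hi
    rcases (by simpa using hi : i = x ∨ i = y) with rfl | rfl
    · exact ⟨y, hxy.symm, he⟩
    · exact ⟨x, hxy, by rw [he, Finset.pair_comm]⟩
  choose t hne ht using h3
  have htt : ∀ i, t (t i) = i := by
    intro i
    have h4 : circClass R p (t i) = circClass R p i :=
      ((hcm i (t i)).1 (by rw [ht]; simp)).symm
    have h5 : i ∈ circClass R p (t i) := by rw [h4]; exact hcm.self_mem i
    rw [ht] at h5
    rcases (by simpa using h5 : i = t i ∨ i = t (t i)) with h | h
    · exact absurd h.symm (hne i)
    · exact h.symm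
  by_cases hcr : ∃ a b c d : Fin (k + 1), a < b ∧ b < c ∧ c < d ∧ circClass R p a = {a, c} ∧
      circClass R p b = {b, d}
  · exact Or.inr (Or.inl hcr)
  set f : ℕ → ℕ := fun l => if h : l < k + 1 then t ⟨l, h⟩ else l with hf
  have hfv : ∀ i : Fin (k + 1), f i = t i := fun i => dif_pos i.isLt
  have hmaps : ∀ i, i < k + 1 → f i < k + 1 := fun i hi => by
    rw [hf]; simp only [dif_pos hi]; exact (t _).isLt
  have hfi : NCInv 0 (k + 1) f := by
    refine ⟨fun i hi => ?_, fun i _ hi => ⟨Nat.zero_le _, hmaps i hi⟩, fun i _ hi => ?_,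
      fun i => ?_, fun i j hij hji hff => ?_⟩
    · rw [hf]; simp only; rw [dif_neg (by omega)]
    · rw [show f i = t ⟨i, hi⟩ from hfv ⟨i, hi⟩]
      exact fun h => hne ⟨i, hi⟩ (Fin.ext h)
    · rcases Nat.lt_or_ge i (k + 1) with hi | hi
      · rw [show f i = t ⟨i, hi⟩ from hfv ⟨i, hi⟩, hfv, htt]
      · have : f i = i := by rw [hf]; simp only; rw [dif_neg (by omega)]
        rw [this, this]
    · have hj : j < k + 1 := by
        by_contra hj
        have : f j = j := by rw [hf]; simp only; rw [dif_neg hj]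
        omega
      have hi : i < k + 1 := by omega
      have e1 : f i = t ⟨i, hi⟩ := hfv ⟨i, hi⟩
      have e2 : f j = t ⟨j, hj⟩ := hfv ⟨j, hj⟩
      exact hcr ⟨⟨i, hi⟩, ⟨j, hj⟩, t ⟨i, hi⟩, t ⟨j, hj⟩, hij, by rw [Fin.lt_def]; simp only; omega,
        by rw [Fin.lt_def]; omega, ht _, ht _⟩
  by_cases hb : Backtracks (k + 1) f (circPath p)
  · refine Or.inl ⟨f, hfi, hb, fun i j => ?_⟩
    rw [ht, Finset.mem_insert, Finset.mem_singleton, hfv, Fin.ext_iff (a := j) (b := t i)]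
  · right; right
    -- Choose a shortest block that is not traversed backwards. All blocks inside it are, so the
    -- path is closed between its two edges and only the outer endpoints can disagree.
    set P : ℕ → Prop := fun m => ∃ i < k + 1, f i = i + m ∧ 0 < m ∧
      ¬ (circPath p (f i) = circPath p (i + 1) ∧ circPath p (f i + 1) = circPath p i) with hP
    have hex : ∃ m, P m := by
      unfold Backtracks at hb
      push Not at hb
      obtain ⟨i, hi, hif, h⟩ := hb
      exact ⟨f i - i, i, hi, by omega, by omega, fun h' => h h'.1 h'.2⟩
    obtain ⟨i, hi, him, hm, hnot⟩ := Nat.find_spec hex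
    have hmin := fun m (hm : m < Nat.find hex) => Nat.find_min hex hm
    set m := Nat.find hex
    have hfi1 := hmaps i hi
    have hcl : circPath p (f i) = circPath p (i + 1) := by
      refine hfi.apply_eq_of_closed hfi1.le (f i - (i + 1)) (i + 1) (by omega) ?_ ?_
      · intro l h1 h2
        have := hfi.maps_inside (show i < l by omega) h2
        omega
      · intro l h1 h2 h3
        by_contra hc
        exact hmin (f l - l) (by omega) ⟨l, by omega, by omega, by omega, fun h => hc h.2⟩
    have hnb : circPath p (f i + 1) ≠ circPath p i := fun h => hnot ⟨hcl, h⟩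
    have e1 : f i = t ⟨i, hi⟩ := hfv ⟨i, hi⟩
    refine ⟨⟨i, hi⟩, t ⟨i, hi⟩, by rw [Fin.lt_def]; simp only; omega, ht _, ?_, ?_⟩
    · rw [← circPath_val p (t _), ← circPath_val_add_one p ⟨i, hi⟩, ← e1, hcl]
    · rw [← circPath_val p ⟨i, hi⟩, ← circPath_val_add_one p (t _), ← e1]
      exact hnb

/-- Quadruples `(p, q, r, s)` with `(p, q) ∼ (r, s)`. -/
def linkedQuadruples (R : Setoid (Fin n × Fin n)) : Finset (Fin n × Fin n × Fin n × Fin n) :=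
  open Classical in Finset.univ.filter fun x => R (x.1, x.2.1) (x.2.2.1, x.2.2.2)

theorem card_linkedQuadruples_le : (linkedQuadruples R).card ≤ n * maxE1 R := by
  classical
  rw [Finset.card_eq_sum_card_fiberwise (t := Finset.univ) (f := Prod.fst) (by simp)]
  refine (Finset.sum_le_card_nsmul _ _ (maxE1 R) fun p _ => ?_).trans (by simp)
  refine le_trans ?_ (Finset.le_sup (f := fun p => countE1 R p) (Finset.mem_univ p))
  rw [countE1, Set.ncard_eq_toFinset_card']
  refine Finset.card_le_card_of_injOn Prod.snd (fun x hx => ?_) ?_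
  · simp only [linkedQuadruples, Finset.coe_filter, Finset.mem_filter, Finset.mem_univ, true_and,
      Set.mem_ofPred_eq] at hx
    simp [← hx.2, hx.1]
  · intro x hx y hy hxy
    simp only [Finset.coe_filter, Set.mem_ofPred_eq] at hx hy
    exact Prod.ext (hx.2.trans hy.2.symm) hxy

theorem val_sub_one {v : Fin (k + 1)} (hv : v ≠ 0) : ((v - 1 : Fin (k + 1)) : ℕ) = v - 1 := by
  rw [Fin.val_sub_one_of_ne_zero hv]

/-- Free choices are the starting vertex and one vertex for each of the `(k+1)/2` classes. -/
theorem card_treeLike_le (hn : 0 < n) (hB1 : 1 ≤ B) (hB : ∀ p q r, countE2 R p q r ≤ B)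
    (hsw : ∀ p q, R (p, q) (q, p)) (c : Fin (k + 1) → Finset (Fin (k + 1)))
    (hcm : IsClassMap c)
    (h2 : ∀ i, (c i).card = 2) (S : Finset (Fin (k + 1) → Fin n))
    (hS : ∀ p ∈ S, circClass R p = c) :
    ∃ m, S.card ≤ n ^ m * B ^ (k + 1) ∧ 2 * m = k + 1 + 2 := by
  have key := card_le_of_exploration (τ := Unit) hn hB1 hB hsw S {()} (fun _ => ())
    (fun _ _ => by simp) (fun i => i + 1) c
    (fun f hf y z hyz => by rw [← hS f hf] at hyz; exact edgeClass_eq_iff.1 hyz)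
    {0} (fun i => i) Fin.val_injective ∅ ?_
  · refine ⟨1 + (Finset.univ.image c).card, key.trans (le_of_eq ?_), ?_⟩
    · simp
    · have := hcm.two_mul_card_image h2
      rw [Fintype.card_fin] at this
      omega
  · intro v
    by_cases hv : v = 0
    · exact Or.inl (by simp [hv])
    · refine Or.inr (Or.inr ⟨v - 1, Or.inl ⟨by simp, ?_⟩, by simp⟩)
      have := Fin.val_ne_zero_iff.2 hv
      rw [val_sub_one hv]
      omega

/-- The ends of the paired edges `a` and `c` form a linked quadruple, counted by (E1). Starting from
them, the circuit can be explored so that neither of the two crossing classes costs a free vertex.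
-/
theorem card_crossing_le (hn : 0 < n) (hB1 : 1 ≤ B) (hB : ∀ p q r, countE2 R p q r ≤ B)
    (hsw : ∀ p q, R (p, q) (q, p)) (cl : Fin (k + 1) → Finset (Fin (k + 1)))
    (hcm : IsClassMap cl)
    (h2 : ∀ i, (cl i).card = 2) (S : Finset (Fin (k + 1) → Fin n))
    (hS : ∀ p ∈ S, circClass R p = cl) {a b c d : Fin (k + 1)} (hab : a < b) (hbc : b < c)
    (hcd : c < d) (hac : cl a = {a, c}) (hbd : cl b = {b, d}) :
    ∃ m, S.card ≤ n * maxE1 R * n ^ m * B ^ (k + 1) ∧ 2 * m + 4 = k + 1 := by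
  have hne : cl a ≠ cl b := fun h => by
    have := (hcm a b).2 h
    rw [hac] at this
    rcases (by simpa using this : b = a ∨ b = c) with h | h <;> subst h <;> simp at *
  have hR : ∀ p ∈ S, R (p a, p (a + 1)) (p c, p (c + 1)) := by
    intro p hp
    have : c ∈ circClass R p a := by rw [hS p hp, hac]; simp
    exact mem_edgeClass.1 this
  have hnx : ∀ i : Fin (k + 1), ((i + 1 : Fin (k + 1)) : ℕ) = if (i : ℕ) = k then 0 else (i : ℕ) + 1 := by
    intro i
    rw [Fin.val_add_one]
    simp [Fin.ext_iff]
  have key := card_le_of_exploration hn hB1 hB hsw S (linkedQuadruples R)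
    (fun p => (p a, p (a + 1), p c, p (c + 1)))
    (fun p hp => by simpa [linkedQuadruples] using hR p hp) (fun i => i + 1) cl
    (fun f hf y z hyz => by rw [← hS f hf] at hyz; exact edgeClass_eq_iff.1 hyz)
    -- Order of exploration: upwards from `a + 1` to `b`, downwards from `c` to `b + 1`, upwards
    -- from `c + 1` to the end, and finally from `0` to `a`. Edge `b` is reached from both sides and
    -- discovers nothing, yet both its ends are known before its partner `d` is used.
    ∅ (fun v : Fin (k + 1) => if (v : ℕ) ≤ a then 3 * (k + 1) + v else if (v : ℕ) ≤ b then v else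
      if (v : ℕ) ≤ c then 2 * (k + 1) - v else 2 * (k + 1) + v) ?_ {cl a, cl b} ?_
  · refine ⟨(Finset.univ.image cl).card - 2, key.trans ?_, ?_⟩
    · rw [Finset.card_empty, zero_add, Finset.card_sdiff_of_subset, Finset.card_pair hne,
        Fintype.card_fin]
      · gcongr
        exact card_linkedQuadruples_le
      · intro A hA
        rcases (by simpa using hA : A = cl a ∨ A = cl b) with rfl | rfl <;> simp
    · have h3 := hcm.two_mul_card_image h2
      rw [Fintype.card_fin] at h3
      have h4 : ({cl a, cl b} : Finset (Finset (Fin (k + 1)))).card ≤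
          (Finset.univ.image cl).card := by
        refine Finset.card_le_card fun A hA => ?_
        rcases (by simpa using hA : A = cl a ∨ A = cl b) with rfl | rfl <;> simp
      rw [Finset.card_pair hne] at h4
      omega
  · intro v v' h
    have hv := v.isLt
    have hv' := v'.isLt
    simp only at h
    apply Fin.ext
    split_ifs at h <;> omega
  · intro v
    have hv := v.isLt
    have hd := d.isLt
    rw [Fin.lt_def] at hab hbc hcd
    have hna := hnx a
    have hnc := hnx c
    have hnb := hnx b
    have hnv := hnx v
    by_cases hk : v = a ∨ v = a + 1 ∨ v = c ∨ v = c + 1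
    · refine Or.inr (Or.inl fun f _ f' _ h => ?_)
      simp only [Prod.mk.injEq] at h
      rcases hk with rfl | rfl | rfl | rfl
      · exact h.1
      · exact h.2.1
      · exact h.2.2.1
      · exact h.2.2.2
    right; right
    simp only [Fin.ext_iff, not_or] at hk
    rw [hna, hnc, if_neg (by omega), if_neg (by omega)] at hk
    have hcol : ∀ x, cl x ∈ ({cl a, cl b} : Finset (Finset (Fin (k + 1)))) →
        (x : ℕ) = a ∨ (x : ℕ) = c ∨ (x : ℕ) = b ∨ (x : ℕ) = d := by
      intro x hx
      rw [Finset.mem_insert, Finset.mem_singleton] at hx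
      rcases hx with hx | hx
      · have := (hcm a x).2 hx.symm
        rw [hac] at this
        rcases (by simpa using this : x = a ∨ x = c) with rfl | rfl <;> simp
      · have := (hcm b x).2 hx.symm
        rw [hbd] at this
        rcases (by simpa using this : x = b ∨ x = d) with rfl | rfl <;> simp
    have hdb : cl d = cl b := ((hcm b d).1 (by rw [hbd]; simp)).symm
    by_cases hvb : (b : ℕ) < v ∧ (v : ℕ) < c
    · refine ⟨v, Or.inr ⟨rfl, ?_⟩, fun h => ?_⟩
      · rw [hnv]
        split_ifs <;> omega
      · have := hcol v h
        omega
    · have hx : ((v - 1 : Fin (k + 1)) : ℕ) = if (v : ℕ) = 0 then k else v - 1 := by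
        split_ifs with h0
        · rw [show v = 0 from Fin.ext h0, zero_sub, Fin.coe_neg_one]
        · exact val_sub_one fun h => h0 (by rw [h]; rfl)
      refine ⟨v - 1, Or.inl ⟨by simp, ?_⟩, fun h => ?_⟩
      · rw [hx]
        split_ifs <;> omega
      · have h3 := hcol _ h
        have h5 : ((v - 1 : Fin (k + 1)) : ℕ) = d ∧ ((v : ℕ) = 0 ∨ (v : ℕ) = d + 1) := by
          by_cases h0 : (v : ℕ) = 0
          · rw [if_pos h0] at hx
            omega
          · rw [if_neg h0] at hx
            omega
        obtain ⟨h4, h5⟩ := h5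
        refine ⟨b, by rw [show v - 1 = d from Fin.ext h4, hdb], ?_, ?_⟩
        · split_ifs <;> omega
        · rw [hnb, if_neg (show ¬ (b : ℕ) = k by omega)]
          split_ifs <;> omega

/-- Triples `(p, q, r)` with `(p, q) ∼ (q, r)` and `r ≠ p`. -/
def linkedTriples (R : Setoid (Fin n × Fin n)) : Finset (Fin n × Fin n × Fin n) :=
  open Classical in Finset.univ.filter fun x => R (x.1, x.2.1) (x.2.1, x.2.2) ∧ x.2.2 ≠ x.1

theorem card_linkedTriples : (linkedTriples R).card = countE3 R := by
  classical
  rw [countE3, Set.ncard_eq_toFinset_card']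
  congr 1
  ext x
  simp [linkedTriples]

/-- The ends of edges `i` and `j` are three vertices forming a triple counted by (E3). Both edges
then run between known vertices, so their class contributes no free vertex. -/
theorem card_not_backtracking_le (hn : 0 < n) (hB1 : 1 ≤ B) (hB : ∀ p q r, countE2 R p q r ≤ B)
    (hsw : ∀ p q, R (p, q) (q, p)) (cl : Fin (k + 1) → Finset (Fin (k + 1)))
    (hcm : IsClassMap cl)
    (h2 : ∀ i, (cl i).card = 2) (S : Finset (Fin (k + 1) → Fin n)) {i j : Fin (k + 1)}
    (hij : i < j) (hcl : cl i = {i, j})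
    (hS : ∀ p ∈ S, circClass R p = cl ∧ p j = p (i + 1) ∧ p (j + 1) ≠ p i) :
    ∃ m, S.card ≤ countE3 R * n ^ m * B ^ (k + 1) ∧ 2 * m + 2 = k + 1 := by
  have hR : ∀ p ∈ S, R (p i, p (i + 1)) (p (i + 1), p (j + 1)) := by
    intro p hp
    have : j ∈ circClass R p i := by rw [(hS p hp).1, hcl]; simp
    have := mem_edgeClass.1 this
    rwa [(hS p hp).2.1] at this
  have hnx : ∀ i : Fin (k + 1), ((i + 1 : Fin (k + 1)) : ℕ) = if (i : ℕ) = k then 0 else (i : ℕ) + 1 := by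
    intro i
    rw [Fin.val_add_one]
    simp [Fin.ext_iff]
  have key := card_le_of_exploration hn hB1 hB hsw S (linkedTriples R)
    (fun p => (p i, p (i + 1), p (j + 1)))
    (fun p hp => by simpa [linkedTriples] using ⟨hR p hp, (hS p hp).2.2⟩) (fun i => i + 1) cl
    (fun f hf y z hyz => by rw [← (hS f hf).1] at hyz; exact edgeClass_eq_iff.1 hyz)
    -- The exploration starts at `i + 1` and runs once around the circuit.
    ∅ (fun v : Fin (k + 1) => if (v : ℕ) ≤ i then k + 1 + v else v) ?_ {cl i} ?_
  · refine ⟨(Finset.univ.image cl).card - 1, key.trans ?_, ?_⟩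
    · rw [Finset.card_empty, zero_add, Finset.card_sdiff_of_subset (by simp),
        Finset.card_singleton, Fintype.card_fin, card_linkedTriples]
    · have h3 := hcm.two_mul_card_image h2
      rw [Fintype.card_fin] at h3
      omega
  · intro v v' h
    have hv := v.isLt
    have hv' := v'.isLt
    simp only at h
    apply Fin.ext
    split_ifs at h <;> omega
  · intro v
    have hv := v.isLt
    have hj := j.isLt
    rw [Fin.lt_def] at hij
    by_cases hk : v = i ∨ v = i + 1 ∨ v = j ∨ v = j + 1
    · refine Or.inr (Or.inl fun f hf f' hf' h => ?_)
      simp only [Prod.mk.injEq] at h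
      rcases hk with rfl | rfl | rfl | rfl
      · exact h.1
      · exact h.2.1
      · rw [(hS f hf).2.1, (hS f' hf').2.1]
        exact h.2.1
      · exact h.2.2
    right; right
    rw [not_or, not_or, not_or] at hk
    have hx : ((v - 1 : Fin (k + 1)) : ℕ) = if (v : ℕ) = 0 then k else v - 1 := by
      split_ifs with h0
      · rw [show v = 0 from Fin.ext h0, zero_sub, Fin.coe_neg_one]
      · exact val_sub_one fun h => h0 (by rw [h]; rfl)
    refine ⟨v - 1, Or.inl ⟨by simp, ?_⟩, fun h => ?_⟩
    · have h3 := hk.2.1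
      have h4 := hk.1
      rw [Fin.ext_iff, hnx] at h3
      rw [Fin.ext_iff] at h4
      rw [hx]
      split_ifs at h3 ⊢ <;> omega
    · exfalso
      rw [Finset.mem_singleton] at h
      have := (hcm i _).2 h.symm
      rw [hcl] at this
      rcases (by simpa using this : v - 1 = i ∨ v - 1 = j) with h | h
      · exact hk.2.1 (by rw [← h, sub_add_cancel])
      · exact hk.2.2.2 (by rw [← h, sub_add_cancel])

/-- Pairs of paired circuits with a common edge class. -/
theorem card_linked_pairs_le (hn : 0 < n) (hB1 : 1 ≤ B) (hB : ∀ p q r, countE2 R p q r ≤ B)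
    (hsw : ∀ p q, R (p, q) (q, p)) (cl : Fin 2 → Fin (k + 1) → Finset (Fin (k + 1)))
    (hcm : ∀ b, IsClassMap (cl b)) (h2 : ∀ b i, (cl b i).card = 2) (x : Fin 2 → Fin (k + 1))
    (S : Finset (Fin 2 × Fin (k + 1) → Fin n))
    (hS : ∀ f ∈ S, (∀ b, circClass R (fun i => f (b, i)) = cl b) ∧
      R (f (0, x 0), f (0, x 0 + 1)) (f (1, x 1), f (1, x 1 + 1))) :
    ∃ m, S.card ≤ n * maxE1 R * n ^ m * B ^ (2 * (k + 1)) ∧ m + 2 = k + 1 := by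
  -- Colours are the classes within each circuit separately, `k + 1` in total; the equivalence
  -- across the circuits enters only through the linked quadruple, which makes the colours of the
  -- two linked edges free of cost.
  set c : Fin 2 × Fin (k + 1) → Finset (Fin 2 × Fin (k + 1)) := fun y =>
    (cl y.1 y.2).image fun i => (y.1, i) with hc
  have hmem : ∀ y z, z ∈ c y ↔ y.1 = z.1 ∧ z.2 ∈ cl y.1 y.2 := by
    rintro ⟨b, i⟩ ⟨b', i'⟩
    simp only [hc, Finset.mem_image, Prod.mk.injEq]
    constructor
    · rintro ⟨l, hl, rfl, rfl⟩
      exact ⟨rfl, hl⟩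
    · rintro ⟨rfl, h⟩
      exact ⟨i', h, rfl, rfl⟩
  have hcm' : IsClassMap c := by
    intro y z
    constructor
    · intro h
      obtain ⟨h1, h3⟩ := (hmem y z).1 h
      have h4 := (hcm y.1 _ _).1 h3
      simp only [hc]
      rw [h4, h1]
    · intro h
      rw [h, hmem]
      exact ⟨rfl, (hcm z.1).self_mem _⟩
  have hcard : ∀ y, (c y).card = 2 := by
    intro y
    rw [hc, Finset.card_image_of_injective _ (Prod.mk_right_injective _), h2]
  have himg := hcm'.two_mul_card_image hcard
  rw [Fintype.card_prod, Fintype.card_fin, Fintype.card_fin] at himg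
  have hne : c (0, x 0) ≠ c (1, x 1) := fun h => by
    have := ((hmem (0, x 0) (1, x 1)).1 ((hcm' _ _).2 h)).1
    simp at this
  have hsub : ({c (0, x 0), c (1, x 1)} : Finset (Finset (Fin 2 × Fin (k + 1)))) ⊆
      Finset.univ.image c := by
    intro A hA
    rcases (by simpa using hA : A = c (0, x 0) ∨ A = c (1, x 1)) with rfl | rfl <;>
      exact Finset.mem_image_of_mem _ (Finset.mem_univ _)
  have hcol : ∀ y, c y ∈ ({c (0, x 0), c (1, x 1)} : Finset (Finset (Fin 2 × Fin (k + 1)))) →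
      c (y.1, x y.1) = c y := by
    intro y hy
    rw [Finset.mem_insert, Finset.mem_singleton] at hy
    rcases hy with hy | hy
    · have := ((hmem y (0, x 0)).1 ((hcm' _ _).2 hy)).1
      rw [hy, this]
    · have := ((hmem y (1, x 1)).1 ((hcm' _ _).2 hy)).1
      rw [hy, this]
  have hinj : Function.Injective (circRank (fun b : Fin 2 => (b : ℕ)) x) :=
    circRank_injective Fin.val_injective
  have key := card_le_of_exploration hn hB1 hB hsw S (linkedQuadruples R)
    (fun f => (f (0, x 0), f (0, x 0 + 1), f (1, x 1), f (1, x 1 + 1)))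
    (fun f hf => by simpa [linkedQuadruples] using (hS f hf).2) circNext c
    (fun f hf y z hyz => by
      obtain ⟨h1, h3⟩ := (hmem y z).1 ((hcm' _ _).2 hyz)
      rw [← (hS f hf).1] at h3
      have := mem_edgeClass.1 h3
      obtain ⟨b, i⟩ := y
      obtain ⟨b', i'⟩ := z
      simp only at h1
      subst h1
      exact this)
    ∅ (circRank (fun b => b) x) hinj {c (0, x 0), c (1, x 1)} ?_
  · refine ⟨(Finset.univ.image c).card - 2, key.trans ?_, ?_⟩
    · rw [Finset.card_empty, zero_add, Finset.card_sdiff_of_subset hsub, Finset.card_pair hne,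
        Fintype.card_prod, Fintype.card_fin, Fintype.card_fin]
      gcongr
      exact card_linkedQuadruples_le
    · have h4 := Finset.card_le_card hsub
      rw [Finset.card_pair hne] at h4
      omega
  · rintro ⟨b, i⟩
    by_cases hi : i = x b ∨ i = x b + 1
    · refine Or.inr (Or.inl fun f _ f' _ h => ?_)
      simp only [Prod.mk.injEq] at h
      fin_cases b <;> rcases hi with rfl | rfl
      · exact h.1
      · exact h.2.1
      · exact h.2.2.1
      · exact h.2.2.2
    right; right
    rw [not_or] at hi
    have hnx : circNext (b, i - 1) = (b, i) := by simp [circNext]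
    have hrk := circRank_next (o := fun b : Fin 2 => (b : ℕ)) (s := x) (b, i - 1)
      (by simpa using hi.1)
    rw [hnx] at hrk
    refine ⟨(b, i - 1), Or.inl ⟨hnx, by omega⟩, fun h => ⟨(b, x b), hcol _ h, ?_, ?_⟩⟩
    all_goals
      have h3 := circRank_start_le (o := fun b : Fin 2 => (b : ℕ)) (s := x) b i
      have h4 : circRank (fun b : Fin 2 => (b : ℕ)) x (b, x b) ≠
          circRank (fun b : Fin 2 => (b : ℕ)) x (b, i) :=
        fun h => hi.1 (congrArg Prod.snd (hinj h)).symm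
    · omega
    · have h5 := circRank_next_le (o := fun b : Fin 2 => (b : ℕ)) (s := x) (b, x b)
      have h6 : circRank (fun b : Fin 2 => (b : ℕ)) x (circNext (b, x b)) ≠
          circRank (fun b : Fin 2 => (b : ℕ)) x (b, i) :=
        fun h => hi.2 (congrArg Prod.snd (hinj h)).symm
      omega

end

/-! ### Expectations of products of entries -/

section

variable {Ω : Type*} [MeasurableSpace Ω] {ℙ : Measure Ω}
  {a : (n : ℕ) → Ω → Matrix (Fin n) (Fin n) ℝ} {R : (n : ℕ) → Setoid (Fin n × Fin n)}
  {C : ℕ → ℝ} {D : ℕ → ℕ → ℝ} {n k : ℕ} {ι : Type*} [Fintype ι]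

/-- Hölder's inequality with all exponents equal to the number of factors. -/
theorem IsSSBHKW.integrable_prod [IsProbabilityMeasure ℙ] (ha : IsSSBHKW ℙ a R C D) (e : ι → Fin n × Fin n) :
    Integrable (fun ω => ∏ x, a n ω (e x).1 (e x).2) ℙ := by
  rcases isEmpty_or_nonempty ι with h | h
  · simp
  rw [← memLp_one_iff_integrable]
  have h1 := MemLp.prod' (s := Finset.univ) (p := fun _ : ι => (Fintype.card ι : ENNReal))
    (f := fun x ω => a n ω (e x).1 (e x).2)
    fun x _ => ha.moments n (e x).1 (e x).2 (Fintype.card ι)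
  have h2 : (∑ _x : ι, (Fintype.card ι : ENNReal)⁻¹)⁻¹ = 1 := by
    rw [Finset.sum_const, Finset.card_univ, nsmul_eq_mul, ENNReal.mul_inv_cancel, inv_one]
    · exact_mod_cast Fintype.card_ne_zero
    · exact ENNReal.natCast_ne_top _
  rwa [h2] at h1

/-- To apply (A1), the factors in `S` play the role of the `P i`; the others are collected by index
pair into distinct `Q j` with their multiplicities as exponents. -/
theorem IsSSBHKW.abs_integral_prod_le (ha : IsSSBHKW ℙ a R C D)
    (e : ι → Fin n × Fin n) (S : Finset ι) (hS : ∀ x ∈ S, ∀ y, R n (e x) (e y) → y = x) :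
    |∫ ω, ∏ x, a n ω (e x).1 (e x).2 ∂ℙ| ≤
      |C (Fintype.card ι)| / (n : ℝ) ^ ((S.card : ℝ) / 2) := by
  classical
  set T := Sᶜ with hT
  set I := T.image e with hI
  set P : Fin S.card → Fin n × Fin n := fun i => e (S.equivFin.symm i) with hP
  set Q : Fin I.card → Fin n × Fin n := fun j => (I.equivFin.symm j : Fin n × Fin n) with hQ
  set δ : Fin I.card → ℕ := fun j => (T.filter fun x => e x = Q j).card with hδ
  have h1 := ha.condA1 n S.card I.card P Q δ ?_ ?_ ?_ ?_
  · have hcard : S.card + ∑ j, δ j = Fintype.card ι := by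
      have h3 : ∑ j, δ j = ∑ v ∈ I, (T.filter fun x => e x = v).card := by
        rw [← Finset.sum_coe_sort I]
        exact Equiv.sum_comp I.equivFin.symm
          fun v : I => (T.filter fun x => e x = (v : Fin n × Fin n)).card
      rw [h3, hI, ← Finset.card_eq_sum_card_image, hT, Finset.card_compl]
      have := Finset.card_le_univ S
      omega
    have hprod : ∀ ω, (∏ i, a n ω (P i).1 (P i).2) * ∏ j, a n ω (Q j).1 (Q j).2 ^ δ j =
        ∏ x, a n ω (e x).1 (e x).2 := by
      intro ω
      rw [← Finset.prod_mul_prod_compl S]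
      congr 1
      · rw [← Finset.prod_coe_sort S]
        exact Equiv.prod_comp S.equivFin.symm fun x : S => a n ω (e x).1 (e x).2
      · rw [Finset.prod_comp (fun v : Fin n × Fin n => a n ω v.1 v.2) e, ← hT, ← hI,
          ← Finset.prod_coe_sort I]
        exact Equiv.prod_comp I.equivFin.symm
          fun v : I => a n ω (v : Fin n × Fin n).1 (v : Fin n × Fin n).2 ^
            (T.filter fun x => e x = (v : Fin n × Fin n)).card
    simp only [hprod, hcard] at h1
    exact h1.trans (by gcongr; exact le_abs_self _)
  · intro i j hij hR
    have := hS _ (S.equivFin.symm i).2 _ hR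
    exact hij (S.equivFin.symm.injective (Subtype.ext this)).symm
  · intro i j hR
    obtain ⟨x, hx, hxe⟩ := Finset.mem_image.1 (I.equivFin.symm j).2
    have hR' : R n (e (S.equivFin.symm i)) (e x) := by rw [hxe]; exact hR
    have := hS _ (S.equivFin.symm i).2 _ hR'
    rw [hT, Finset.mem_compl] at hx
    exact hx (this ▸ (S.equivFin.symm i).2)
  · intro i j hij
    exact I.equivFin.symm.injective (Subtype.ext hij)
  · intro j
    obtain ⟨x, hx, hxe⟩ := Finset.mem_image.1 (I.equivFin.symm j).2
    exact Finset.card_pos.2 ⟨x, Finset.mem_filter.2 ⟨hx, hxe⟩⟩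

theorem IsSSBHKW.abs_integral_prod_edges_le [DecidableEq ι] (ha : IsSSBHKW ℙ a R C D)
    (nx : ι → ι) (f : ι → Fin n) :
    |∫ ω, ∏ x, a n ω (f x) (f (nx x)) ∂ℙ| ≤ |C (Fintype.card ι)| /
      (n : ℝ) ^ (((Finset.univ.filter fun x => (edgeClass (R n) nx f x).card = 1).card : ℝ) / 2) := by
  refine ha.abs_integral_prod_le (fun x => (f x, f (nx x))) _ fun x hx y hy => ?_
  have h1 := (Finset.mem_filter.1 hx).2
  obtain ⟨z, hz⟩ := Finset.card_eq_one.1 h1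
  have h2 : y ∈ edgeClass (R n) nx f x := mem_edgeClass.2 hy
  have h3 : x ∈ edgeClass (R n) nx f x := mem_edgeClass.2 ((R n).refl _)
  rw [hz, Finset.mem_singleton] at h2 h3
  rw [h2, h3]

theorem IsSSBHKW.abs_integral_prod_le_const (ha : IsSSBHKW ℙ a R C D) (e : ι → Fin n × Fin n) :
    |∫ ω, ∏ x, a n ω (e x).1 (e x).2 ∂ℙ| ≤ |C (Fintype.card ι)| := by
  simpa using ha.abs_integral_prod_le e ∅ (by simp)

theorem IsSSBHKW.abs_integral_prod_sq_sub_one_le (ha : IsSSBHKW ℙ a R C D)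
    (e : ι → Fin n × Fin n) (he : ∀ x y, R n (e x) (e y) → x = y) :
    |(∫ ω, ∏ x, a n ω (e x).1 (e x).2 ^ 2 ∂ℙ) - 1| ≤ |D (Fintype.card ι) n| := by
  have h1 := ha.condA2 n (Fintype.card ι) (fun i => e ((Fintype.equivFin ι).symm i))
    fun i j hij hR => hij ((Fintype.equivFin ι).symm.injective (he _ _ hR))
  have h2 : ∀ ω, ∏ i, a n ω (e ((Fintype.equivFin ι).symm i)).1
      (e ((Fintype.equivFin ι).symm i)).2 ^ 2 = ∏ x, a n ω (e x).1 (e x).2 ^ 2 := fun ω =>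
    Equiv.prod_comp (Fintype.equivFin ι).symm fun x => a n ω (e x).1 (e x).2 ^ 2
  simp only [h2] at h1
  exact h1.trans (le_abs_self _)

/-- The product of the entries along a circuit. -/
def circProd (A : Matrix (Fin n) (Fin n) ℝ) (p : Fin (k + 1) → Fin n) : ℝ :=
  ∏ i, A (p i) (p (i + 1))

/-- The first edges of the blocks of a pairing. -/
abbrev Opener (k : ℕ) (f : ℕ → ℕ) : Type := {i : Fin (k + 1) // (i : ℕ) < f i}

theorem NCInv.two_mul_card_opener {f : ℕ → ℕ} (hf : NCInv 0 (k + 1) f) :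
    2 * Fintype.card (Opener k f) = k + 1 := by
  have h1 := hf.two_mul_openCount
  rw [Fintype.card_subtype]
  have : (Finset.univ.filter fun i : Fin (k + 1) => (i : ℕ) < f i).card = openCount f (k + 1) := by
    refine Finset.card_nbij (fun i => (i : ℕ)) (fun i hi => ?_)
      (fun i _ j _ h => Fin.ext h) (fun i hi => ?_)
    · have := i.isLt
      simp only [Finset.coe_filter, Finset.mem_range, Finset.mem_univ, true_and,
        Set.mem_ofPred_eq] at hi ⊢
      exact ⟨this, hi⟩
    · simp only [Finset.coe_filter, Finset.mem_range, Set.mem_ofPred_eq] at hi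
      exact ⟨⟨i, hi.1⟩, by simpa using hi.2, rfl⟩
  rw [this, h1]

/-- Paired edges are traversed in opposite directions, so by symmetry of the matrix their entries
agree. -/
theorem circProd_eq_prod_sq {A : Matrix (Fin n) (Fin n) ℝ} (hA : A.IsSymm)
    {p : Fin (k + 1) → Fin n} {f : ℕ → ℕ} (hf : NCInv 0 (k + 1) f)
    (hb : Backtracks (k + 1) f (circPath p)) :
    circProd A p = ∏ i : Opener k f, A (p i) (p (i + 1)) ^ 2 := by
  classical
  set t : Fin (k + 1) → Fin (k + 1) := fun i =>
    ⟨f i, (hf.maps i (Nat.zero_le _) i.isLt).2⟩ with ht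
  have htt : ∀ i, t (t i) = i := fun i => Fin.ext (hf.invol i)
  have h1 : ∏ i ∈ Finset.univ.filter (fun i : Fin (k + 1) => ¬ (i : ℕ) < f i),
      A (p i) (p (i + 1)) = ∏ i ∈ Finset.univ.filter (fun i : Fin (k + 1) => (i : ℕ) < f i),
      A (p i) (p (i + 1)) := by
    refine Finset.prod_nbij' t t ?_ ?_ (fun i _ => htt i) (fun i _ => htt i) ?_
    · intro i hi
      simp only [Finset.mem_filter, Finset.mem_univ, true_and] at hi ⊢
      have h2 := hf.ne i (Nat.zero_le _) i.isLt
      have h3 := hf.invol i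
      simp only [ht]
      omega
    · intro i hi
      simp only [Finset.mem_filter, Finset.mem_univ, true_and] at hi ⊢
      have h3 := hf.invol i
      simp only [ht]
      omega
    · intro i hi
      simp only [Finset.mem_filter, Finset.mem_univ, true_and] at hi
      have h2 := hf.ne i (Nat.zero_le _) i.isLt
      have h3 := hf.invol i
      have h4 := hb (f i) (hf.maps i (Nat.zero_le _) i.isLt).2 (by omega)
      rw [h3] at h4
      have e1 : p i = p (t i + 1) := by
        rw [← circPath_val p i, ← circPath_val_add_one p (t i)]
        exact h4.1
      have e2 : p (i + 1) = p (t i) := by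
        rw [← circPath_val p (t i), ← circPath_val_add_one p i]
        exact h4.2
      rw [e1, e2]
      exact hA.apply _ _
  rw [circProd, ← Finset.prod_filter_mul_prod_filter_not Finset.univ
    (fun i : Fin (k + 1) => (i : ℕ) < f i), h1, ← sq, ← Finset.prod_pow]
  exact (Finset.prod_subtype _ (by simp) fun i => A (p i) (p (i + 1)) ^ 2)

theorem IsSSBHKW.abs_integral_circProd_sub_one_le (ha : IsSSBHKW ℙ a R C D)
    {p : Fin (k + 1) → Fin n} (hp : IsTreeLike (R n) p) :
    |(∫ ω, circProd (a n ω) p ∂ℙ) - 1| ≤ |D ((k + 1) / 2) n| := by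
  obtain ⟨f, hf, hb, hc⟩ := hp
  have h1 := hf.two_mul_card_opener
  have h2 := ha.abs_integral_prod_sq_sub_one_le
    (fun i : Opener k f => (p i, p (i + 1))) fun x y hxy => by
      have h3 := (hc x y).1 (mem_edgeClass.2 hxy)
      rcases h3 with h3 | h3
      · exact Subtype.ext h3.symm
      · have h4 := x.2
        have h5 := y.2
        have h6 := hf.invol x
        rw [h3] at h5
        omega
  rw [show (k + 1) / 2 = Fintype.card (Opener k f) by omega]
  simpa only [← circProd_eq_prod_sq (ha.symm n _) hf hb] using h2

/-- For unlinked circuits the openers of both lie in pairwise different classes, `k + 1` in total,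
so (A2) applies to the joint product of squares. -/
theorem IsSSBHKW.abs_integral_circProd_mul_sub_one_le (ha : IsSSBHKW ℙ a R C D)
    {p p' : Fin (k + 1) → Fin n} (hp : IsTreeLike (R n) p) (hp' : IsTreeLike (R n) p')
    (hd : ∀ i j, ¬ R n (p i, p (i + 1)) (p' j, p' (j + 1))) :
    |(∫ ω, circProd (a n ω) p * circProd (a n ω) p' ∂ℙ) - 1| ≤ |D (k + 1) n| := by
  obtain ⟨f, hf, hb, hc⟩ := hp
  obtain ⟨f', hf', hb', hc'⟩ := hp'
  have h1 := hf.two_mul_card_opener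
  have h1' := hf'.two_mul_card_opener
  have h2 := ha.abs_integral_prod_sq_sub_one_le
    (fun i : Opener k f ⊕ Opener k f' =>
      Sum.elim (fun i : Opener k f => (p i, p (i + 1)))
        (fun i : Opener k f' => (p' i, p' (i + 1))) i) ?_
  · rw [show k + 1 = Fintype.card (Opener k f ⊕ Opener k f') by rw [Fintype.card_sum]; omega]
    simp only [Fintype.prod_sum_type, Sum.elim_inl, Sum.elim_inr,
      ← circProd_eq_prod_sq (ha.symm n _) hf hb, ← circProd_eq_prod_sq (ha.symm n _) hf' hb'] at h2
    exact h2
  · have key : ∀ {p : Fin (k + 1) → Fin n} {f : ℕ → ℕ}, NCInv 0 (k + 1) f →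
        (∀ i j : Fin (k + 1), j ∈ circClass (R n) p i ↔ j = i ∨ (j : ℕ) = f i) →
        ∀ x y : Opener k f, R n (p x, p (x + 1)) (p y, p (y + 1)) → x = y := by
      intro p f hf hc x y hxy
      rcases (hc x y).1 (mem_edgeClass.2 hxy) with h3 | h3
      · exact Subtype.ext h3.symm
      · have h4 := x.2
        have h5 := y.2
        have h6 := hf.invol x
        rw [h3] at h5
        omega
    rintro (x | x) (y | y) hxy
    · exact congrArg Sum.inl (key hf hc x y hxy)
    · exact absurd hxy (hd _ _)
    · exact absurd ((R n).symm hxy) (hd _ _)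
    · exact congrArg Sum.inr (key hf' hc' x y hxy)

end

/-! ### Counting circuits by type -/

section

variable {n B : ℕ} (R : Setoid (Fin n × Fin n)) (k : ℕ)

/-- Circuits with an edge class that is not a pair. -/
def unpaired : Finset (Fin (k + 1) → Fin n) :=
  open Classical in Finset.univ.filter fun p => ∃ i, (circClass R p i).card ≠ 2

/-- Circuits whose edge classes are pairs, but that are not tree-like. -/
def badPaired : Finset (Fin (k + 1) → Fin n) :=
  open Classical in Finset.univ.filter fun p => (∀ i, (circClass R p i).card = 2) ∧ ¬ IsTreeLike R p

/-- Tree-like circuits. -/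
def treeLike : Finset (Fin (k + 1) → Fin n) :=
  open Classical in Finset.univ.filter fun p => IsTreeLike R p

variable {k}

theorem mem_unpaired {p : Fin (k + 1) → Fin n} :
    p ∈ unpaired R k ↔ ∃ i, (circClass R p i).card ≠ 2 := by simp [unpaired]

theorem mem_treeLike {p : Fin (k + 1) → Fin n} : p ∈ treeLike R k ↔ IsTreeLike R p := by
  simp [treeLike]

theorem sum_eq_sum_types (g : (Fin (k + 1) → Fin n) → ℝ) :
    ∑ p, g p = ∑ p ∈ unpaired R k, g p + ∑ p ∈ badPaired R k, g p + ∑ p ∈ treeLike R k, g p := by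
  classical
  rw [← Finset.sum_filter_add_sum_filter_not Finset.univ
    (fun p : Fin (k + 1) → Fin n => ∃ i, (circClass R p i).card ≠ 2) g,
    ← Finset.sum_filter_add_sum_filter_not (Finset.univ.filter fun p : Fin (k + 1) → Fin n =>
      ¬ ∃ i, (circClass R p i).card ≠ 2) (fun p => ¬ IsTreeLike R p) g, add_assoc]
  refine congrArg₂ (· + ·) (Finset.sum_congr ?_ fun _ _ => rfl) ?_
  · ext p
    simp [unpaired]
  · refine congrArg₂ (· + ·) ?_ ?_
    · refine Finset.sum_congr ?_ fun _ _ => rfl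
      ext p
      simp [badPaired]
    · refine Finset.sum_congr ?_ fun _ _ => rfl
      ext p
      simp only [treeLike, Finset.mem_filter, Finset.mem_univ, true_and, not_not, not_exists]
      exact ⟨fun h => h.2, fun h => ⟨h.card_eq_two, h⟩⟩

variable (k) in
/-- The exponent `1 + K/2` of the number of circuits of length `K = k + 1` that matter. -/
def circExp : ℝ := 1 + ((k : ℝ) + 1) / 2

variable {R}

theorem natPow_eq_rpow_circExp {m : ℕ} {x : ℝ} (h : (m : ℝ) = x) :
    (n : ℝ) ^ m = (n : ℝ) ^ x := by
  rw [← h, Real.rpow_natCast]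

/-- The number of singleton classes in a family of circuits. -/
def singles {N : ℕ} (R : Setoid (Fin n × Fin n)) (F : Fin N → Fin (k + 1) → Fin n) : ℕ :=
  (Finset.univ.filter fun x => (edgeClass R circNext (Function.uncurry F) x).card = 1).card

theorem card_filter_edgeClass {N : ℕ} (F : Fin N → Fin (k + 1) → Fin n) (j : Fin N)
    (i : Fin (k + 1)) :
    ((edgeClass R circNext (Function.uncurry F) (j, i)).filter fun y => y.1 = j).card =
      (circClass R (F j) i).card := by
  refine (Finset.card_nbij (fun l => (j, l)) (fun l hl => ?_)
    (fun _ _ _ _ h => congrArg Prod.snd h) fun y hy => ?_).symm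
  · simp only [Finset.coe_filter, Set.mem_ofPred_eq]
    have h := mem_edgeClass.1 (Finset.mem_coe.1 hl)
    exact ⟨mem_edgeClass.2 h, trivial⟩
  · obtain ⟨j', l⟩ := y
    simp only [Finset.coe_filter, Set.mem_ofPred_eq] at hy
    obtain ⟨hy, rfl⟩ := hy
    have h := mem_edgeClass.1 hy
    exact ⟨l, Finset.mem_coe.2 (mem_edgeClass.2 h), rfl⟩

/-- Fix the class pattern, with `s` singletons. The additional `s/2` in the counting exponent
cancels against the weight `n^{-s/2}` supplied by (A1), leaving the saving of `1/6` per circuit. -/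
theorem sum_unpaired_le (hn : 0 < n) (hB1 : 1 ≤ B) (hB : ∀ p q r, countE2 R p q r ≤ B)
    (hsw : ∀ p q, R (p, q) (q, p)) (N : ℕ) :
    ∑ F ∈ Fintype.piFinset (fun _ : Fin N => unpaired R k),
      1 / (n : ℝ) ^ ((singles R F : ℝ) / 2) ≤
    (Fintype.card (Fin N × Fin (k + 1) → Finset (Fin N × Fin (k + 1))) * B ^ (N * (k + 1)) : ℕ) *
      ((n : ℝ) ^ (circExp k - 1 / 6)) ^ N := by
  classical
  have hn1 : (1 : ℝ) ≤ n := by exact_mod_cast hn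
  have hn0 : (0 : ℝ) < n := by exact_mod_cast hn
  rw [← Finset.sum_fiberwise (s := Fintype.piFinset (fun _ : Fin N => unpaired R k))
    (g := fun F => edgeClass R circNext (Function.uncurry F)), Nat.cast_mul, mul_assoc,
    ← Finset.card_univ, ← nsmul_eq_mul]
  refine Finset.sum_le_card_nsmul _ _ _ fun c _ => ?_
  set S := (Fintype.piFinset (fun _ : Fin N => unpaired R k)).filter
    fun F => edgeClass R circNext (Function.uncurry F) = c with hS
  set s := (Finset.univ.filter fun x => (c x).card = 1).card with hs
  have h1 : ∑ F ∈ S, 1 / (n : ℝ) ^ ((singles R F : ℝ) / 2) = S.card * (1 / (n : ℝ) ^ ((s : ℝ) / 2)) := by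
    rw [← nsmul_eq_mul, ← Finset.sum_const]
    refine Finset.sum_congr rfl fun F hF => ?_
    rw [singles, (Finset.mem_filter.1 hF).2]
  rw [h1]
  rcases S.eq_empty_or_nonempty with h0 | ⟨F₀, hF₀⟩
  · rw [h0, Finset.card_empty]
    simp only [Nat.cast_zero, zero_mul]
    positivity
  obtain ⟨m, hm1, hm2⟩ := card_le_of_not_paired hn hB1 hB hsw c
    (S.map ⟨Function.uncurry, Function.LeftInverse.injective Function.curry_uncurry⟩)
    (fun f hf => by
      obtain ⟨F, hF, rfl⟩ := Finset.mem_map.1 hf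
      exact (Finset.mem_filter.1 hF).2)
    (fun j => by
      obtain ⟨h2, h3⟩ := Finset.mem_filter.1 hF₀
      obtain ⟨i, hi⟩ := (mem_unpaired R).1 (Fintype.mem_piFinset.1 h2 j)
      refine ⟨i, ?_⟩
      rw [← h3, card_filter_edgeClass]
      exact hi)
  rw [Finset.card_map] at hm1
  have hm1' : (S.card : ℝ) ≤ (n : ℝ) ^ m * (B : ℝ) ^ (N * (k + 1)) := by exact_mod_cast hm1
  calc (S.card : ℝ) * (1 / (n : ℝ) ^ ((s : ℝ) / 2))
      ≤ ((n : ℝ) ^ m * (B : ℝ) ^ (N * (k + 1))) * (1 / (n : ℝ) ^ ((s : ℝ) / 2)) := by gcongr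
    _ = (B : ℝ) ^ (N * (k + 1)) * (n : ℝ) ^ ((m : ℝ) - (s : ℝ) / 2) := by
        rw [Real.rpow_sub hn0, Real.rpow_natCast]
        ring
    _ ≤ (B : ℝ) ^ (N * (k + 1)) * (n : ℝ) ^ ((circExp k - 1 / 6) * N) := by
        have h4 : (6 * m + N : ℝ) ≤ 6 * N + 3 * (N * (k + 1)) + 3 * s := by exact_mod_cast hm2
        gcongr
        rw [circExp]
        linarith
    _ = ((B ^ (N * (k + 1)) : ℕ) : ℝ) * ((n : ℝ) ^ (circExp k - 1 / 6)) ^ N := by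
        rw [Real.rpow_mul hn0.le, Real.rpow_natCast, Nat.cast_pow]

theorem card_treeLike_le_rpow (hn : 0 < n) (hB1 : 1 ≤ B) (hB : ∀ p q r, countE2 R p q r ≤ B)
    (hsw : ∀ p q, R (p, q) (q, p)) :
    ((treeLike R k).card : ℝ) ≤
      (Fintype.card (Fin (k + 1) → Finset (Fin (k + 1))) * B ^ (k + 1) : ℕ) *
      (n : ℝ) ^ circExp k := by
  classical
  have h1 := Finset.card_eq_sum_card_fiberwise (s := treeLike R k) (t := Finset.univ)
    (f := fun p => circClass R p) (by simp)
  rw [h1, Nat.cast_sum, Nat.cast_mul, mul_assoc, ← Finset.card_univ, ← nsmul_eq_mul]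
  refine Finset.sum_le_card_nsmul _ _ _ fun c _ => ?_
  rcases ((treeLike R k).filter fun p => circClass R p = c).eq_empty_or_nonempty with h0 | ⟨p, hp⟩
  · rw [h0, Finset.card_empty, Nat.cast_zero]
    positivity
  obtain ⟨hp1, hp2⟩ := Finset.mem_filter.1 hp
  have hcm : IsClassMap c := by rw [← hp2]; exact isClassMap_edgeClass _ _
  obtain ⟨m, hm1, hm2⟩ := card_treeLike_le hn hB1 hB hsw c hcm
    (fun i => by rw [← hp2]; exact ((mem_treeLike R).1 hp1).card_eq_two i)
    ((treeLike R k).filter fun p => circClass R p = c) (fun q hq => (Finset.mem_filter.1 hq).2)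
  have hm2' : (2 * m : ℝ) = k + 1 + 2 := by exact_mod_cast hm2
  rw [← natPow_eq_rpow_circExp (m := m) (by rw [circExp]; linarith), mul_comm]
  exact_mod_cast hm1

/-- The circuits are covered by finitely many families, one for each class pattern and position of a
crossing or of a block not traversed backwards. -/
theorem card_badPaired_le (hn : 0 < n) (hB1 : 1 ≤ B) (hB : ∀ p q r, countE2 R p q r ≤ B)
    (hsw : ∀ p q, R (p, q) (q, p)) :
    ((badPaired R k).card : ℝ) ≤
      (Fintype.card ((Fin (k + 1) → Finset (Fin (k + 1))) × Fin (k + 1) × Fin (k + 1) ×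
        Fin (k + 1) × Fin (k + 1)) * B ^ (k + 1) : ℕ) *
      ((maxE1 R + countE3 R) * (n : ℝ) ^ (circExp k - 2)) := by
  classical
  have hn0 : (0 : ℝ) < n := by exact_mod_cast hn
  set U : (Fin (k + 1) → Finset (Fin (k + 1))) × Fin (k + 1) × Fin (k + 1) ×
        Fin (k + 1) × Fin (k + 1) → Finset (Fin (k + 1) → Fin n) := fun x =>
    (badPaired R k).filter fun p => circClass R p = x.1 ∧
      x.2.1 < x.2.2.1 ∧ x.2.2.1 < x.2.2.2.1 ∧ x.2.2.2.1 < x.2.2.2.2 ∧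
      circClass R p x.2.1 = {x.2.1, x.2.2.2.1} ∧ circClass R p x.2.2.1 = {x.2.2.1, x.2.2.2.2}
    with hU
  set V : (Fin (k + 1) → Finset (Fin (k + 1))) × Fin (k + 1) × Fin (k + 1) ×
        Fin (k + 1) × Fin (k + 1) → Finset (Fin (k + 1) → Fin n) := fun x =>
    (badPaired R k).filter fun p => circClass R p = x.1 ∧
      x.2.1 < x.2.2.1 ∧ circClass R p x.2.1 = {x.2.1, x.2.2.1} ∧ p x.2.2.1 = p (x.2.1 + 1) ∧
      p (x.2.2.1 + 1) ≠ p x.2.1 with hV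
  have hpaired : ∀ p ∈ badPaired R k, ∀ i, (circClass R p i).card = 2 := fun p hp =>
    (Finset.mem_filter.1 hp).2.1
  have hsub : badPaired R k ⊆ Finset.univ.biUnion fun x => U x ∪ V x := by
    intro p hp
    rw [Finset.mem_biUnion]
    rcases isTreeLike_or (hpaired p hp) with h | ⟨a, b, c, d, h⟩ | ⟨i, j, h⟩
    · exact absurd h (Finset.mem_filter.1 hp).2.2
    · exact ⟨(circClass R p, a, b, c, d), Finset.mem_univ _,
        Finset.mem_union_left _ (Finset.mem_filter.2 ⟨hp, rfl, h⟩)⟩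
    -- The last two entries are padding, so that both kinds of defect share one index type.
    · exact ⟨(circClass R p, i, j, i, i), Finset.mem_univ _,
        Finset.mem_union_right _ (Finset.mem_filter.2 ⟨hp, rfl, h⟩)⟩
  have hUc : ∀ x, ((U x).card : ℝ) ≤ (B : ℝ) ^ (k + 1) * (maxE1 R * (n : ℝ) ^ (circExp k - 2)) := by
    intro x
    rcases (U x).eq_empty_or_nonempty with h0 | ⟨p, hp⟩
    · rw [h0, Finset.card_empty, Nat.cast_zero]
      positivity
    obtain ⟨hp1, hp2, h1, h2, h3, h4, h5⟩ := Finset.mem_filter.1 hp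
    have hcm : IsClassMap x.1 := by rw [← hp2]; exact isClassMap_edgeClass _ _
    obtain ⟨m, hm1, hm2⟩ := card_crossing_le hn hB1 hB hsw x.1 hcm
      (fun i => by rw [← hp2]; exact hpaired p hp1 i) (U x)
      (fun q hq => (Finset.mem_filter.1 hq).2.1) h1 h2 h3 (by rw [← hp2]; exact h4)
      (by rw [← hp2]; exact h5)
    have hm2' : (2 * m + 4 : ℝ) = k + 1 := by exact_mod_cast hm2
    rw [← natPow_eq_rpow_circExp (m := m + 1) (by push_cast; rw [circExp]; linarith)]
    have hm1' : ((U x).card : ℝ) ≤ n * maxE1 R * (n : ℝ) ^ m * (B : ℝ) ^ (k + 1) := by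
      exact_mod_cast hm1
    refine hm1'.trans (le_of_eq ?_)
    ring
  have hVc : ∀ x, ((V x).card : ℝ) ≤ (B : ℝ) ^ (k + 1) * (countE3 R * (n : ℝ) ^ (circExp k - 2)) := by
    intro x
    rcases (V x).eq_empty_or_nonempty with h0 | ⟨p, hp⟩
    · rw [h0, Finset.card_empty, Nat.cast_zero]
      positivity
    obtain ⟨hp1, hp2, h1, h2, h3, h4⟩ := Finset.mem_filter.1 hp
    have hcm : IsClassMap x.1 := by rw [← hp2]; exact isClassMap_edgeClass _ _
    obtain ⟨m, hm1, hm2⟩ := card_not_backtracking_le hn hB1 hB hsw x.1 hcm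
      (fun i => by rw [← hp2]; exact hpaired p hp1 i) (V x) h1 (by rw [← hp2]; exact h2)
      (fun q hq => by
        have := (Finset.mem_filter.1 hq).2
        exact ⟨this.1, this.2.2.2.1, this.2.2.2.2⟩)
    have hm2' : (2 * m + 2 : ℝ) = k + 1 := by exact_mod_cast hm2
    rw [← natPow_eq_rpow_circExp (m := m) (by rw [circExp]; linarith)]
    have hm1' : ((V x).card : ℝ) ≤ countE3 R * (n : ℝ) ^ m * (B : ℝ) ^ (k + 1) := by
      exact_mod_cast hm1
    refine hm1'.trans (le_of_eq ?_)
    ring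
  have h1 : ((badPaired R k).card : ℝ) ≤ ∑ x, (((U x).card : ℝ) + (V x).card) := by
    have h2 := (Finset.card_le_card hsub).trans Finset.card_biUnion_le
    have h3 : ∑ x, (U x ∪ V x).card ≤ ∑ x, ((U x).card + (V x).card) :=
      Finset.sum_le_sum fun x _ => Finset.card_union_le _ _
    exact_mod_cast h2.trans h3
  refine h1.trans ?_
  rw [Nat.cast_mul, mul_assoc, ← Finset.card_univ, ← nsmul_eq_mul]
  refine Finset.sum_le_card_nsmul _ _ _ fun x _ => ?_
  refine (add_le_add (hUc x) (hVc x)).trans (le_of_eq ?_)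
  rw [Nat.cast_pow]
  ring

variable (R k) in
/-- Pairs of tree-like circuits with equivalent edges. -/
def linkedPairs : Finset ((Fin (k + 1) → Fin n) × (Fin (k + 1) → Fin n)) :=
  open Classical in (treeLike R k ×ˢ treeLike R k).filter fun x =>
    ∃ i j, R (x.1 i, x.1 (i + 1)) (x.2 j, x.2 (j + 1))

theorem card_linkedPairs_le (hn : 0 < n) (hB1 : 1 ≤ B) (hB : ∀ p q r, countE2 R p q r ≤ B)
    (hsw : ∀ p q, R (p, q) (q, p)) :
    ((linkedPairs R k).card : ℝ) ≤
      (Fintype.card ((Fin 2 → Fin (k + 1) → Finset (Fin (k + 1))) × (Fin 2 → Fin (k + 1))) *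
        B ^ (2 * (k + 1)) : ℕ) * (maxE1 R * (n : ℝ) ^ (2 * circExp k - 3)) := by
  classical
  have hn0 : (0 : ℝ) < n := by exact_mod_cast hn
  set e : (Fin (k + 1) → Fin n) × (Fin (k + 1) → Fin n) → Fin 2 × Fin (k + 1) → Fin n :=
    fun x y => if y.1 = 0 then x.1 y.2 else x.2 y.2 with he
  have hinj : Function.Injective e := by
    intro x x' h
    refine Prod.ext (funext fun i => ?_) (funext fun i => ?_)
    · simpa [he] using congrFun h (0, i)
    · simpa [he] using congrFun h (1, i)
  have he0 : ∀ x i, e x (0, i) = x.1 i := fun x i => by simp [he]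
  have he1 : ∀ x i, e x (1, i) = x.2 i := fun x i => by simp [he]
  set U : (Fin 2 → Fin (k + 1) → Finset (Fin (k + 1))) × (Fin 2 → Fin (k + 1)) →
      Finset ((Fin (k + 1) → Fin n) × (Fin (k + 1) → Fin n)) := fun y =>
    (linkedPairs R k).filter fun x => (∀ b, circClass R (fun i => e x (b, i)) = y.1 b) ∧
      R (e x (0, y.2 0), e x (0, y.2 0 + 1)) (e x (1, y.2 1), e x (1, y.2 1 + 1)) with hU
  have hsub : linkedPairs R k ⊆ Finset.univ.biUnion U := by
    intro x hx
    rw [Finset.mem_biUnion]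
    obtain ⟨i, j, hij⟩ := (Finset.mem_filter.1 hx).2
    refine ⟨(fun b => circClass R (fun i => e x (b, i)), ![i, j]), Finset.mem_univ _,
      Finset.mem_filter.2 ⟨hx, fun b => rfl, ?_⟩⟩
    simpa [he0, he1] using hij
  have hUc : ∀ y, ((U y).card : ℝ) ≤
      (B ^ (2 * (k + 1)) : ℕ) * (maxE1 R * (n : ℝ) ^ (2 * circExp k - 3)) := by
    intro y
    rcases (U y).eq_empty_or_nonempty with h0 | ⟨x, hx⟩
    · rw [h0, Finset.card_empty, Nat.cast_zero]
      positivity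
    obtain ⟨hx1, hx2, hx3⟩ := Finset.mem_filter.1 hx
    obtain ⟨hx4, hx5⟩ := Finset.mem_product.1 (Finset.mem_filter.1 hx1).1
    have hcard : ∀ b i, (y.1 b i).card = 2 := by
      intro b i
      rw [← hx2 b]
      fin_cases b
      · exact ((mem_treeLike R).1 hx4).card_eq_two i
      · exact ((mem_treeLike R).1 hx5).card_eq_two i
    obtain ⟨m, hm1, hm2⟩ := card_linked_pairs_le hn hB1 hB hsw y.1
      (fun b => by rw [← hx2 b]; exact isClassMap_edgeClass _ _) hcard y.2
      ((U y).map ⟨e, hinj⟩) (fun f hf => by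
        obtain ⟨x, hx, rfl⟩ := Finset.mem_map.1 hf
        exact (Finset.mem_filter.1 hx).2)
    rw [Finset.card_map] at hm1
    have hm2' : (m + 2 : ℝ) = k + 1 := by exact_mod_cast hm2
    rw [← natPow_eq_rpow_circExp (m := m + 1) (by push_cast; rw [circExp]; linarith)]
    have hm1' : ((U y).card : ℝ) ≤ n * maxE1 R * (n : ℝ) ^ m * (B : ℝ) ^ (2 * (k + 1)) := by
      exact_mod_cast hm1
    refine hm1'.trans (le_of_eq ?_)
    push_cast
    ring
  have h1 : ((linkedPairs R k).card : ℝ) ≤ ∑ y, ((U y).card : ℝ) := by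
    exact_mod_cast (Finset.card_le_card hsub).trans Finset.card_biUnion_le
  refine h1.trans ?_
  rw [Nat.cast_mul, mul_assoc, ← Finset.card_univ, ← nsmul_eq_mul]
  exact Finset.sum_le_card_nsmul _ _ _ fun y _ => hUc y

end

/-! ### Moment bounds for weighted sums over circuits -/

section

variable {Ω : Type*} [MeasurableSpace Ω] {ℙ : Measure Ω} [IsProbabilityMeasure ℙ]
  {a : (n : ℕ) → Ω → Matrix (Fin n) (Fin n) ℝ} {R : (n : ℕ) → Setoid (Fin n × Fin n)}
  {C : ℕ → ℝ} {D : ℕ → ℕ → ℝ} {n k : ℕ}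

theorem prod_circProd (A : Matrix (Fin n) (Fin n) ℝ) {N : ℕ} (F : Fin N → Fin (k + 1) → Fin n) :
    ∏ j, circProd A (F j) =
      ∏ x : Fin N × Fin (k + 1), A (Function.uncurry F x) (Function.uncurry F (circNext x)) := by
  rw [Fintype.prod_prod_type]
  rfl

theorem IsSSBHKW.integral_sum_pow (ha : IsSSBHKW ℙ a R C D)
    (W : (Fin (k + 1) → Fin n) → ℝ) (S : Finset (Fin (k + 1) → Fin n)) (N : ℕ) :
    Integrable (fun ω => (∑ p ∈ S, W p * circProd (a n ω) p) ^ N) ℙ ∧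
    ∫ ω, (∑ p ∈ S, W p * circProd (a n ω) p) ^ N ∂ℙ =
      ∑ F ∈ Fintype.piFinset (fun _ : Fin N => S), (∏ j, W (F j)) *
        ∫ ω, ∏ x : Fin N × Fin (k + 1),
          a n ω (Function.uncurry F x) (Function.uncurry F (circNext x)) ∂ℙ := by
  have h1 : ∀ ω, (∑ p ∈ S, W p * circProd (a n ω) p) ^ N =
      ∑ F ∈ Fintype.piFinset (fun _ : Fin N => S), (∏ j, W (F j)) *
        ∏ x : Fin N × Fin (k + 1),
          a n ω (Function.uncurry F x) (Function.uncurry F (circNext x)) := by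
    intro ω
    rw [Finset.sum_pow']
    refine Finset.sum_congr rfl fun F _ => ?_
    rw [Finset.prod_mul_distrib, prod_circProd]
  have h2 : ∀ F : Fin N → Fin (k + 1) → Fin n, Integrable (fun ω => (∏ j, W (F j)) *
      ∏ x : Fin N × Fin (k + 1),
          a n ω (Function.uncurry F x) (Function.uncurry F (circNext x))) ℙ := fun F =>
    (ha.integrable_prod fun x => (Function.uncurry F x, Function.uncurry F (circNext x))).const_mul _
  simp only [h1]
  refine ⟨integrable_finsetSum _ fun F _ => h2 F, ?_⟩
  rw [integral_finsetSum _ fun F _ => h2 F]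
  exact Finset.sum_congr rfl fun F _ => integral_const_mul _ _

theorem abs_prod_le_pow {N : ℕ} {X : Type*} {W : X → ℝ} {M : ℝ} (hW : ∀ p, |W p| ≤ M)
    (F : Fin N → X) : |∏ j, W (F j)| ≤ M ^ N := by
  rw [Finset.abs_prod]
  refine (Finset.prod_le_prod (fun _ _ => abs_nonneg _) fun j _ => hW (F j)).trans ?_
  simp

theorem IsSSBHKW.abs_integral_unpaired_pow_le {B : ℕ} (ha : IsSSBHKW ℙ a R C D) (hn : 0 < n)
    (hB1 : 1 ≤ B) (hB : ∀ p q r, countE2 (R n) p q r ≤ B) {W : (Fin (k + 1) → Fin n) → ℝ} {M : ℝ}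
    (hW : ∀ p, |W p| ≤ M) (N : ℕ) :
    |∫ ω, (∑ p ∈ unpaired (R n) k, W p * circProd (a n ω) p) ^ N ∂ℙ| ≤
      M ^ N * |C (N * (k + 1))| *
      ((Fintype.card (Fin N × Fin (k + 1) → Finset (Fin N × Fin (k + 1))) *
        B ^ (N * (k + 1)) : ℕ) * ((n : ℝ) ^ (circExp k - 1 / 6)) ^ N) := by
  rw [(ha.integral_sum_pow W _ N).2]
  have hM : 0 ≤ M := (abs_nonneg _).trans (hW fun _ => ⟨0, hn⟩)
  refine (Finset.abs_sum_le_sum_abs _ _).trans ?_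
  refine le_trans ?_ (mul_le_mul_of_nonneg_left (sum_unpaired_le hn hB1 hB (ha.rel_swap n) N)
    (by positivity))
  rw [Finset.mul_sum]
  refine Finset.sum_le_sum fun F _ => ?_
  rw [abs_mul, mul_assoc, mul_one_div]
  refine mul_le_mul (abs_prod_le_pow hW F) ?_ (abs_nonneg _) (by positivity)
  have := ha.abs_integral_prod_edges_le circNext (Function.uncurry F)
  rwa [Fintype.card_prod, Fintype.card_fin, Fintype.card_fin] at this

/-- A crude bound of each term by a constant; it suffices for the paired circuits that are not
tree-like, because there are few of them. -/
theorem IsSSBHKW.abs_integral_sum_pow_le (ha : IsSSBHKW ℙ a R C D)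
    {W : (Fin (k + 1) → Fin n) → ℝ} {M : ℝ} (hM : 0 ≤ M)
    (hW : ∀ p, |W p| ≤ M) (S : Finset (Fin (k + 1) → Fin n)) (N : ℕ) :
    |∫ ω, (∑ p ∈ S, W p * circProd (a n ω) p) ^ N ∂ℙ| ≤
      M ^ N * |C (N * (k + 1))| * (S.card : ℝ) ^ N := by
  rw [(ha.integral_sum_pow W _ N).2]
  refine (Finset.abs_sum_le_sum_abs _ _).trans ?_
  have h1 : ∀ F ∈ Fintype.piFinset (fun _ : Fin N => S), |(∏ j, W (F j)) *
        ∫ ω, ∏ x : Fin N × Fin (k + 1),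
          a n ω (Function.uncurry F x) (Function.uncurry F (circNext x)) ∂ℙ| ≤
      M ^ N * |C (N * (k + 1))| := by
    intro F _
    rw [abs_mul]
    refine mul_le_mul (abs_prod_le_pow hW F) ?_ (abs_nonneg _) (by positivity)
    have := ha.abs_integral_prod_le_const fun x : Fin N × Fin (k + 1) =>
      (Function.uncurry F x, Function.uncurry F (circNext x))
    rwa [Fintype.card_prod, Fintype.card_fin, Fintype.card_fin] at this
  refine (Finset.sum_le_card_nsmul _ _ _ h1).trans (le_of_eq ?_)
  rw [Fintype.card_piFinset_const, nsmul_eq_mul]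
  push_cast
  rw [mul_comm]

theorem IsSSBHKW.integrable_circProd_mul (ha : IsSSBHKW ℙ a R C D) (p p' : Fin (k + 1) → Fin n) :
    Integrable (fun ω => circProd (a n ω) p * circProd (a n ω) p') ℙ ∧
      |∫ ω, circProd (a n ω) p * circProd (a n ω) p' ∂ℙ| ≤ |C (2 * (k + 1))| := by
  have h1 := ha.integrable_prod (n := n) (Sum.elim (fun i : Fin (k + 1) => (p i, p (i + 1)))
    (fun i : Fin (k + 1) => (p' i, p' (i + 1))))
  have h2 := ha.abs_integral_prod_le_const (n := n)
    (Sum.elim (fun i : Fin (k + 1) => (p i, p (i + 1)))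
    (fun i : Fin (k + 1) => (p' i, p' (i + 1))))
  simp only [Fintype.prod_sum_type, Sum.elim_inl, Sum.elim_inr, Fintype.card_sum,
    Fintype.card_fin, ← two_mul] at h1 h2
  exact ⟨h1, h2⟩

theorem IsSSBHKW.integrable_circProd (ha : IsSSBHKW ℙ a R C D) (p : Fin (k + 1) → Fin n) :
    Integrable (fun ω => circProd (a n ω) p) ℙ ∧
      |∫ ω, circProd (a n ω) p ∂ℙ| ≤ |C (k + 1)| := by
  have h1 := ha.integrable_prod (n := n) (fun i : Fin (k + 1) => (p i, p (i + 1)))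
  have h2 := ha.abs_integral_prod_le_const (n := n) (fun i : Fin (k + 1) => (p i, p (i + 1)))
  rw [Fintype.card_fin] at h2
  exact ⟨h1, h2⟩

/-- Expand the square into terms `E(XX' - X - X' + 1)`. For unlinked circuits all three expectations
are close to `1`, so the term is of the size of the errors in (A2). Linked pairs are bounded
trivially and counted. -/
theorem IsSSBHKW.integral_treeLike_sq_le (ha : IsSSBHKW ℙ a R C D)
    {W : (Fin (k + 1) → Fin n) → ℝ} {M : ℝ} (hM : 0 ≤ M) (hW : ∀ p, |W p| ≤ M) :
    Integrable (fun ω => (∑ p ∈ treeLike (R n) k, W p * (circProd (a n ω) p - 1)) ^ 2) ℙ ∧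
    ∫ ω, (∑ p ∈ treeLike (R n) k, W p * (circProd (a n ω) p - 1)) ^ 2 ∂ℙ ≤
      M ^ 2 * ((|C (2 * (k + 1))| + 2 * |C (k + 1)| + 1) * (linkedPairs (R n) k).card +
        (|D (k + 1) n| + 2 * |D ((k + 1) / 2) n|) * ((treeLike (R n) k).card : ℝ) ^ 2) := by
  classical
  set G := treeLike (R n) k with hG
  have h1 : ∀ ω, (∑ p ∈ G, W p * (circProd (a n ω) p - 1)) ^ 2 =
      ∑ x ∈ G ×ˢ G, W x.1 * W x.2 * (circProd (a n ω) x.1 * circProd (a n ω) x.2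
        - circProd (a n ω) x.1 - circProd (a n ω) x.2 + 1) := by
    intro ω
    rw [sq, Finset.sum_mul_sum, Finset.sum_product]
    refine Finset.sum_congr rfl fun p _ => Finset.sum_congr rfl fun p' _ => ?_
    ring
  have h2 : ∀ x : (Fin (k + 1) → Fin n) × (Fin (k + 1) → Fin n),
      Integrable (fun ω => circProd (a n ω) x.1 * circProd (a n ω) x.2
        - circProd (a n ω) x.1 - circProd (a n ω) x.2 + 1) ℙ := fun x =>
    (((ha.integrable_circProd_mul x.1 x.2).1.sub (ha.integrable_circProd x.1).1).sub
      (ha.integrable_circProd x.2).1).add (integrable_const _)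
  have h3 : ∀ x : (Fin (k + 1) → Fin n) × (Fin (k + 1) → Fin n),
      ∫ ω, (circProd (a n ω) x.1 * circProd (a n ω) x.2
        - circProd (a n ω) x.1 - circProd (a n ω) x.2 + 1) ∂ℙ =
      (∫ ω, circProd (a n ω) x.1 * circProd (a n ω) x.2 ∂ℙ) - (∫ ω, circProd (a n ω) x.1 ∂ℙ)
        - (∫ ω, circProd (a n ω) x.2 ∂ℙ) + 1 := by
    intro x
    have i1 := (ha.integrable_circProd_mul x.1 x.2).1
    have i2 := (ha.integrable_circProd x.1).1
    have i3 := (ha.integrable_circProd x.2).1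
    have e1 := integral_add (μ := ℙ) ((i1.sub i2).sub i3) (integrable_const (1 : ℝ))
    have e2 := integral_sub (i1.sub i2) i3
    have e3 := integral_sub i1 i2
    simp only [Pi.sub_apply, integral_const, probReal_univ, one_smul] at e1 e2 e3
    rw [e1, e2, e3]
  simp only [h1]
  refine ⟨integrable_finsetSum _ fun x _ => (h2 x).const_mul _, ?_⟩
  rw [integral_finsetSum _ fun x _ => (h2 x).const_mul _]
  simp only [integral_const_mul, h3]
  have hWW : ∀ x : (Fin (k + 1) → Fin n) × (Fin (k + 1) → Fin n), |W x.1 * W x.2| ≤ M ^ 2 := by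
    intro x
    rw [abs_mul, sq]
    exact mul_le_mul (hW _) (hW _) (abs_nonneg _) hM
  set P : (Fin (k + 1) → Fin n) × (Fin (k + 1) → Fin n) → Prop := fun x =>
    ∃ i j, R n (x.1 i, x.1 (i + 1)) (x.2 j, x.2 (j + 1)) with hP
  rw [← Finset.sum_filter_add_sum_filter_not (G ×ˢ G) P, mul_add]
  have hlink : (G ×ˢ G).filter P = linkedPairs (R n) k := by
    ext x
    simp [linkedPairs, hG, hP]
  refine add_le_add ?_ ?_
  · rw [hlink]
    refine (Finset.sum_le_card_nsmul _ _ (M ^ 2 * (|C (2 * (k + 1))| + 2 * |C (k + 1)| + 1))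
      fun x _ => ?_).trans (le_of_eq (by rw [nsmul_eq_mul]; ring))
    refine (le_abs_self _).trans ?_
    rw [abs_mul]
    refine mul_le_mul (hWW x) ?_ (abs_nonneg _) (by positivity)
    have i1 := abs_le.1 (ha.integrable_circProd_mul x.1 x.2).2
    have i2 := abs_le.1 (ha.integrable_circProd x.1).2
    have i3 := abs_le.1 (ha.integrable_circProd x.2).2
    rw [abs_le]
    constructor <;> linarith [i1.1, i1.2, i2.1, i2.2, i3.1, i3.2]
  · refine (Finset.sum_le_card_nsmul _ _ (M ^ 2 * (|D (k + 1) n| + 2 * |D ((k + 1) / 2) n|))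
      fun x hx => ?_).trans ?_
    · refine (le_abs_self _).trans ?_
      rw [abs_mul]
      refine mul_le_mul (hWW x) ?_ (abs_nonneg _) (by positivity)
      obtain ⟨hx1, hx2⟩ := Finset.mem_filter.1 hx
      obtain ⟨hx3, hx4⟩ := Finset.mem_product.1 hx1
      simp only [hP, not_exists] at hx2
      have t1 := (mem_treeLike (R n)).1 hx3
      have t2 := (mem_treeLike (R n)).1 hx4
      have i1 := abs_le.1 (ha.abs_integral_circProd_mul_sub_one_le t1 t2 hx2)
      have i2 := abs_le.1 (ha.abs_integral_circProd_sub_one_le t1)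
      have i3 := abs_le.1 (ha.abs_integral_circProd_sub_one_le t2)
      rw [abs_le]
      constructor <;> linarith [i1.1, i1.2, i2.1, i2.2, i3.1, i3.2]
    · rw [nsmul_eq_mul]
      have h5 : ((((G ×ˢ G).filter fun x => ¬ P x).card : ℕ) : ℝ) ≤ (G.card : ℝ) ^ 2 := by
        have := Finset.card_filter_le (G ×ˢ G) fun x => ¬ P x
        rw [Finset.card_product, ← sq] at this
        exact_mod_cast this
      calc _ ≤ (G.card : ℝ) ^ 2 * (M ^ 2 * (|D (k + 1) n| + 2 * |D ((k + 1) / 2) n|)) := by gcongr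
        _ = _ := by ring

end

/-! ### Convergence from bounds on even moments -/

section

variable {Ω : Type*} [MeasurableSpace Ω] {ℙ : Measure Ω}

/-- `Z n → 0` in probability, for real random variables. -/
def VanishInProb (ℙ : Measure Ω) (Z : ℕ → Ω → ℝ) : Prop :=
  ∀ ε : ℝ, 0 < ε → Tendsto (fun n => ℙ {ω | ε ≤ |Z n ω|}) atTop (𝓝 0)

/-- `Z n → 0` almost surely. -/
def VanishAS (ℙ : Measure Ω) (Z : ℕ → Ω → ℝ) : Prop :=
  ∀ᵐ ω ∂ℙ, Tendsto (fun n => Z n ω) atTop (𝓝 0)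

theorem VanishInProb.add {Z Z' : ℕ → Ω → ℝ} (h : VanishInProb ℙ Z) (h' : VanishInProb ℙ Z') :
    VanishInProb ℙ fun n ω => Z n ω + Z' n ω := by
  intro ε hε
  have h1 := (h (ε / 2) (half_pos hε)).add (h' (ε / 2) (half_pos hε))
  rw [add_zero] at h1
  refine tendsto_of_tendsto_of_tendsto_of_le_of_le tendsto_const_nhds h1 (fun n => zero_le) fun n => ?_
  refine (measure_mono fun ω hω => ?_).trans (measure_union_le _ _)
  by_contra hc
  simp only [Set.mem_union, Set.mem_ofPred_eq, not_or, not_le] at hc hω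
  have := abs_add_le (Z n ω) (Z' n ω)
  linarith [hc.1, hc.2]

theorem VanishInProb.add_of_tendsto {Z : ℕ → Ω → ℝ} {c : ℕ → ℝ} (h : VanishInProb ℙ Z)
    (hc : Tendsto c atTop (𝓝 0)) : VanishInProb ℙ fun n ω => Z n ω + c n := by
  refine h.add fun ε hε => ?_
  have h1 : ∀ᶠ n in atTop, |c n| < ε := by
    have := hc.abs
    rw [abs_zero] at this
    exact this.eventually_lt_const hε
  refine tendsto_const_nhds.congr' ?_
  filter_upwards [h1] with n hn
  simp [not_le.2 hn]

theorem VanishInProb.congr {Z Z' : ℕ → Ω → ℝ} (h : VanishInProb ℙ Z)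
    (hZ : ∀ᶠ n in atTop, ∀ ω, Z n ω = Z' n ω) : VanishInProb ℙ Z' := by
  intro ε hε
  refine (h ε hε).congr' ?_
  filter_upwards [hZ] with n hn
  simp only [hn]

theorem vanishInProb_of_integral_pow_le [IsProbabilityMeasure ℙ] {Z : ℕ → Ω → ℝ} {r : ℕ} {b : ℕ → ℝ}
    (hi : ∀ n, 1 ≤ n → Integrable (fun ω => Z n ω ^ (2 * r)) ℙ)
    (hb : ∀ n, 1 ≤ n → ∫ ω, Z n ω ^ (2 * r) ∂ℙ ≤ b n) (h0 : Tendsto b atTop (𝓝 0)) :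
    VanishInProb ℙ Z := by
  intro ε hε
  have hε' : (0 : ℝ) < ε ^ (2 * r) := by positivity
  have h1 : Tendsto (fun n => ENNReal.ofReal (b n / ε ^ (2 * r))) atTop (𝓝 0) := by
    have := ENNReal.tendsto_ofReal (h0.div_const (ε ^ (2 * r)))
    simpa using this
  refine tendsto_of_tendsto_of_tendsto_of_le_of_le' tendsto_const_nhds h1
    (Eventually.of_forall fun n => zero_le) ?_
  filter_upwards [eventually_ge_atTop 1] with n hn
  have h2 := mul_meas_ge_le_integral_of_nonneg (μ := ℙ)
    (ae_of_all _ fun ω => (even_two_mul r).pow_nonneg (Z n ω)) (hi n hn) (ε ^ (2 * r))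
  have h3 : {ω | ε ≤ |Z n ω|} ⊆ {ω | ε ^ (2 * r) ≤ Z n ω ^ (2 * r)} := by
    intro ω hω
    simp only [Set.mem_ofPred_eq] at hω ⊢
    rw [← (even_two_mul r).pow_abs (Z n ω)]
    exact pow_le_pow_left₀ hε.le hω _
  refine (measure_mono h3).trans ?_
  rw [← ENNReal.ofReal_toReal (measure_ne_top ℙ {ω | ε ^ (2 * r) ≤ Z n ω ^ (2 * r)})]
  apply ENNReal.ofReal_le_ofReal
  rw [le_div_iff₀ hε', mul_comm]
  exact h2.trans (hb n hn)

/-- Summable moments make the series of the nonnegative variables `Z n ^ (2r)` integrable, hence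
almost surely finite, so its terms tend to `0`. Indices are shifted by one since the bounds start at
`n = 1`. -/
theorem vanishAS_of_integral_pow_le {Z : ℕ → Ω → ℝ} {r : ℕ} {b : ℕ → ℝ}
    (hi : ∀ n, 1 ≤ n → Integrable (fun ω => Z n ω ^ (2 * r)) ℙ)
    (hb : ∀ n, 1 ≤ n → ∫ ω, Z n ω ^ (2 * r) ∂ℙ ≤ b n) (h0 : Summable b) :
    VanishAS ℙ Z := by
  have hnn : ∀ n, 0 ≤ᵐ[ℙ] fun ω => Z n ω ^ (2 * r) := fun n =>
    ae_of_all _ fun ω => (even_two_mul r).pow_nonneg (Z n ω)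
  have hb0 : ∀ n, 0 ≤ b (n + 1) := fun n =>
    (integral_nonneg_of_ae (hnn (n + 1))).trans (hb (n + 1) (by omega))
  have hm : ∀ n, AEMeasurable (fun ω => ENNReal.ofReal (Z (n + 1) ω ^ (2 * r))) ℙ := fun n =>
    (hi (n + 1) (by omega)).aestronglyMeasurable.aemeasurable.ennreal_ofReal
  have h1 : ∫⁻ ω, ∑' n, ENNReal.ofReal (Z (n + 1) ω ^ (2 * r)) ∂ℙ ≠ ⊤ := by
    rw [lintegral_tsum hm]
    have hs : Summable fun n => b (n + 1) := (summable_nat_add_iff 1).2 h0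
    refine ne_top_of_le_ne_top (hs.tsum_ofReal_ne_top) (ENNReal.tsum_le_tsum fun n => ?_)
    rw [← ofReal_integral_eq_lintegral_ofReal (hi (n + 1) (by omega)) (hnn (n + 1))]
    exact ENNReal.ofReal_le_ofReal (hb (n + 1) (by omega))
  have h2 := ae_lt_top' (AEMeasurable.tsum hm) h1
  filter_upwards [h2] with ω hω
  have h3 := ENNReal.tendsto_atTop_zero_of_tsum_ne_top hω.ne
  rw [← tendsto_add_atTop_iff_nat 1]
  have h4 : Tendsto (fun n => Z (n + 1) ω ^ (2 * r)) atTop (𝓝 0) := by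
    have := (ENNReal.tendsto_toReal ENNReal.zero_ne_top).comp h3
    refine this.congr fun n => ?_
    exact ENNReal.toReal_ofReal ((even_two_mul r).pow_nonneg _)
  rw [tendsto_zero_iff_abs_tendsto_zero]
  rw [Metric.tendsto_atTop] at h4 ⊢
  intro ε hε
  obtain ⟨N, hN⟩ := h4 (ε ^ (2 * r)) (by positivity)
  refine ⟨N, fun n hn => ?_⟩
  have h5 := hN n hn
  rw [Real.dist_eq, sub_zero, abs_pow] at h5
  rw [Real.dist_eq, sub_zero]
  simp only [Function.comp_apply, abs_abs]
  exact lt_of_pow_lt_pow_left₀ _ hε.le h5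

end

/-! ### Fluctuations of weighted circuit sums -/

section

variable {Ω : Type*} [MeasurableSpace Ω] {ℙ : Measure Ω}
  {a : (n : ℕ) → Ω → Matrix (Fin n) (Fin n) ℝ} {R : (n : ℕ) → Setoid (Fin n × Fin n)}
  {C : ℕ → ℝ} {D : ℕ → ℕ → ℝ} {k : ℕ} {W : (n : ℕ) → (Fin (k + 1) → Fin n) → ℝ} {M : ℝ}

theorem IsSSBHKW.exists_bound (ha : IsSSBHKW ℙ a R C D) :
    ∃ B : ℕ, 1 ≤ B ∧ ∀ n (p q r : Fin n), countE2 (R n) p q r ≤ B := by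
  obtain ⟨B, hB⟩ := ha.condE2
  exact ⟨max B 1, le_max_right _ _, fun n p q r => (hB n p q r).trans (le_max_left _ _)⟩

theorem IsSSBHKW.scaled_integral_pow_le [IsProbabilityMeasure ℙ]
    (ha : IsSSBHKW ℙ a R C D)
    (S : (n : ℕ) → Finset (Fin (k + 1) → Fin n)) (N n : ℕ) (b : ℝ)
    (h : |∫ ω, (∑ p ∈ S n, W n p * circProd (a n ω) p) ^ N ∂ℙ| ≤ b) :
    Integrable (fun ω => ((∑ p ∈ S n, W n p * circProd (a n ω) p) / (n : ℝ) ^ circExp k) ^ N) ℙ ∧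
    ∫ ω, ((∑ p ∈ S n, W n p * circProd (a n ω) p) / (n : ℝ) ^ circExp k) ^ N ∂ℙ ≤
      b / ((n : ℝ) ^ circExp k) ^ N := by
  simp only [div_pow]
  refine ⟨(ha.integral_sum_pow (W n) (S n) N).1.div_const _, ?_⟩
  rw [integral_div]
  gcongr
  exact (le_abs_self _).trans h

theorem IsSSBHKW.exists_unpaired_bound [IsProbabilityMeasure ℙ]
    (ha : IsSSBHKW ℙ a R C D)
    (hW : ∀ n p, |W n p| ≤ M) (N : ℕ) :
    ∃ c, ∀ n, 1 ≤ n →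
      Integrable (fun ω => ((∑ p ∈ unpaired (R n) k, W n p * circProd (a n ω) p) /
        (n : ℝ) ^ circExp k) ^ N) ℙ ∧
      ∫ ω, ((∑ p ∈ unpaired (R n) k, W n p * circProd (a n ω) p) / (n : ℝ) ^ circExp k) ^ N ∂ℙ ≤
        c * (n : ℝ) ^ (-(N / 6 : ℝ)) := by
  obtain ⟨B, hB1, hB⟩ := ha.exists_bound
  refine ⟨M ^ N * |C (N * (k + 1))| *
      (Fintype.card (Fin N × Fin (k + 1) → Finset (Fin N × Fin (k + 1))) *
        B ^ (N * (k + 1)) : ℕ), fun n hn => ?_⟩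
  have hn0 : (0 : ℝ) < n := by exact_mod_cast hn
  obtain ⟨h1, h2⟩ := ha.scaled_integral_pow_le (fun n => unpaired (R n) k) N n _
    (ha.abs_integral_unpaired_pow_le hn hB1 (hB n) (hW n) N)
  refine ⟨h1, h2.trans (le_of_eq ?_)⟩
  rw [← mul_assoc, mul_div_assoc, ← div_pow, ← Real.rpow_sub hn0, ← Real.rpow_mul_natCast hn0.le]
  congr 2
  ring

theorem IsSSBHKW.exists_badPaired_bound [IsProbabilityMeasure ℙ]
    (ha : IsSSBHKW ℙ a R C D) (hM : 0 ≤ M)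
    (hW : ∀ n p, |W n p| ≤ M) (N : ℕ) :
    ∃ c, ∀ n, 1 ≤ n →
      Integrable (fun ω => ((∑ p ∈ badPaired (R n) k, W n p * circProd (a n ω) p) /
        (n : ℝ) ^ circExp k) ^ N) ℙ ∧
      ∫ ω, ((∑ p ∈ badPaired (R n) k, W n p * circProd (a n ω) p) / (n : ℝ) ^ circExp k) ^ N ∂ℙ ≤
        c * ((maxE1 (R n) + countE3 (R n)) / (n : ℝ) ^ 2) ^ N := by
  obtain ⟨B, hB1, hB⟩ := ha.exists_bound
  set c' : ℝ := ((Fintype.card ((Fin (k + 1) → Finset (Fin (k + 1))) × Fin (k + 1) ×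
    Fin (k + 1) × Fin (k + 1) × Fin (k + 1)) * B ^ (k + 1) : ℕ) : ℝ) with hc'
  refine ⟨M ^ N * |C (N * (k + 1))| * c' ^ N, fun n hn => ?_⟩
  have hn0 : (0 : ℝ) < n := by exact_mod_cast hn
  obtain ⟨h1, h2⟩ := ha.scaled_integral_pow_le (fun n => badPaired (R n) k) N n _
    (ha.abs_integral_sum_pow_le hM (hW n) (badPaired (R n) k) N)
  refine ⟨h1, h2.trans ?_⟩
  have h3 := card_badPaired_le (k := k) hn hB1 (hB n) (ha.rel_swap n)
  rw [mul_div_assoc, ← div_pow, mul_assoc (_ * _), ← mul_pow]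
  gcongr
  rw [div_le_iff₀ (by positivity)]
  refine h3.trans (le_of_eq ?_)
  rw [← hc', Real.rpow_sub hn0, Real.rpow_two]
  field_simp

/-- Relative to the square of the normalisation, linked pairs contribute `maxE1 / n³`, and all other
pairs contribute the errors of (A2). -/
theorem IsSSBHKW.exists_treeLike_bound [IsProbabilityMeasure ℙ]
    (ha : IsSSBHKW ℙ a R C D) (hM : 0 ≤ M)
    (hW : ∀ n p, |W n p| ≤ M) :
    ∃ c, 0 ≤ c ∧ ∀ n, 1 ≤ n →
      Integrable (fun ω => ((∑ p ∈ treeLike (R n) k, W n p * (circProd (a n ω) p - 1)) /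
        (n : ℝ) ^ circExp k) ^ 2) ℙ ∧
      ∫ ω, ((∑ p ∈ treeLike (R n) k, W n p * (circProd (a n ω) p - 1)) /
        (n : ℝ) ^ circExp k) ^ 2 ∂ℙ ≤
        c * (maxE1 (R n) / (n : ℝ) ^ 3 + (|D (k + 1) n| + 2 * |D ((k + 1) / 2) n|)) := by
  obtain ⟨B, hB1, hB⟩ := ha.exists_bound
  set c₁ : ℝ := ((Fintype.card ((Fin 2 → Fin (k + 1) → Finset (Fin (k + 1))) ×
    (Fin 2 → Fin (k + 1))) * B ^ (2 * (k + 1)) : ℕ) : ℝ) with hc₁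
  set c₂ : ℝ :=
    ((Fintype.card (Fin (k + 1) → Finset (Fin (k + 1))) * B ^ (k + 1) : ℕ) : ℝ) with hc₂
  set c₀ : ℝ := |C (2 * (k + 1))| + 2 * |C (k + 1)| + 1 with hc₀
  refine ⟨M ^ 2 * (c₀ * c₁ + c₂ ^ 2), by positivity, fun n hn => ?_⟩
  have hn0 : (0 : ℝ) < n := by exact_mod_cast hn
  obtain ⟨h1, h2⟩ := ha.integral_treeLike_sq_le (n := n) hM (hW n)
  simp only [div_pow]
  refine ⟨h1.div_const _, ?_⟩
  rw [integral_div, div_le_iff₀ (by positivity)]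
  refine h2.trans ?_
  have h3 := card_linkedPairs_le (k := k) hn hB1 (hB n) (ha.rel_swap n)
  have h4 := card_treeLike_le_rpow (k := k) hn hB1 (hB n) (ha.rel_swap n)
  rw [← hc₁] at h3
  rw [← hc₂] at h4
  set d := |D (k + 1) n| + 2 * |D ((k + 1) / 2) n| with hd
  have hd0 : 0 ≤ d := by positivity
  set E : ℝ := maxE1 (R n) / (n : ℝ) ^ 3 with hE
  have hE0 : 0 ≤ E := by positivity
  set Q : ℝ := ((n : ℝ) ^ circExp k) ^ 2 with hQ
  have hQ0 : 0 ≤ Q := by positivity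
  have h5 : (maxE1 (R n) : ℝ) * (n : ℝ) ^ (2 * circExp k - 3) = E * Q := by
    rw [Real.rpow_sub hn0, mul_comm 2, Real.rpow_mul hn0.le, Real.rpow_two,
      show (3 : ℝ) = ((3 : ℕ) : ℝ) by norm_num, Real.rpow_natCast]
    ring
  rw [h5] at h3
  have h6 : ((treeLike (R n) k).card : ℝ) ^ 2 ≤ c₂ ^ 2 * Q := by
    rw [hQ, ← mul_pow]
    gcongr
  calc M ^ 2 * (c₀ * (linkedPairs (R n) k).card + d * ((treeLike (R n) k).card : ℝ) ^ 2)
      ≤ M ^ 2 * (c₀ * (c₁ * (E * Q)) + d * (c₂ ^ 2 * Q)) := by gcongr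
    _ = M ^ 2 * (c₀ * c₁ * E + c₂ ^ 2 * d) * Q := by ring
    _ ≤ M ^ 2 * ((c₀ * c₁ + c₂ ^ 2) * (E + d)) * Q := by
        gcongr
        have i1 : 0 ≤ c₀ * c₁ * d := by positivity
        have i2 : 0 ≤ c₂ ^ 2 * E := by positivity
        nlinarith
    _ = _ := by ring

/-- The fluctuation of a weighted circuit sum around the contribution of tree-like circuits. -/
theorem circSum_split (R : (n : ℕ) → Setoid (Fin n × Fin n)) (n : ℕ)
    (A : Matrix (Fin n) (Fin n) ℝ) (V : (Fin (k + 1) → Fin n) → ℝ) (Q : ℝ) :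
    (∑ p, V p * circProd A p - ∑ p ∈ treeLike (R n) k, V p) / Q =
      (∑ p ∈ unpaired (R n) k, V p * circProd A p) / Q +
      (∑ p ∈ badPaired (R n) k, V p * circProd A p) / Q +
      (∑ p ∈ treeLike (R n) k, V p * (circProd A p - 1)) / Q := by
  rw [sum_eq_sum_types (R n)]
  simp only [mul_sub, mul_one, Finset.sum_sub_distrib]
  ring

theorem IsSSBHKW.tendsto_scaled_counts (ha : IsSSBHKW ℙ a R C D) :
    Tendsto (fun n => ((maxE1 (R n) : ℝ) + countE3 (R n)) / (n : ℝ) ^ 2) atTop (𝓝 0) :=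
  (ha.condE1.add ha.condE3).tendsto_div_nhds_zero

theorem IsSSBHKW.vanishInProb_circSum [IsProbabilityMeasure ℙ]
    (ha : IsSSBHKW ℙ a R C D) (hM : 0 ≤ M)
    (hW : ∀ n p, |W n p| ≤ M) :
    VanishInProb ℙ fun n ω => (∑ p, W n p * circProd (a n ω) p -
      ∑ p ∈ treeLike (R n) k, W n p) / (n : ℝ) ^ circExp k := by
  simp only [circSum_split R]
  obtain ⟨c₁, h₁⟩ := ha.exists_unpaired_bound (k := k) hW (2 * 1)
  obtain ⟨c₂, h₂⟩ := ha.exists_badPaired_bound (k := k) hM hW (2 * 1)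
  obtain ⟨c₃, -, h₃⟩ := ha.exists_treeLike_bound (k := k) hM hW
  refine ((vanishInProb_of_integral_pow_le (fun n hn => (h₁ n hn).1) (fun n hn => (h₁ n hn).2) ?_).add
    (vanishInProb_of_integral_pow_le (fun n hn => (h₂ n hn).1) (fun n hn => (h₂ n hn).2) ?_)).add
    (vanishInProb_of_integral_pow_le (r := 1) (fun n hn => (h₃ n hn).1) (fun n hn => (h₃ n hn).2) ?_)
  · have := ((tendsto_rpow_neg_atTop (y := ((2 * 1 : ℕ) : ℝ) / 6) (by norm_num)).comp
      tendsto_natCast_atTop_atTop).const_mul c₁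
    simpa using this
  · have := (ha.tendsto_scaled_counts.pow (2 * 1)).const_mul c₂
    simpa using this
  · have h4 : Tendsto (fun n => (maxE1 (R n) : ℝ) / (n : ℝ) ^ 3) atTop (𝓝 0) := by
      have h5 := ha.condE1.tendsto_div_nhds_zero.mul tendsto_one_div_atTop_nhds_zero_nat
      rw [zero_mul] at h5
      refine h5.congr fun n => ?_
      rw [div_mul_div_comm, mul_one]
      ring
    have h5 := (ha.tendsto_D (k + 1)).abs.add ((ha.tendsto_D ((k + 1) / 2)).abs.const_mul 2)
    have := (h4.add h5).const_mul c₃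
    simpa using this

theorem StrongE.exists_bound (h : StrongE R) : ∃ δ c : ℝ, 0 < δ ∧ 0 ≤ c ∧ ∃ n₀ : ℕ, ∀ n, n₀ ≤ n →
    ((maxE1 (R n) : ℝ) + countE3 (R n)) / (n : ℝ) ^ 2 ≤ c * (n : ℝ) ^ (-δ) := by
  obtain ⟨δ, hδ, h1, h2⟩ := h
  obtain ⟨c, hc, hb⟩ := (h1.add h2).exists_nonneg
  obtain ⟨n₀, hn₀⟩ := eventually_atTop.1 hb.bound
  refine ⟨δ, c, hδ, hc, max n₀ 1, fun n hn => ?_⟩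
  have h3 := hn₀ n ((le_max_left _ _).trans hn)
  have hn0 : (0 : ℝ) < n := by exact_mod_cast (le_max_right n₀ 1).trans hn
  rw [Real.norm_of_nonneg (by positivity), Real.norm_of_nonneg (by positivity)] at h3
  rw [div_le_iff₀ (by positivity)]
  refine h3.trans (le_of_eq ?_)
  rw [mul_assoc, ← Real.rpow_two, ← Real.rpow_add hn0]
  congr 2
  ring

theorem IsSSBHKW.vanishAS_circSum [IsProbabilityMeasure ℙ]
    (ha : IsSSBHKW ℙ a R C D) (hE : StrongE R)
    (hD : ∀ s, Summable (D s)) (hM : 0 ≤ M) (hW : ∀ n p, |W n p| ≤ M) :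
    VanishAS ℙ fun n ω => (∑ p, W n p * circProd (a n ω) p -
      ∑ p ∈ treeLike (R n) k, W n p) / (n : ℝ) ^ circExp k := by
  simp only [circSum_split R]
  obtain ⟨δ, c, hδ, hc, n₀, hb⟩ := hE.exists_bound
  -- The moment of order `2r` of the badly paired part decays like `n^{-2rδ}`, summable once `2rδ >
  -- 1`.
  obtain ⟨r, hr⟩ := exists_nat_gt (1 / (2 * δ))
  -- The twelfth moment decays like `n^{-12/6} = n^{-2}`.
  obtain ⟨c₁, h₁⟩ := ha.exists_unpaired_bound (k := k) hW (2 * 6)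
  obtain ⟨c₂, h₂⟩ := ha.exists_badPaired_bound (k := k) hM hW (2 * r)
  obtain ⟨c₃, -, h₃⟩ := ha.exists_treeLike_bound (k := k) hM hW
  have a1 : VanishAS ℙ fun n ω => (∑ p ∈ unpaired (R n) k, W n p * circProd (a n ω) p) /
        (n : ℝ) ^ circExp k := by
    refine vanishAS_of_integral_pow_le (r := 6) (fun n hn => (h₁ n hn).1)
      (fun n hn => (h₁ n hn).2) (Summable.mul_left c₁ ?_)
    exact Real.summable_nat_rpow.2 (by norm_num)
  have a2 : VanishAS ℙ fun n ω => (∑ p ∈ badPaired (R n) k, W n p * circProd (a n ω) p) /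
        (n : ℝ) ^ circExp k := by
    refine vanishAS_of_integral_pow_le (fun n hn => (h₂ n hn).1)
      (fun n hn => (h₂ n hn).2) (Summable.mul_left c₂ ?_)
    have hs : Summable fun n : ℕ => c ^ (2 * r) * (n : ℝ) ^ (-δ * (2 * r)) := by
      refine Summable.mul_left _ (Real.summable_nat_rpow.2 ?_)
      rw [div_lt_iff₀ (by positivity)] at hr
      linarith
    refine (summable_nat_add_iff n₀).1 (Summable.of_nonneg_of_le (fun n => by positivity)
      (fun n => ?_) ((summable_nat_add_iff n₀).2 hs))
    refine (pow_le_pow_left₀ (by positivity) (hb (n + n₀) (by omega)) _).trans (le_of_eq ?_)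
    rw [mul_pow, ← Real.rpow_mul_natCast (by positivity)]
    push_cast
    rfl
  have a3 : VanishAS ℙ fun n ω => (∑ p ∈ treeLike (R n) k, W n p * (circProd (a n ω) p - 1)) /
        (n : ℝ) ^ circExp k := by
    refine vanishAS_of_integral_pow_le (r := 1) (fun n hn => (h₃ n hn).1)
      (fun n hn => (h₃ n hn).2) (Summable.mul_left c₃ ?_)
    refine Summable.add ?_ ((hD _).abs.add ((hD _).abs.mul_left 2))
    -- Second moments suffice for the tree-like part: linked pairs gain an extra factor `1/n`, and
    -- the sequences `D s` are summable by assumption.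
    have hs : Summable fun n : ℕ => c * (n : ℝ) ^ (-δ - 1) :=
      Summable.mul_left _ (Real.summable_nat_rpow.2 (by linarith))
    refine (summable_nat_add_iff (n₀ + 1)).1 (Summable.of_nonneg_of_le (fun n => by positivity)
      (fun n => ?_) ((summable_nat_add_iff (n₀ + 1)).2 hs))
    set m := n + (n₀ + 1) with hm
    have hm0 : (0 : ℝ) < m := by exact_mod_cast (show 0 < m by omega)
    have h4 := hb m (by omega)
    have h5 : (maxE1 (R m) : ℝ) / (m : ℝ) ^ 2 ≤ c * (m : ℝ) ^ (-δ) := by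
      refine le_trans ?_ h4
      gcongr
      simp
    rw [Real.rpow_sub hm0, Real.rpow_one, ← mul_div_assoc, le_div_iff₀ hm0]
    refine le_trans (le_of_eq ?_) h5
    field_simp
  filter_upwards [a1, a2, a3] with ω w1 w2 w3
  simpa using (w1.add w2).add w3

end

/-! ### Spectral moments and traces -/

section

variable {n : ℕ}

theorem trace_pow_eq_sum_eigenvalues {A : Matrix (Fin n) (Fin n) ℝ} (hA : A.IsHermitian) (k : ℕ) :
    (A ^ k).trace = ∑ i, hA.eigenvalues i ^ k := by
  conv_lhs => rw [hA.spectral_theorem]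
  rw [← map_pow, Matrix.diagonal_pow, Unitary.conjStarAlgAut_apply, Matrix.trace_mul_cycle,
    Unitary.coe_star_mul_self, one_mul, Matrix.trace_diagonal]
  simp

theorem esd_eq {A : Matrix (Fin n) (Fin n) ℝ} (hA : A.IsHermitian) :
    esd A = (n : ENNReal)⁻¹ • ∑ i, Measure.dirac (hA.eigenvalues i) := by
  rw [esd, hA.roots_charpoly_eq_eigenvalues, Multiset.map_map]
  rfl

theorem isProbabilityMeasure_esd (hn : 0 < n) {A : Matrix (Fin n) (Fin n) ℝ} (hA : A.IsSymm) :
    IsProbabilityMeasure (esd A) := by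
  have hA' : A.IsHermitian := hA
  constructor
  rw [esd_eq hA']
  simp only [Measure.smul_apply, Measure.coe_finsetSum, Finset.sum_apply, measure_univ,
    Finset.sum_const, Finset.card_univ, Fintype.card_fin, smul_eq_mul, nsmul_eq_mul, mul_one]
  exact ENNReal.inv_mul_cancel (by exact_mod_cast hn.ne') (ENNReal.natCast_ne_top n)

theorem hasMoments_esd (hn : 0 < n) {A : Matrix (Fin n) (Fin n) ℝ} (hA : A.IsSymm) :
    HasMoments (esd A) fun k => (A ^ k).trace / n := by
  have hA' : A.IsHermitian := hA
  intro k
  have h1 : ∀ i ∈ (Finset.univ : Finset (Fin n)), Integrable (fun x : ℝ => x ^ k)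
      (Measure.dirac (hA'.eigenvalues i)) := fun i _ => integrable_dirac (by simp)
  rw [esd_eq hA']
  refine ⟨Integrable.smul_measure (integrable_finsetSum_measure.2 h1) ?_, ?_⟩
  · simpa using hn.ne'
  · rw [integral_smul_measure, integral_finsetSum_measure h1]
    simp only [integral_dirac, trace_pow_eq_sum_eigenvalues hA']
    rw [ENNReal.toReal_inv, ENNReal.toReal_natCast, smul_eq_mul, div_eq_inv_mul]

/-- The arbitrary function `h` of the two endpoints carries the induction on the length; taking `h i
j = A j i` closes the path to a circuit. -/
theorem sum_path_prod (A : Matrix (Fin n) (Fin n) ℝ) (k : ℕ) :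
    ∀ h : Fin n → Fin n → ℝ, ∑ q : Fin (k + 1) → Fin n,
      (∏ l : Fin k, A (q l.castSucc) (q l.succ)) * h (q 0) (q (Fin.last k)) =
      ∑ i, ∑ j, (A ^ k) i j * h i j := by
  induction k with
  | zero =>
    intro h
    rw [← (Equiv.funUnique (Fin 1) (Fin n)).symm.sum_comp]
    refine Finset.sum_congr rfl fun i _ => ?_
    simp [Matrix.one_apply]
  | succ k ih =>
    intro h
    rw [← (Fin.snocEquiv fun _ : Fin (k + 2) => Fin n).sum_comp, Fintype.sum_prod_type_right]
    have h1 := ih fun i l => ∑ j, A l j * h i j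
    have h2 : ∀ q : Fin (k + 1) → Fin n, ∑ j : Fin n,
        (∏ l : Fin (k + 1), A ((Fin.snocEquiv fun _ : Fin (k + 2) => Fin n) (j, q) l.castSucc)
          ((Fin.snocEquiv fun _ : Fin (k + 2) => Fin n) (j, q) l.succ)) *
          h ((Fin.snocEquiv fun _ : Fin (k + 2) => Fin n) (j, q) 0)
            ((Fin.snocEquiv fun _ : Fin (k + 2) => Fin n) (j, q) (Fin.last (k + 1))) =
        (∏ l : Fin k, A (q l.castSucc) (q l.succ)) * ∑ j, A (q (Fin.last k)) j * h (q 0) j := by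
      intro q
      rw [Finset.mul_sum]
      refine Finset.sum_congr rfl fun j _ => ?_
      have e : ∀ l : Fin (k + 1), (Fin.snocEquiv fun _ : Fin (k + 2) => Fin n) (j, q) l.castSucc =
          q l := fun l => by simp [Fin.snocEquiv]
      have e' : (Fin.snocEquiv fun _ : Fin (k + 2) => Fin n) (j, q) (Fin.last (k + 1)) = j := by
        simp [Fin.snocEquiv]
      rw [Fin.prod_univ_castSucc, Fin.succ_last, e', ← mul_assoc]
      simp only [e, Fin.succ_castSucc]
      rw [← Fin.castSucc_zero, e]
    simp only [h2]
    rw [h1]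
    refine Finset.sum_congr rfl fun i _ => ?_
    simp only [pow_succ, Matrix.mul_apply, Finset.mul_sum, Finset.sum_mul]
    rw [Finset.sum_comm]
    exact Finset.sum_congr rfl fun j _ => Finset.sum_congr rfl fun l _ => by ring

theorem trace_pow_eq_sum_circProd (A : Matrix (Fin n) (Fin n) ℝ) (k : ℕ) :
    (A ^ (k + 1)).trace = ∑ p : Fin (k + 1) → Fin n, circProd A p := by
  have h := sum_path_prod A k fun i j => A j i
  rw [Matrix.trace, pow_succ]
  simp only [Matrix.diag_apply, Matrix.mul_apply]
  rw [← h]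
  refine Finset.sum_congr rfl fun p _ => ?_
  rw [circProd, Fin.prod_univ_castSucc, Fin.last_add_one]
  refine congrArg (· * _) (Finset.prod_congr rfl fun l _ => ?_)
  rw [show l.castSucc + 1 = l.succ from Fin.ext (by simp)]

/-- The product of the weights along a circuit. -/
def circWeight (w : ℝ → ℝ) {k n : ℕ} (p : Fin (k + 1) → Fin n) : ℝ :=
  ∏ i, w (|(p i : ℝ) - (p (i + 1) : ℝ)| / n)

theorem abs_sub_div_mem (i j : Fin n) : |(i : ℝ) - (j : ℝ)| / n ∈ Set.Icc (0 : ℝ) 1 := by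
  have hn : (0 : ℝ) < n := by exact_mod_cast i.pos
  refine ⟨by positivity, ?_⟩
  rw [div_le_one hn, abs_le]
  have h1 : (i : ℝ) < n := by exact_mod_cast i.isLt
  have h2 : (j : ℝ) < n := by exact_mod_cast j.isLt
  have h3 : (0 : ℝ) ≤ i := by positivity
  have h4 : (0 : ℝ) ≤ j := by positivity
  constructor <;> linarith

theorem abs_circWeight_le {w : ℝ → ℝ} {M : ℝ} (hM : ∀ x ∈ Set.Icc (0 : ℝ) 1, |w x| ≤ M) {k : ℕ}
    (p : Fin (k + 1) → Fin n) : |circWeight w p| ≤ M ^ (k + 1) := by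
  rw [circWeight, Finset.abs_prod]
  refine (Finset.prod_le_prod (fun _ _ => abs_nonneg _)
    fun i _ => hM _ (abs_sub_div_mem _ _)).trans ?_
  simp

theorem weightedMatrix_isSymm (w : ℝ → ℝ) {A : Matrix (Fin n) (Fin n) ℝ} (hA : A.IsSymm) :
    (weightedMatrix w n A).IsSymm := by
  ext i j
  simp only [Matrix.transpose_apply, weightedMatrix, Matrix.of_apply]
  rw [abs_sub_comm, hA.apply]

theorem circProd_weightedMatrix (w : ℝ → ℝ) (A : Matrix (Fin n) (Fin n) ℝ) {k : ℕ}
    (p : Fin (k + 1) → Fin n) : circProd (weightedMatrix w n A) p =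
      (1 / √(n : ℝ)) ^ (k + 1) * (circWeight w p * circProd A p) := by
  simp only [circProd, weightedMatrix, Matrix.of_apply, circWeight, Finset.prod_mul_distrib,
    Finset.prod_const, Finset.card_univ, Fintype.card_fin]

theorem trace_weightedMatrix_pow (hn : 0 < n) (w : ℝ → ℝ) (A : Matrix (Fin n) (Fin n) ℝ) (k : ℕ) :
    (weightedMatrix w n A ^ (k + 1)).trace / n =
      (∑ p : Fin (k + 1) → Fin n, circWeight w p * circProd A p) / (n : ℝ) ^ circExp k := by
  have hn0 : (0 : ℝ) < n := by exact_mod_cast hn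
  rw [trace_pow_eq_sum_circProd]
  simp only [circProd_weightedMatrix]
  rw [← Finset.mul_sum, circExp, Real.rpow_add hn0, Real.rpow_one, Real.sqrt_eq_rpow, one_div,
    ← Real.rpow_neg hn0.le, ← Real.rpow_mul_natCast hn0.le,
    show -(1 / 2 : ℝ) * ((k + 1 : ℕ) : ℝ) = -(((k : ℝ) + 1) / 2) by push_cast; ring,
    Real.rpow_neg hn0.le]
  field_simp

end

/-! ### The contribution of tree-like circuits -/

section

variable {R : (n : ℕ) → Setoid (Fin n × Fin n)} {k : ℕ} {w : ℝ → ℝ}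

/-- Circuits that backtrack along `f`. -/
def backtracking (k : ℕ) (f : ℕ → ℕ) (n : ℕ) : Finset (Fin (k + 1) → Fin n) :=
  open Classical in Finset.univ.filter fun p => Backtracks (k + 1) f (circPath p)

/-- Every circuit backtracking along `f` factors uniquely through the canonical path, so these
circuits are the arbitrary labellings of its vertices. -/
theorem IsPartner.sum_backtracking {π : Ptn (k + 1)} {f : ℕ → ℕ} (hp : IsPartner π f)
    (hf : NCInv 0 (k + 1) f) (n : ℕ) :
    ∑ p ∈ backtracking k f n, circWeight w p =
      ∑ x : pathVertices π → Fin n, pathWeight w π (extendBy (fun i => (x i : ℝ) / n) 0) := by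
  classical
  have hmem : ∀ i, i ≤ k + 1 → canonicalPath π i ∈ pathVertices π := fun i hi =>
    hp.canonicalPath_mem hf hi
  set Φ : (pathVertices π → Fin n) → Fin (k + 1) → Fin n := fun x i =>
    x ⟨canonicalPath π i, hmem i i.isLt.le⟩ with hΦ
  have hΦp : ∀ x l (hl : l ≤ k + 1), circPath (Φ x) l = x ⟨canonicalPath π l, hmem l hl⟩ := by
    intro x l hl
    simp only [circPath, hΦ, Fin.ofNat_eq_cast, Fin.val_natCast]
    congr 2
    rcases hl.lt_or_eq with h | h
    · rw [Nat.mod_eq_of_lt h]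
    · rw [h, Nat.mod_self, canonicalPath_zero, hp.canonicalPath_length hf]
  have hsurj : ∀ v : pathVertices π, ∃ i : Fin (k + 1), canonicalPath π i = v := by
    intro v
    obtain ⟨i, hi, hv⟩ := hp.exists_canonicalPath_eq hf v.2
    rcases hi.lt_or_eq with h | h
    · exact ⟨⟨i, h⟩, hv⟩
    · exact ⟨0, by rw [← hv, h, hp.canonicalPath_length hf, Fin.val_zero, canonicalPath_zero]⟩
  symm
  refine Finset.sum_bij (fun x _ => Φ x) ?_ ?_ ?_ ?_
  · intro x _
    simp only [backtracking, Finset.mem_filter, Finset.mem_univ, true_and]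
    intro i hi hif
    have h1 := hf.maps i (Nat.zero_le _) hi
    obtain ⟨h2, h3⟩ := hp.backtracks hf i hi hif
    rw [hΦp x (f i) h1.2.le, hΦp x (i + 1) hi, hΦp x (f i + 1) h1.2, hΦp x i hi.le]
    exact ⟨congrArg x (Subtype.ext h2), congrArg x (Subtype.ext h3)⟩
  · intro x _ y _ h
    funext v
    obtain ⟨i, hi⟩ := hsurj v
    have := congrFun h i
    simp only [hΦ] at this
    have e : (⟨canonicalPath π i, hmem i i.isLt.le⟩ : pathVertices π) = v := Subtype.ext hi
    rwa [e] at this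
  · intro p hpb
    simp only [backtracking, Finset.mem_filter, Finset.mem_univ, true_and] at hpb
    choose g hg using hsurj
    refine ⟨fun v => p (g v), Finset.mem_univ _, ?_⟩
    funext i
    simp only [hΦ]
    rw [← circPath_val p, ← circPath_val p i]
    exact hp.eq_of_canonicalPath_eq hf hpb (k + 1) le_rfl _ (Fin.isLt _).le _ i.isLt.le (hg _)
  · intro x _
    rw [pathWeight, circWeight, ← Fin.prod_univ_eq_prod_range
      (fun i => w |extendBy (fun i => (x i : ℝ) / n) 0 (canonicalPath π i) -
        extendBy (fun i => (x i : ℝ) / n) 0 (canonicalPath π ((i + 1) % (k + 1)))|) (k + 1)]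
    refine Finset.prod_congr rfl fun i _ => ?_
    rw [hp.canonicalPath_mod hf i.isLt, extendBy_of_mem (hmem i i.isLt.le),
      extendBy_of_mem (hmem (i + 1) i.isLt), ← circPath_val_add_one (Φ x) i,
      hΦp x (i + 1) i.isLt, ← sub_div, abs_div, Nat.abs_cast]

/-- A Riemann sum over a cube: the number of vertices equals the exponent `circExp k`, so the
normalisation is exactly the number of grid points. -/
theorem IsPartner.tendsto_sum_backtracking {π : Ptn (k + 1)} {f : ℕ → ℕ} (hp : IsPartner π f)
    (hf : NCInv 0 (k + 1) f) (hw : RiemannIntegrableUnit w) :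
    Tendsto (fun n : ℕ => (∑ p ∈ backtracking k f n, circWeight w p) / (n : ℝ) ^ circExp k)
      atTop (𝓝 (J w π)) := by
  obtain ⟨M, -, hM⟩ := hw.bounded
  have h := tendsto_grid_sum (hp.ae_continuousAt_pathWeight hf hw) (M := M ^ (k + 1))
    fun y hy => pathWeight_extendBy_abs_le hM π (extendBy_mem hy (by simp))
  rw [J_eq_integral]
  refine h.congr fun n => ?_
  have h1 : ((2 * Fintype.card (pathVertices π) : ℕ) : ℝ) = ((k + 1 + 2 : ℕ) : ℝ) := by
    rw [hp.card_pathVertices hf]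
  push_cast at h1
  rw [hp.sum_backtracking hf, ← natPow_eq_rpow_circExp (m := Fintype.card (pathVertices π))
    (by rw [circExp]; linarith), div_eq_inv_mul]

end

/-! ### Backtracking circuits and their edge classes -/

section

variable {n B k : ℕ} {R : Setoid (Fin n × Fin n)}

theorem Backtracks.mem_circClass {f : ℕ → ℕ} (hf : NCInv 0 (k + 1) f)
    (hsw : ∀ p q, R (p, q) (q, p)) {p : Fin (k + 1) → Fin n}
    (hb : Backtracks (k + 1) f (circPath p)) {i j : Fin (k + 1)} (hij : (j : ℕ) = f i) :
    j ∈ circClass R p i := by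
  have key : ∀ {i j : Fin (k + 1)}, (j : ℕ) = f i → (i : ℕ) < j →
      R (p i, p (i + 1)) (p j, p (j + 1)) := by
    intro i j hij hlt
    obtain ⟨h1, h2⟩ := hb i i.isLt (by omega)
    rw [← hij, circPath_val, circPath_val_add_one] at h1
    rw [← hij, circPath_val, circPath_val_add_one] at h2
    rw [h1, h2]
    exact hsw _ _
  rw [mem_edgeClass]
  have h1 := hf.ne i (Nat.zero_le _) i.isLt
  have h2 := hf.invol i
  rcases lt_or_gt_of_ne h1 with h | h
  · exact R.symm (key (by rw [hij, h2]) (by omega))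
  · exact key hij (by omega)

theorem Backtracks.two_le_card {f : ℕ → ℕ} (hf : NCInv 0 (k + 1) f)
    (hsw : ∀ p q, R (p, q) (q, p)) {p : Fin (k + 1) → Fin n}
    (hb : Backtracks (k + 1) f (circPath p)) (i : Fin (k + 1)) :
    ∃ j : Fin (k + 1), (j : ℕ) = f i ∧ j ≠ i ∧ {i, j} ⊆ circClass R p i := by
  have h1 := hf.maps i (Nat.zero_le _) i.isLt
  have h2 := hf.ne i (Nat.zero_le _) i.isLt
  refine ⟨⟨f i, h1.2⟩, rfl, fun h => h2 (congrArg Fin.val h), fun l hl => ?_⟩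
  rcases (by simpa using hl : l = i ∨ l = ⟨f i, h1.2⟩) with rfl | rfl
  · exact (isClassMap_edgeClass _ _).self_mem _
  · exact Backtracks.mem_circClass hf hsw hb rfl

theorem Backtracks.mem_circClass_iff {f : ℕ → ℕ} (hf : NCInv 0 (k + 1) f)
    (hsw : ∀ p q, R (p, q) (q, p)) {p : Fin (k + 1) → Fin n}
    (hb : Backtracks (k + 1) f (circPath p)) (h2 : ∀ i, (circClass R p i).card = 2)
    (i j : Fin (k + 1)) : j ∈ circClass R p i ↔ j = i ∨ (j : ℕ) = f i := by
  obtain ⟨l, hl, hne, hsub⟩ := Backtracks.two_le_card hf hsw hb i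
  have he : {i, l} = circClass R p i :=
    Finset.eq_of_subset_of_card_le hsub (by rw [h2, Finset.card_pair hne.symm])
  rw [← he, Finset.mem_insert, Finset.mem_singleton, ← hl, Fin.ext_iff (b := l)]

/-- The case of a single circuit in `sum_unpaired_le`: without singleton classes every weight there
is `1`, so the sum counts circuits. -/
theorem card_unpaired_no_singles_le (hn : 0 < n) (hB1 : 1 ≤ B)
    (hB : ∀ p q r, countE2 R p q r ≤ B) (hsw : ∀ p q, R (p, q) (q, p))
    (S : Finset (Fin (k + 1) → Fin n)) (hS : ∀ p ∈ S, p ∈ unpaired R k)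
    (hS1 : ∀ p ∈ S, ∀ i, (circClass R p i).card ≠ 1) :
    (S.card : ℝ) ≤ (Fintype.card (Fin 1 × Fin (k + 1) → Finset (Fin 1 × Fin (k + 1))) *
      B ^ (1 * (k + 1)) : ℕ) * (n : ℝ) ^ (circExp k - 1 / 6) := by
  classical
  have h1 := sum_unpaired_le (k := k) hn hB1 hB hsw 1
  rw [pow_one] at h1
  refine le_trans ?_ h1
  have hinj : Function.Injective fun (p : Fin (k + 1) → Fin n) (_ : Fin 1) => p :=
    fun p p' h => congrFun h 0
  have hsub : S.map ⟨_, hinj⟩ ⊆ Fintype.piFinset (fun _ : Fin 1 => unpaired R k) := by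
    intro F hF
    obtain ⟨p, hp, rfl⟩ := Finset.mem_map.1 hF
    exact Fintype.mem_piFinset.2 fun _ => hS p hp
  refine le_trans (le_of_eq ?_) (Finset.sum_le_sum_of_subset_of_nonneg hsub
    fun F _ _ => by positivity)
  rw [Finset.sum_map, Finset.card_eq_sum_ones, Nat.cast_sum]
  refine Finset.sum_congr rfl fun p hp => ?_
  have h2 : singles R (fun _ : Fin 1 => p) = 0 := by
    rw [singles, Finset.card_eq_zero, Finset.filter_eq_empty_iff]
    rintro ⟨j, i⟩ - h
    apply hS1 p hp i
    refine Eq.trans ?_ h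
    rw [← card_filter_edgeClass (R := R) (fun _ : Fin 1 => p) j i]
    congr 1
    rw [Finset.filter_true_of_mem]
    exact fun y _ => Subsingleton.elim _ _
  simp [h2]

end

/-! ### The tree-like sum as a sum over non-crossing pairings -/

section

variable {R : (n : ℕ) → Setoid (Fin n × Fin n)} {k B : ℕ} {w : ℝ → ℝ}

theorem exists_partner_fun (k : ℕ) : ∃ f : Ptn (k + 1) → ℕ → ℕ, ∀ π ∈ ncPairings (k + 1),
    NCInv 0 (k + 1) (f π) ∧ IsPartner π (f π) := by
  have : ∀ π : Ptn (k + 1), ∃ f : ℕ → ℕ, π ∈ ncPairings (k + 1) →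
      NCInv 0 (k + 1) f ∧ IsPartner π f := by
    intro π
    by_cases h : π ∈ ncPairings (k + 1)
    · obtain ⟨f, hf⟩ := (mem_ncPairings.1 h).exists_partner
      exact ⟨f, fun _ => hf⟩
    · exact ⟨id, fun h' => absurd h' h⟩
  choose f hf using this
  exact ⟨f, hf⟩

/-- A circuit backtracking along `f π` is tree-like unless some class is larger than a pair. The
pieces for different `π` are disjoint, since the edge classes of a tree-like circuit determine its
pairing. -/
theorem sum_treeLike_eq {n : ℕ} {S : Setoid (Fin n × Fin n)} (hsw : ∀ p q, S (p, q) (q, p))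
    {f : Ptn (k + 1) → ℕ → ℕ}
    (hf : ∀ π ∈ ncPairings (k + 1), NCInv 0 (k + 1) (f π) ∧ IsPartner π (f π))
    (V : (Fin (k + 1) → Fin n) → ℝ) :
    ∑ p ∈ treeLike S k, V p = ∑ π ∈ ncPairings (k + 1),
      (∑ p ∈ backtracking k (f π) n, V p -
        ∑ p ∈ backtracking k (f π) n ∩ unpaired S k, V p) := by
  classical
  have h1 : treeLike S k = (ncPairings (k + 1)).biUnion
      fun π => backtracking k (f π) n \ unpaired S k := by
    ext p
    simp only [Finset.mem_biUnion, mem_treeLike, Finset.mem_sdiff, mem_unpaired, not_exists,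
      not_not, backtracking, Finset.mem_filter, Finset.mem_univ, true_and]
    constructor
    · intro h
      have h2 := h.card_eq_two
      obtain ⟨g, hg, hb, -⟩ := h
      obtain ⟨π, hπ, hp⟩ := hg.exists_ptn
      have hπ' := mem_ncPairings.2 hπ
      refine ⟨π, hπ', ?_, h2⟩
      rwa [(hf π hπ').2.fun_eq hp (hf π hπ').1 hg]
    · rintro ⟨π, hπ, hb, h2⟩
      exact ⟨f π, (hf π hπ).1, hb, Backtracks.mem_circClass_iff (hf π hπ).1 hsw hb h2⟩
  have hdisj : Set.PairwiseDisjoint (ncPairings (k + 1) : Set (Ptn (k + 1)))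
      fun π => backtracking k (f π) n \ unpaired S k := by
    intro π hπ π' hπ' hne
    refine Finset.disjoint_left.2 fun p hp hp' => hne ?_
    simp only [Finset.mem_sdiff, mem_unpaired, not_exists, not_not, backtracking,
      Finset.mem_filter, Finset.mem_univ, true_and] at hp hp'
    have h3 : f π = f π' := by
      funext l
      rcases lt_or_ge l (k + 1) with hl | hl
      · have i1 := (hf π hπ).1.maps l (Nat.zero_le _) hl
        have i2 := (hf π hπ).1.ne l (Nat.zero_le _) hl
        have i3 := (Backtracks.mem_circClass_iff (hf π hπ).1 hsw hp.1 hp.2 ⟨l, hl⟩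
          ⟨f π l, i1.2⟩).2 (Or.inr rfl)
        rcases (Backtracks.mem_circClass_iff (hf π' hπ').1 hsw hp'.1 hp'.2 _ _).1 i3 with h | h
        · exact absurd (congrArg Fin.val h) i2
        · exact h
      · rw [(hf π hπ).1.out l (Or.inr hl), (hf π' hπ').1.out l (Or.inr hl)]
    exact (hf π hπ).2.ptn_eq (h3 ▸ (hf π' hπ').2)
  rw [h1, Finset.sum_biUnion hdisj]
  refine Finset.sum_congr rfl fun π _ => ?_
  rw [eq_sub_iff_add_eq, ← Finset.sdiff_inter_self_left]
  exact Finset.sum_sdiff Finset.inter_subset_left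

/-- The backtracking sums give the constants `J`. The circuits to be subtracted have no singleton
class but some class that is not a pair, so their number is smaller by a factor `n^{-1/6}`. -/
theorem tendsto_treeLike_sum (hB1 : 1 ≤ B) (hB : ∀ n (p q r : Fin n), countE2 (R n) p q r ≤ B)
    (hsw : ∀ n (p q : Fin n), R n (p, q) (q, p)) (hw : RiemannIntegrableUnit w) :
    Tendsto (fun n : ℕ => (∑ p ∈ treeLike (R n) k, circWeight w p) / (n : ℝ) ^ circExp k)
      atTop (𝓝 (limitMoment w (k + 1))) := by
  obtain ⟨f, hf⟩ := exists_partner_fun k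
  obtain ⟨M, hM1, hM⟩ := hw.bounded
  have h1 : Tendsto (fun n : ℕ => ∑ π ∈ ncPairings (k + 1),
      ((∑ p ∈ backtracking k (f π) n, circWeight w p) / (n : ℝ) ^ circExp k -
        (∑ p ∈ backtracking k (f π) n ∩ unpaired (R n) k, circWeight w p) / (n : ℝ) ^ circExp k))
      atTop (𝓝 (∑ π ∈ ncPairings (k + 1), (J w π - 0))) := by
    refine tendsto_finsetSum _ fun π hπ => Tendsto.sub
      ((hf π hπ).2.tendsto_sum_backtracking (hf π hπ).1 hw) ?_
    set c : ℝ := ((Fintype.card (Fin 1 × Fin (k + 1) → Finset (Fin 1 × Fin (k + 1))) *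
      B ^ (1 * (k + 1)) : ℕ) : ℝ) with hc
    have h2 : Tendsto (fun n : ℕ => c * M ^ (k + 1) * (n : ℝ) ^ (-(1 / 6 : ℝ))) atTop (𝓝 0) := by
      have := ((tendsto_rpow_neg_atTop (y := (1 / 6 : ℝ)) (by norm_num)).comp
        tendsto_natCast_atTop_atTop).const_mul (c * M ^ (k + 1))
      simpa using this
    refine squeeze_zero_norm' ?_ h2
    filter_upwards [eventually_ge_atTop 1] with n hn
    have hn0 : (0 : ℝ) < n := by exact_mod_cast hn
    rw [Real.norm_eq_abs, abs_div, abs_of_nonneg (Real.rpow_nonneg hn0.le _),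
      div_le_iff₀ (Real.rpow_pos_of_pos hn0 _)]
    refine (Finset.abs_sum_le_sum_abs _ _).trans ((Finset.sum_le_card_nsmul _ _ (M ^ (k + 1))
      fun p _ => abs_circWeight_le hM p).trans ?_)
    have h3 := card_unpaired_no_singles_le hn hB1 (hB n) (hsw n)
      (backtracking k (f π) n ∩ unpaired (R n) k) (fun p hp => (Finset.mem_inter.1 hp).2)
      (fun p hp i => by
        have hb := (Finset.mem_inter.1 hp).1
        simp only [backtracking, Finset.mem_filter, Finset.mem_univ, true_and] at hb
        obtain ⟨j, -, hne, hsub⟩ := Backtracks.two_le_card (hf π hπ).1 (hsw n) hb i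
        have := Finset.card_le_card hsub
        rw [Finset.card_pair hne.symm] at this
        omega)
    rw [← hc] at h3
    rw [nsmul_eq_mul]
    calc _ ≤ c * (n : ℝ) ^ (circExp k - 1 / 6) * M ^ (k + 1) := by gcongr
      _ = _ := by
        rw [mul_assoc (c * M ^ (k + 1)), ← Real.rpow_add hn0, neg_add_eq_sub]
        ring
  simp only [sub_zero] at h1
  refine h1.congr fun n => ?_
  rw [sum_treeLike_eq (hsw n) hf, Finset.sum_div]
  exact Finset.sum_congr rfl fun π _ => (sub_div _ _ _).symm

end

/-! ### Convergence of the spectral moments -/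

section

variable {Ω : Type*} {a : (n : ℕ) → Ω → Matrix (Fin n) (Fin n) ℝ} {R : (n : ℕ) → Setoid (Fin n × Fin n)}
  {C : ℕ → ℝ} {D : ℕ → ℕ → ℝ} {w : ℝ → ℝ}

/-- The `k`-th moment of the empirical spectral distribution of the weighted matrix. -/
def specMoment (w : ℝ → ℝ) (a : (n : ℕ) → Ω → Matrix (Fin n) (Fin n) ℝ) (k n : ℕ) (ω : Ω) : ℝ :=
  (weightedMatrix w n (a n ω) ^ k).trace / n

theorem specMoment_zero {n : ℕ} (hn : 0 < n) (ω : Ω) : specMoment w a 0 n ω = 1 := by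
  have : (n : ℝ) ≠ 0 := by exact_mod_cast hn.ne'
  simp [specMoment, Matrix.trace_one, this]

theorem specMoment_sub_eq {k n : ℕ} (hn : 0 < n) (ω : Ω) :
    (∑ p : Fin (k + 1) → Fin n, circWeight w p * circProd (a n ω) p - ∑ p ∈ treeLike (R n) k, circWeight w p) /
        (n : ℝ) ^ circExp k +
      ((∑ p ∈ treeLike (R n) k, circWeight w p) / (n : ℝ) ^ circExp k - limitMoment w (k + 1)) =
    specMoment w a (k + 1) n ω - limitMoment w (k + 1) := by
  rw [specMoment, trace_weightedMatrix_pow hn]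
  ring

variable [MeasurableSpace Ω] {ℙ : Measure Ω} [IsProbabilityMeasure ℙ]

theorem IsSSBHKW.vanishInProb_specMoment (ha : IsSSBHKW ℙ a R C D) (hw : RiemannIntegrableUnit w)
    (k : ℕ) : VanishInProb ℙ fun n ω => specMoment w a k n ω - limitMoment w k := by
  have hlim0 := limitMoment_zero (w := w)
  obtain ⟨B, hB1, hB⟩ := ha.exists_bound
  obtain ⟨M, hM1, hM⟩ := hw.bounded
  rcases k with _ | k
  · refine VanishInProb.congr (Z := fun _ _ => 0) (fun ε hε => ?_) ?_
    · simp [not_le.2 hε]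
    · filter_upwards [eventually_ge_atTop 1] with n hn ω
      rw [specMoment_zero hn, hlim0, sub_self]
  · have h1 := ha.vanishInProb_circSum (k := k) (M := M ^ (k + 1)) (by positivity)
      fun n p => abs_circWeight_le hM p
    have h2 := (tendsto_treeLike_sum (k := k) hB1 hB ha.rel_swap hw).sub_const (limitMoment w (k + 1))
    rw [sub_self] at h2
    refine (h1.add_of_tendsto h2).congr ?_
    filter_upwards [eventually_ge_atTop 1] with n hn ω
    exact specMoment_sub_eq hn ω

theorem IsSSBHKW.tendsto_specMoment (ha : IsSSBHKW ℙ a R C D) (hw : RiemannIntegrableUnit w)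
    (hE : StrongE R) (hD : ∀ s, Summable (D s)) (k : ℕ) :
    ∀ᵐ ω ∂ℙ, Tendsto (fun n => specMoment w a k n ω) atTop (𝓝 (limitMoment w k)) := by
  have hlim0 := limitMoment_zero (w := w)
  obtain ⟨B, hB1, hB⟩ := ha.exists_bound
  obtain ⟨M, hM1, hM⟩ := hw.bounded
  rcases k with _ | k
  · refine ae_of_all _ fun ω => tendsto_const_nhds.congr' ?_
    filter_upwards [eventually_ge_atTop 1] with n hn
    rw [specMoment_zero hn, hlim0]
  · have h1 := ha.vanishAS_circSum (k := k) (M := M ^ (k + 1)) hE hD (by positivity)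
      fun n p => abs_circWeight_le hM p
    have h2 := (tendsto_treeLike_sum (k := k) hB1 hB ha.rel_swap hw).sub_const (limitMoment w (k + 1))
    rw [sub_self] at h2
    filter_upwards [h1] with ω hω
    have h3 := (hω.add h2).add_const (limitMoment w (k + 1))
    rw [add_zero, zero_add] at h3
    refine h3.congr' ?_
    filter_upwards [eventually_ge_atTop 1] with n hn
    rw [specMoment_sub_eq hn ω, sub_add_cancel]

end

/-! ### Weak convergence of random measures from convergence of their moments -/

section

variable {Ω : Type*} [MeasurableSpace Ω] {ℙ : Measure Ω} {σ : ℕ → Ω → Measure ℝ}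
  {m' : ℕ → ℕ → Ω → ℝ} {m : ℕ → ℝ} {μ ν : Measure ℝ} {A R : ℝ}

/-- The exceptional events have total probability below `1` for large `n`, so they cannot cover the
whole space. -/
theorem VanishInProb.exists_forall_lt [IsProbabilityMeasure ℙ] {Z : ℕ → ℕ → Ω → ℝ}
    (hZ : ∀ k, VanishInProb ℙ (Z k)) (N K : ℕ) {ε : ℝ} (hε : 0 < ε) :
    ∃ n ≥ N, ∃ ω, ∀ k < K, |Z k n ω| < ε := by
  have h1 : Tendsto (fun n => ∑ k ∈ Finset.range K, ℙ {ω | ε ≤ |Z k n ω|}) atTop (𝓝 0) := by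
    simpa using tendsto_finsetSum (Finset.range K) fun k _ => hZ k ε hε
  obtain ⟨n, hn, hnN⟩ := ((h1.eventually (gt_mem_nhds zero_lt_one)).and
    (eventually_ge_atTop N)).exists
  by_contra! hcon
  have h2 : (Set.univ : Set Ω) ⊆ ⋃ k ∈ Finset.range K, {ω | ε ≤ |Z k n ω|} := by
    intro ω _
    obtain ⟨k, hk, h⟩ := hcon n hnN ω
    exact Set.mem_biUnion (Finset.mem_coe.2 (Finset.mem_range.2 hk)) h
  have h3 := (measure_mono h2).trans (measure_biUnion_finset_le (μ := ℙ) (Finset.range K) _)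
  rw [measure_univ] at h3
  exact absurd hn (not_lt.2 h3)

/-- Choose for each `j` a realisation whose first `j` moments are within `1/(j+1)` of `m`, and take
a weak limit. No criterion for the solvability of the moment problem is involved. -/
theorem exists_hasMoments_of_vanishInProb [IsProbabilityMeasure ℙ]
    (hσ : ∀ n, 0 < n → ∀ ω, IsProbabilityMeasure (σ n ω) ∧ HasMoments (σ n ω) fun k => m' k n ω)
    (hm : ∀ k, VanishInProb ℙ fun n ω => m' k n ω - m k) :
    ∃ μ : Measure ℝ, IsProbabilityMeasure μ ∧ HasMoments μ m := by
  have h1 : ∀ j : ℕ, ∃ n > 0, ∃ ω, ∀ k < j, |m' k n ω - m k| < 1 / ((j : ℝ) + 1) := fun j =>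
    VanishInProb.exists_forall_lt hm 1 j (by positivity)
  choose n hn ω hω using h1
  have (j : ℕ) : IsProbabilityMeasure (σ (n j) (ω j)) := (hσ _ (hn j) _).1
  obtain ⟨μ, -, hμ, -, hμm, -⟩ := exists_weak_limit_of_moments
    (σ := fun j => σ (n j) (ω j)) (m' := fun j k => m' k (n j) (ω j)) (m := m)
    (fun j => (hσ _ (hn j) _).2) fun k => by
      rw [tendsto_iff_norm_sub_tendsto_zero]
      refine squeeze_zero' (Eventually.of_forall fun _ => norm_nonneg _) ?_
        tendsto_one_div_add_atTop_nhds_zero_nat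
      filter_upwards [eventually_gt_atTop k] with j hj
      exact (hω j k hj).le
  exact ⟨μ, hμ, hμm⟩

theorem HasMoments.weakConvInProb [IsProbabilityMeasure μ] (hμ : HasMoments μ m) (hR : 0 ≤ R)
    (hmR : ∀ k, m (2 * k) ≤ A * R ^ (2 * k))
    (hσ : ∀ n, 0 < n → ∀ ω, IsProbabilityMeasure (σ n ω) ∧ HasMoments (σ n ω) fun k => m' k n ω)
    (hm : ∀ k, VanishInProb ℙ fun n ω => m' k n ω - m k) : WeakConvInProb ℙ σ μ := by
  intro f
  rw [tendstoInMeasure_iff_norm]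
  intro ε hε
  obtain ⟨δ, K, hδ, h⟩ := hμ.exists_moments_close hR hmR f hε
  have h1 : Tendsto (fun n => ∑ k ∈ Finset.range K, ℙ {ω | δ ≤ |m' k n ω - m k|}) atTop
      (𝓝 0) := by
    simpa using tendsto_finsetSum (Finset.range K) fun k _ => hm k δ hδ
  refine tendsto_of_tendsto_of_tendsto_of_le_of_le' tendsto_const_nhds h1
    (Eventually.of_forall fun _ => zero_le) ?_
  filter_upwards [eventually_gt_atTop 0] with n hn
  refine (measure_mono fun ω hω => ?_).trans
    (measure_biUnion_finset_le (μ := ℙ) (Finset.range K) _)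
  by_contra hcon
  simp only [Set.mem_iUnion, Finset.mem_range, Set.mem_ofPred_eq, not_exists, not_le] at hcon
  exact absurd (h _ _ (hσ n hn ω).1 (hσ n hn ω).2 hcon) (not_lt.2 hω)

/-- The exceptional null set comes from the countably many moments and thus does not depend on the
test function. -/
theorem HasMoments.weakConvAS [IsProbabilityMeasure μ] (hμ : HasMoments μ m) (hR : 0 ≤ R)
    (hmR : ∀ k, m (2 * k) ≤ A * R ^ (2 * k))
    (hσ : ∀ n, 0 < n → ∀ ω, IsProbabilityMeasure (σ n ω) ∧ HasMoments (σ n ω) fun k => m' k n ω)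
    (hm : ∀ k, ∀ᵐ ω ∂ℙ, Tendsto (fun n => m' k n ω) atTop (𝓝 (m k))) : WeakConvAS ℙ σ μ := by
  filter_upwards [ae_all_iff.2 hm] with ω hω f
  rw [Metric.tendsto_nhds]
  intro ε hε
  obtain ⟨δ, K, hδ, h⟩ := hμ.exists_moments_close hR hmR f hε
  have h1 : ∀ᶠ n in atTop, ∀ k ∈ Finset.range K, |m' k n ω - m k| < δ :=
    (Finset.range K).eventually_all.2 fun k _ => by
      simpa [Real.dist_eq] using (Metric.tendsto_nhds.1 (hω k)) δ hδ
  filter_upwards [h1, eventually_gt_atTop 0] with n h2 hn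
  exact h _ _ (hσ n hn ω).1 (hσ n hn ω).2 fun k hk => h2 k (Finset.mem_range.2 hk)

theorem WeakConvInProb.unique [IsProbabilityMeasure ℙ] [IsProbabilityMeasure μ]
    [IsProbabilityMeasure ν] (h : WeakConvInProb ℙ σ μ) (h' : WeakConvInProb ℙ σ ν) : μ = ν := by
  refine ext_of_forall_integral_eq_of_IsFiniteMeasure fun f => ?_
  have h1 := tendstoInMeasure_ae_unique (h f) (h' f)
  obtain ⟨_, h2⟩ := h1.exists
  exact h2

theorem WeakConvAS.unique [IsProbabilityMeasure ℙ] [IsProbabilityMeasure μ]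
    [IsProbabilityMeasure ν] (h : WeakConvAS ℙ σ μ) (h' : WeakConvAS ℙ σ ν) : μ = ν := by
  refine ext_of_forall_integral_eq_of_IsFiniteMeasure fun f => ?_
  obtain ⟨ω, h1, h2⟩ := (h.and h').exists
  exact tendsto_nhds_unique (h1 f) (h2 f)

theorem HasMoments.map_neg (hμ : HasMoments μ m) (hodd : ∀ k, ¬ Even k → m k = 0) :
    HasMoments (μ.map fun x => -x) m := by
  intro k
  have hmeas : AEMeasurable (fun x : ℝ => -x) μ := measurable_neg.aemeasurable
  have hs : AEStronglyMeasurable (fun x : ℝ => x ^ k) (μ.map fun x => -x) :=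
    (continuous_pow k).aestronglyMeasurable
  rw [integrable_map_measure hs hmeas, integral_map hmeas hs]
  rcases Nat.even_or_odd k with hk | hk
  · simpa [Function.comp_def, hk.neg_pow] using hμ k
  · have h0 := hodd k (Nat.not_even_iff_odd.2 hk)
    have h1 := hμ k
    rw [h0] at h1
    simpa [Function.comp_def, hk.neg_pow, integral_neg, h1.2, h0] using h1.1.neg

end

/-! ### The weighted ensemble and its rescaling -/

section

variable {Ω : Type*} [MeasurableSpace Ω] {ℙ : Measure Ω}
  {a : (n : ℕ) → Ω → Matrix (Fin n) (Fin n) ℝ} {R : (n : ℕ) → Setoid (Fin n × Fin n)}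
  {C : ℕ → ℝ} {D : ℕ → ℕ → ℝ} {w : ℝ → ℝ}

theorem IsSSBHKW.esd_smul (ha : IsSSBHKW ℙ a R C D) (w : ℝ → ℝ) (c : ℝ) {n : ℕ} (hn : 0 < n)
    (ω : Ω) : IsProbabilityMeasure (esd (c • weightedMatrix w n (a n ω))) ∧
      HasMoments (esd (c • weightedMatrix w n (a n ω))) fun k => c ^ k * specMoment w a k n ω := by
  have hs : (c • weightedMatrix w n (a n ω)).IsSymm :=
    (weightedMatrix_isSymm w (ha.symm n ω)).smul c
  refine ⟨isProbabilityMeasure_esd hn hs, ?_⟩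
  convert hasMoments_esd hn hs using 2 with k
  rw [specMoment, smul_pow, Matrix.trace_smul, smul_eq_mul, mul_div_assoc]

theorem VanishInProb.const_mul {Z : ℕ → Ω → ℝ} (h : VanishInProb ℙ Z) {c : ℝ} (hc : 0 < c) :
    VanishInProb ℙ fun n ω => c * Z n ω := by
  intro ε hε
  refine (h (ε / c) (by positivity)).congr fun n => ?_
  congr 1
  ext ω
  simp only [Set.mem_ofPred_eq, abs_mul, abs_of_pos hc, div_le_iff₀ hc, mul_comm c]

theorem IsSSBHKW.vanishInProb_scaled [IsProbabilityMeasure ℙ]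
    (ha : IsSSBHKW ℙ a R C D) (hw : RiemannIntegrableUnit w)
    {c : ℝ} (hc : 0 < c) (k : ℕ) :
    VanishInProb ℙ fun n ω => c ^ k * specMoment w a k n ω - c ^ k * limitMoment w k := by
  simpa only [mul_sub] using (ha.vanishInProb_specMoment hw k).const_mul (pow_pos hc k)

theorem IsSSBHKW.tendsto_scaled [IsProbabilityMeasure ℙ]
    (ha : IsSSBHKW ℙ a R C D) (hw : RiemannIntegrableUnit w)
    (hE : StrongE R) (hD : ∀ s, Summable (D s)) (c : ℝ) (k : ℕ) :
    ∀ᵐ ω ∂ℙ, Tendsto (fun n => c ^ k * specMoment w a k n ω) atTop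
      (𝓝 (c ^ k * limitMoment w k)) := by
  filter_upwards [ha.tendsto_specMoment hw hE hD k] with ω hω
  exact hω.const_mul _

theorem scaled_limitMoment_le {M c : ℝ} (hM : ∀ x ∈ Set.Icc (0 : ℝ) 1, |w x| ≤ M) (k : ℕ) :
    c ^ (2 * k) * limitMoment w (2 * k) ≤ 1 * (c * (2 * M)) ^ (2 * k) := by
  rw [mul_pow c, one_mul]
  exact mul_le_mul_of_nonneg_left ((limitMoment_le hM k).trans_eq (one_mul _))
    ((even_two_mul k).pow_nonneg c)

theorem scaled_limitMoment_of_phi_const (hw : RiemannIntegrableUnit w) (h0 : 0 < phi0 w)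
    (h : ∀ x ∈ Set.Icc (0 : ℝ) 1, phi w x = phi0 w) (k : ℕ) :
    (1 / √(phi0 w)) ^ k * limitMoment w k = semicircleMoment k := by
  rw [limitMoment_of_phi_const hw h]
  rcases Nat.even_or_odd k with hk | hk
  · obtain ⟨j, rfl⟩ := even_iff_exists_two_mul.1 hk
    rw [Nat.mul_div_cancel_left j two_pos, ← mul_assoc, pow_mul, ← mul_pow, div_pow,
      Real.sq_sqrt h0.le, one_pow, one_div_mul_cancel h0.ne', one_pow, one_mul]
  · rw [semicircleMoment, if_neg (Nat.not_even_iff_odd.2 hk), mul_zero, mul_zero]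

/-- The fourth moment alone decides: the condition reads `2∫φ² / φ₀² = 2`, which is equality in
Cauchy-Schwarz for `φ`. -/
theorem phi_const_of_scaled_limitMoment (hw : RiemannIntegrableUnit w) (h0 : 0 < phi0 w)
    (h : (1 / √(phi0 w)) ^ 4 * limitMoment w 4 = semicircleMoment 4) :
    ∀ x ∈ Set.Icc (0 : ℝ) 1, phi w x = phi0 w := by
  refine phi_eq_phi0_of_integral_sq hw ?_
  have h4 : √(phi0 w) ^ 4 = phi0 w ^ 2 := by
    rw [show 4 = 2 * 2 from rfl, pow_mul, Real.sq_sqrt h0.le]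
  have hc : semicircleMoment 4 = 2 := by
    rw [semicircleMoment, if_pos (by decide)]
    norm_num [catalan_eq_centralBinom_div, Nat.centralBinom, Nat.choose]
  rw [limitMoment_four hw, hc, div_pow, h4, one_pow] at h
  field_simp at h
  linarith

theorem HasMoments.semicircle_iff {m : ℕ → ℝ} {μ : Measure ℝ} [IsProbabilityMeasure μ]
    (hμ : HasMoments μ m) : μ = semicircle ↔ ∀ k, m k = semicircleMoment k := by
  constructor
  · rintro rfl k
    rw [← (hμ k).2, (semicircle_hasMoments k).2]
  · intro h
    have h1 : HasMoments μ semicircleMoment := by rwa [← funext h]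
    exact semicircle_hasMoments.unique h1 zero_le_two semicircleMoment_le

/-- The factor `c` serves both `X_n` itself (`c = 1`) and the normalised matrix (`c = 1/√φ₀`). -/
theorem IsSSBHKW.exists_limit_measure [IsProbabilityMeasure ℙ]
    (ha : IsSSBHKW ℙ a R C D) (hw : RiemannIntegrableUnit w)
    {c : ℝ} (hc : 0 < c) : ∃ μ : Measure ℝ, IsProbabilityMeasure μ ∧
      HasMoments μ (fun k => c ^ k * limitMoment w k) ∧
      WeakConvInProb ℙ (fun n ω => esd (c • weightedMatrix w n (a n ω))) μ ∧
      (StrongE R → (∀ s, Summable (D s)) →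
        WeakConvAS ℙ (fun n ω => esd (c • weightedMatrix w n (a n ω))) μ) := by
  obtain ⟨M, hM1, hM⟩ := hw.bounded
  have hσ : ∀ n, 0 < n → ∀ ω, IsProbabilityMeasure (esd (c • weightedMatrix w n (a n ω))) ∧
      HasMoments (esd (c • weightedMatrix w n (a n ω))) fun k => c ^ k * specMoment w a k n ω :=
    fun n hn ω => ha.esd_smul w c hn ω
  obtain ⟨μ, hμ, hμm⟩ := exists_hasMoments_of_vanishInProb
    (σ := fun n ω => esd (c • weightedMatrix w n (a n ω)))
    (m' := fun k n ω => c ^ k * specMoment w a k n ω) hσ (ha.vanishInProb_scaled hw hc)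
  have hR : 0 ≤ c * (2 * M) := by positivity
  exact ⟨μ, hμ, hμm,
    hμm.weakConvInProb hR (scaled_limitMoment_le hM) hσ (ha.vanishInProb_scaled hw hc),
    fun hE hD => hμm.weakConvAS hR (scaled_limitMoment_le hM) hσ (ha.tendsto_scaled hw hE hD c)⟩

end

/-! ### Equivalent forms of the semicircle law and the recursion for pairings -/

section

variable {w : ℝ → ℝ}

/-- The proposition `p` stands for the semicircle law in either mode of convergence; only its
reformulation in terms of moments matters. -/
theorem tfae_semicircle {p : Prop} (hw : RiemannIntegrableUnit w) (h0 : 0 < phi0 w)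
    (hp : p ↔ ∀ k, (1 / √(phi0 w)) ^ k * limitMoment w k = semicircleMoment k) :
    [p, ∃ c : ℝ, ∀ x ∈ Set.Icc (0 : ℝ) 1, phi w x = c,
      ∀ x ∈ Set.Icc (0 : ℝ) 1, phi w x = phi0 w,
      ∀ x ∈ Set.Icc (0 : ℝ) 1, phi w x = ∫ z in (0 : ℝ)..1, w z ^ 2,
      ∀ᵐ x ∂(volume.restrict (Set.Icc (0 : ℝ) 1)), w x ^ 2 = w (1 - x) ^ 2].TFAE := by
  tfae_have 4 ↔ 5 := phi_const_iff_symm hw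
  tfae_have 4 → 2 := fun h => ⟨_, h⟩
  tfae_have 2 → 3 := fun ⟨c, hc⟩ x hx => by rw [hc x hx, phi0_of_const hc]
  -- The constant is identified by its value at `0`, where `φ(0) = ∫ w²`.
  tfae_have 3 → 4 := fun h x hx => by
    rw [h x hx, ← h 0 (Set.left_mem_Icc.2 zero_le_one), phi_zero hw]
  tfae_have 1 → 3 := fun h => phi_const_of_scaled_limitMoment hw h0 (hp.1 h 4)
  tfae_have 3 → 1 := fun h => hp.2 (scaled_limitMoment_of_phi_const hw h0 h)
  tfae_finish

theorem IsNonCrossingPairing.J_eq_integral_removePair (hw : RiemannIntegrableUnit w) {k : ℕ}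
    {π : Ptn (k + 2)} (hπ : IsNonCrossingPairing π) {m : Fin (k + 1)}
    (hm : ({m.castSucc, m.succ} : Finset (Fin (k + 2))) ∈ π.parts) :
    J w π = ∫ x in (0 : ℝ)..1, phi w x * Jcond w (removePair π m) (canonicalPath π m) x := by
  obtain ⟨f, hf, hfp⟩ := hπ.exists_partner
  refine WeightedEnsemble.J_eq_integral_removePair hw hfp hf ?_
  have h : Linked π m (m + 1) :=
    ⟨_, hm, ⟨m.castSucc, by simp, rfl⟩, m.succ, by simp, rfl⟩
  have h1 := ((hfp _ _).1 h).2
  omega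

end

end WeightedEnsemble

end

open WeightedEnsemble in
theorem theorem3p2 {Ω : Type*} [MeasurableSpace Ω] (ℙ : Measure Ω) [IsProbabilityMeasure ℙ]
    (a : (n : ℕ) → Ω → Matrix (Fin n) (Fin n) ℝ)
    (R : (n : ℕ) → Setoid (Fin n × Fin n)) (C : ℕ → ℝ) (D : ℕ → ℕ → ℝ)
    (ha : IsSSBHKW ℙ a R C D)
    (w : ℝ → ℝ) (hw : RiemannIntegrableUnit w) :
    -- the limiting measure, its moments, and weak convergence
    (∃ μ : Measure ℝ, IsProbabilityMeasure μ ∧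
      WeakConvInProb ℙ (fun n ω => esd (weightedMatrix w n (a n ω))) μ ∧
      μ.map (fun x => -x) = μ ∧
      (∃ K : Set ℝ, IsCompact K ∧ μ Kᶜ = 0) ∧
      (∀ k : ℕ, Integrable (fun x => x ^ k) μ ∧ ∫ x, x ^ k ∂μ = ∑ π ∈ ncPairings k, J w π) ∧
      (∀ ν : Measure ℝ, IsProbabilityMeasure ν →
        (∀ k : ℕ, Integrable (fun x => x ^ k) ν ∧ ∫ x, x ^ k ∂ν = ∑ π ∈ ncPairings k, J w π) →
        ν = μ) ∧
      ∫ x, x ^ 2 ∂μ = phi0 w ∧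
      (StrongE R → (∀ s, Summable (D s)) →
        WeakConvAS ℙ (fun n ω => esd (weightedMatrix w n (a n ω))) μ)) ∧
    -- recursive calculation of the constants `J_w(π)`
    (∀ (k : ℕ) (π : Ptn (k + 2)) (m : Fin (k + 1)), IsNonCrossingPairing π →
      ({m.castSucc, m.succ} : Finset (Fin (k + 2))) ∈ π.parts →
      J w π = ∫ x in (0 : ℝ)..1, phi w x * Jcond w (removePair π m) (canonicalPath π m) x) ∧
    -- the limiting variance
    phi0 w = 2 * ∫ x in (0 : ℝ)..1, (1 - x) * w x ^ 2 ∧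
    (phi0 w = 0 ↔ ∀ᵐ x ∂(volume.restrict (Set.Icc (0 : ℝ) 1)), w x = 0) ∧
    -- characterization of the semicircle law
    (0 < phi0 w →
      [WeakConvInProb ℙ
          (fun n ω => esd ((1 / √(phi0 w)) • weightedMatrix w n (a n ω))) semicircle,
        ∃ c : ℝ, ∀ x ∈ Set.Icc (0 : ℝ) 1, phi w x = c,
        ∀ x ∈ Set.Icc (0 : ℝ) 1, phi w x = phi0 w,
        ∀ x ∈ Set.Icc (0 : ℝ) 1, phi w x = ∫ z in (0 : ℝ)..1, w z ^ 2,
        ∀ᵐ x ∂(volume.restrict (Set.Icc (0 : ℝ) 1)), w x ^ 2 = w (1 - x) ^ 2].TFAE ∧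
      (StrongE R → (∀ s, Summable (D s)) →
        [WeakConvAS ℙ
            (fun n ω => esd ((1 / √(phi0 w)) • weightedMatrix w n (a n ω))) semicircle,
          ∃ c : ℝ, ∀ x ∈ Set.Icc (0 : ℝ) 1, phi w x = c,
          ∀ x ∈ Set.Icc (0 : ℝ) 1, phi w x = phi0 w,
          ∀ x ∈ Set.Icc (0 : ℝ) 1, phi w x = ∫ z in (0 : ℝ)..1, w z ^ 2,
          ∀ᵐ x ∂(volume.restrict (Set.Icc (0 : ℝ) 1)), w x ^ 2 = w (1 - x) ^ 2].TFAE)) := by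
  obtain ⟨μ, hμ, hμm, hprob, has⟩ := ha.exists_limit_measure hw one_pos
  simp only [one_pow, one_mul, one_smul] at hμm hprob has
  obtain ⟨M, hM1, hM⟩ := hw.bounded
  have hR : (0 : ℝ) ≤ 2 * M := by positivity
  have hodd : ∀ k, ¬ Even k → limitMoment w k = 0 := fun k hk => limitMoment_of_not_even hk
  have huniq : ∀ ν : Measure ℝ, IsProbabilityMeasure ν → HasMoments ν (limitMoment w) → ν = μ :=
    fun ν _ hν => hμm.unique hν hR (limitMoment_le hM)
  -- Symmetry follows from uniqueness: the odd moments vanish, so the reflected measure has the same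
  -- moments.
  refine ⟨⟨μ, hμ, hprob, huniq _ (Measure.isProbabilityMeasure_map measurable_neg.aemeasurable)
    (hμm.map_neg hodd), ⟨Set.Icc (-(2 * M)) (2 * M), isCompact_Icc,
      hμm.measure_compl_Icc hR (limitMoment_le hM)⟩, hμm, huniq,
      (hμm 2).2.trans (limitMoment_two hw), has⟩,
    fun k π m hπ hm => hπ.J_eq_integral_removePair hw hm, phi0_eq hw, phi0_eq_zero_iff hw,
    fun h0 => ?_⟩
  obtain ⟨ν, hν, hνm, hνprob, hνas⟩ :=
    ha.exists_limit_measure hw (one_div_pos.2 (Real.sqrt_pos.2 h0))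
  -- The rescaled ensemble converges to `ν` in any case, so by uniqueness of limits the semicircle
  -- law holds exactly when `ν` is the semicircle distribution, that is, when the moments agree.
  refine ⟨tfae_semicircle hw h0 (Iff.trans ⟨fun h => hνprob.unique h, ?_⟩ hνm.semicircle_iff),
    fun hE hD => tfae_semicircle hw h0
      (Iff.trans ⟨fun h => (hνas hE hD).unique h, ?_⟩ hνm.semicircle_iff)⟩
  · rintro rfl
    exact hνprob
  · rintro rfl
    exact hνas hE hD
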